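/- Let $\kappa=1+\sqrt{2-2/\sqrt5}\approx 2.0514$ and let $\log$ denote the logarithm to base $2$. Let $T$ be a finite tree with $n\ge 1$ nodes, without prescribed order of the edges around its nodes, let $r$ be any node of $T$, chosen as root, and at every non-leaf let a *heavy* edge be selected, leading to a child with a largest subtree (ties broken arbitrarily); the other edges to children, and these children, are *light*. The heavy edges form the heavy paths (a single node is allowed); the *top node* of a heavy path is its node closest to $r$. Then $T$ has a planar straight-line drawing in the plane that 1. has perfect angular resolution: any two edges at a node $v$ are separated by an angle of at least $2\pi/\deg(v)$; 2. has no edge of length smaller than $1$; 3. is covered by a disk of radius $n^2\cdot n^{\log\kappa}$, where $n^2\cdot n^{\log\kappa}<n^{3.0367}$ if $n\ge2$; 4. is produced by the greedy balloon layout within the heavy-path framework, in the following sense. *Framework.* For every top node $u$ there is an *exclusive disk* of radius $X_u$ centred at $u$ that contains the drawing of the subtree rooted at $u$; $X_u=1$ if $u$ is a leaf of the rooted tree; and if $u\ne r$, the parent of $u$ is not in the interior of the disk, so that the edge to the parent crosses its boundary orthogonally. At every node $z$, the $\deg(z)$ edges lie on evenly spaced rays (spokes), and the exclusive disks of the light children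 of $z$ are arranged around $z$ by the greedy balloon layout (up to rotation and reflection); the edges to the parent and to the heavy child, where they exist, are on the free spokes. Let $x_z$ be the radius of the smallest disk centred at $z$ that covers these exclusive disks ($0$ if there are none). The disks of radius $x_z$ about the nodes $z$ of one heavy path have disjoint interiors and are contained in the exclusive disk of that path. *Greedy balloon layout.* Given are $d$ evenly spaced spokes from the origin, $f\in\{1,2\}$ of which have to stay free, and balloons (disks) of radii $r_1\le\dots\le r_{d-f}$. Put $\alpha(\varphi)=\frac{1+\sin(\varphi/2)}{\sin(\varphi/2)}$. Start with the list $S$ of all spokes in cyclic order and with $\mathrm{safe}=0$. While $|S|>f+2$, play a round: the spokes of even position in $S$ receive, in order, the smallest remaining balloons; on spoke $s$ the balloon of radius $\rho$ gets its centre at distance $c=\max\{\alpha(\varphi)\rho-\rho,\ \mathrm{safe}+\rho\}$, where $\varphi$ is the minimum of $\pi$ and twice the smallest angle between $s$ and another spoke of $S$; then $\mathrm{safe}$ becomes the largest of its old value and all $c+\rho$ of the round, and $S$ becomes the list of the spokes of odd position with the last one moved to the front. The round is a *wedge round* if $c>\mathrm{safe}+\rho$ (old value) for one of its balloons. Then,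 with $S=(s_1,s_2,\dots)$ and $\rho'\le\rho$ the remaining radii (only $\rho$ if one is left): - $f=1$, $|S|=2$: $\rho$ on $s_1$ at distance $\mathrm{safe}+\rho$. - $f=1$, $|S|=3$: $\rho$ at distance $\mathrm{safe}+\rho$ on $s_3$ if $\angle s_1s_2\le\angle s_2s_3$ and on $s_1$ otherwise, and $\rho'$ on the other one of $s_1,s_3$ at distance $\max\{\alpha(\pi/3)\rho'-\rho',\mathrm{safe}+\rho'\}$. - $f=2$, $|S|=3$: $\rho$ on $s_2$ at distance $\max\{\alpha(4\pi/5)\rho-\rho,\ t+\rho\}$, where $t=\mathrm{safe}\cdot\frac{\sin\beta+\cos\beta}{\sin\beta+1}$ with $\beta=2\pi/(2\ell-1)$ if there was a preceding round, it was a wedge round, and it started with $\ell$ spokes, and $t=\mathrm{safe}$ otherwise. - $f=2$, $|S|=4$: $\rho'$ on $s_2$ at distance $\max\{\alpha(4\pi/7)\rho'-\rho',\mathrm{safe}+\rho'\}$, and $\rho$ on $s_4$ at distance $\mathrm{safe}+\rho$. The remaining spokes stay free; if there are no balloons, all spokes do. -/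

import Mathlib

namespace BalloonTree

/-! ### Straight-line drawings of a graph in the plane -/

section Drawing

variable {V : Type*}

/-- The point set covered by the straight-line drawing of `G` with vertex positions `p`. -/
def drawing (G : SimpleGraph V) (p : V → ℂ) : Set ℂ :=
  Set.range p ∪ {z | ∃ u v, G.Adj u v ∧ z ∈ segment ℝ (p u) (p v)}

/-- `p` is a plane straight-line drawing of `G`: vertices are distinct points, an edge contains
no vertices but its ends, and two different edges meet at most in a common end. -/
structure IsPlanarStraightLine (G : SimpleGraph V) (p : V → ℂ) : Prop where
  injective : Function.Injective p
  vertex_edge : ∀ u v w, G.Adj u v → p w ∈ segment ℝ (p u) (p v) → w = u ∨ w = v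
  edge_edge : ∀ u v u' v', G.Adj u v → G.Adj u' v' → s(u, v) ≠ s(u', v') →
    segment ℝ (p u) (p v) ∩ segment ℝ (p u') (p v') ⊆ p '' (({u, v} : Set V) ∩ {u', v'})

/-- The number of edges incident to `v`. -/
noncomputable def deg (G : SimpleGraph V) (v : V) : ℕ := (G.neighborSet v).ncard

/-- Any two edges at a vertex `v` are separated by an angle of at least `2π / deg v`. -/
def HasPerfectAngularResolution (G : SimpleGraph V) (p : V → ℂ) : Prop :=
  ∀ v u w, G.Adj v u → G.Adj v w → u ≠ w →
    2 * Real.pi / (deg G v : ℝ) ≤ EuclideanGeometry.angle (p u) (p v) (p w)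

end Drawing

/-! ### The greedy balloon layout with free spokes

A star with `d` evenly spaced spokes is given by the spoke numbers `0, …, d - 1`; the direction of
spoke `s` is `2π s / d`, up to a rotation and possibly a reflection of the whole star. -/

/-- The constant `κ = 1 + √(2 - 2/√5) ≈ 2.0514`. -/
noncomputable def kappa : ℝ := 1 + √(2 - 2 / √5)

/-- A disk of radius `r` with centre on the axis of a wedge with opening angle `φ ≤ π` that touches
the boundary of the wedge is covered by the disk of radius `alpha φ * r` about the apex. -/
noncomputable def alpha (φ : ℝ) : ℝ := (1 + Real.sin (φ / 2)) / Real.sin (φ / 2)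

/-- The number of steps of size `2π / d` from spoke `a` to spoke `b` in cyclic direction. -/
def gap (d a b : ℕ) : ℕ := (b + d - a) % d

/-- The minimal angle, in steps of size `2π / d`, between `s` and another spoke of `S`. -/
def minGap (d : ℕ) (S : List ℕ) (s : ℕ) : ℕ :=
  ((S.filter (· ≠ s)).map fun t => min (gap d s t) (gap d t s)).foldr min d

/-- The spokes with even index (counted from one): those used in the current round. -/
def usedSpokes : List ℕ → List ℕ
  | _ :: b :: t => b :: usedSpokes t
  | _ => []

/-- The spokes with odd index (counted from one). -/
def oddSpokes : List ℕ → List ℕ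
  | a :: _ :: t => a :: oddSpokes t
  | l => l

/-- The spokes left for the following rounds: those with odd index, the last one put in front. -/
def keptSpokes (S : List ℕ) : List ℕ := (oddSpokes S).rotate ((oddSpokes S).length - 1)

theorem length_oddSpokes_lt : ∀ S : List ℕ,
    (oddSpokes S).length ≤ S.length ∧ (1 < S.length → (oddSpokes S).length < S.length)
  | [] => by simp [oddSpokes]
  | [_] => by simp [oddSpokes]
  | _ :: _ :: t => by
    have := (length_oddSpokes_lt t).1
    simp only [oddSpokes, List.length_cons]
    omega

theorem length_keptSpokes_lt {S : List ℕ} (h : 1 < S.length) :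
    (keptSpokes S).length < S.length := by
  simpa [keptSpokes] using (length_oddSpokes_lt S).2 h

/-- The distance from the origin at which a balloon of radius `r` is placed on the spoke `s` when
the spokes `S` are available and the safe disk has radius `safe`: the balloon touches the safe disk,
or else it is moved outwards until it lies in the wedge centred at `s` whose opening angle is twice
the minimal angle between `s` and a neighbouring spoke. (A wedge of opening angle at least `π`
imposes no condition.) -/
noncomputable def centerDist (d : ℕ) (S : List ℕ) (safe : ℝ) (s : ℕ) (r : ℝ) : ℝ :=
  max (alpha (min (2 * (2 * Real.pi * (minGap d S s : ℝ) / (d : ℝ))) Real.pi) * r - r) (safe + r)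

/-- A balloon layout: for each balloon, in the order of the list of radii, its spoke and the distance
of its centre from the origin; and the list of free spokes. -/
structure Layout where
  placed : List (ℕ × ℝ)
  free : List ℕ

/-- How far out the last balloon may start when three spokes and one balloon are left. If the
preceding round, played with `ℓ` spokes, produced a wedge layer, then the last balloon may be pushed
into the safe disk, up to a line whose distance from the origin is determined by the angle
`β = 2π / (2ℓ - 1)`. -/
noncomputable def pushed (safe : ℝ) : Option ℕ → ℝ
  | none => safe
  | some l =>
    safe * (Real.sin (2 * Real.pi / (2 * (l : ℝ) - 1)) + Real.cos (2 * Real.pi / (2 * (l : ℝ) - 1)))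
      / (Real.sin (2 * Real.pi / (2 * (l : ℝ) - 1)) + 1)

/-- The terminal cases, for `f` free spokes: two spokes and one balloon, three spokes and two
balloons (`f = 1`); three spokes and one balloon, four spokes and two balloons (`f = 2`);
no balloon at all. The spokes are listed such that the (at most two) smaller angles
are those between the first and second and between the second and third spoke. -/
noncomputable def terminalLayout (d f : ℕ) (S : List ℕ) (safe : ℝ) (wedge : Option ℕ)
    (rs : List ℝ) : Layout :=
  match f, S, rs with
  | 1, [a, b], [r] => ⟨[(a, safe + r)], [b]⟩
  | 1, [a, b, c], [r', r] =>
    if gap d a b ≤ gap d b c then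
      ⟨[(a, max (alpha (Real.pi / 3) * r' - r') (safe + r')), (c, safe + r)], [b]⟩
    else
      ⟨[(c, max (alpha (Real.pi / 3) * r' - r') (safe + r')), (a, safe + r)], [b]⟩
  | 2, [a, b, c], [r] =>
    ⟨[(b, max (alpha (4 * Real.pi / 5) * r - r) (pushed safe wedge + r))], [a, c]⟩
  | 2, [a, b, c, e], [r', r] =>
    ⟨[(b, max (alpha (4 * Real.pi / 7) * r' - r') (safe + r')), (e, safe + r)], [a, c]⟩
  | _, S, _ => ⟨[], S⟩

open Classical in
/-- The rounds of the greedy strategy, for the remaining spokes `S` and the remaining radii `rs` in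
increasing order. `safe` is the radius of the safe disk; `wedge` is `some ℓ` if the
preceding round was played with `ℓ` spokes and produced a wedge layer. -/
noncomputable def greedyRounds (d f : ℕ) (S : List ℕ) (safe : ℝ) (wedge : Option ℕ)
    (rs : List ℝ) : Layout :=
  if _h : f + 2 < S.length then
    let used := usedSpokes S
    let now := List.zip used (rs.take used.length)
    let safe' := (now.map fun q => centerDist d S safe q.1 q.2 + q.2).foldr max safe
    let wedge' := if ∃ q ∈ now, safe + q.2 < centerDist d S safe q.1 q.2 then some S.length else none
    let rest := greedyRounds d f (keptSpokes S) safe' wedge' (rs.drop used.length)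
    ⟨(now.map fun q => (q.1, centerDist d S safe q.1 q.2)) ++ rest.placed, rest.free⟩
  else terminalLayout d f S safe wedge rs
termination_by S.length
decreasing_by exact length_keptSpokes_lt (by omega)

/-- The greedy balloon layout of balloons with radii `rs` (in increasing order) on `d` spokes, `f`
of which stay free. -/
noncomputable def greedyLayout (d f : ℕ) (rs : List ℝ) : Layout :=
  greedyRounds d f (List.range d) 0 none rs

/-- The radius of the smallest disk about the origin that covers all balloons of the layout. -/
noncomputable def Layout.coverRadius (lay : Layout) (rs : List ℝ) : ℝ :=
  (List.zipWith (fun q r => q.2 + r) lay.placed rs).foldr max 0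

/-- The unit vector in direction of spoke `s` of a star with `d` spokes, rotated by `θ`, and with
spokes numbered counterclockwise (`ε = 1`) or clockwise (`ε = -1`). -/
noncomputable def spokeDir (d : ℕ) (θ ε : ℝ) (s : ℕ) : ℂ :=
  Complex.exp (((θ + ε * (2 * Real.pi * (s : ℝ) / (d : ℝ)) : ℝ) : ℂ) * Complex.I)

/-! ### Heavy-path decomposition of a rooted tree -/

section Tree

variable {V : Type*}

/-- `v` is a child of `u` in the tree `G` with root `r`. -/
def IsChild (G : SimpleGraph V) (r u v : V) : Prop :=
  G.Adj u v ∧ G.dist r v = G.dist r u + 1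

/-- The vertices of the subtree rooted at `u`: those whose path from the root visits `u`. -/
def subtree (G : SimpleGraph V) (r u : V) : Set V :=
  {w | G.dist r w = G.dist r u + G.dist u w}

/-- `h` selects at every non-leaf `u` a child with largest subtree, the other end of the heavy edge
below `u` (ties are broken arbitrarily). -/
structure IsHeavyChoice (G : SimpleGraph V) (r : V) (h : V → Option V) : Prop where
  isChild : ∀ u v, h u = some v → IsChild G r u v
  largest : ∀ u v, h u = some v → ∀ w, IsChild G r u w →
    (subtree G r w).ncard ≤ (subtree G r v).ncard
  exists_of_child : ∀ u v, IsChild G r u v → h u ≠ none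

/-- `v` is a child of `u` through a light edge. -/
def IsLightChild (G : SimpleGraph V) (r : V) (h : V → Option V) (u v : V) : Prop :=
  IsChild G r u v ∧ h u ≠ some v

/-- `u` is the top node of its heavy path, that is, the root or a light child. -/
def IsTop (h : V → Option V) (u : V) : Prop := ∀ w, h w ≠ some u

/-- `z` lies on the heavy path that starts at `u`. -/
def OnHeavyPath (h : V → Option V) (u z : V) : Prop :=
  Relation.ReflTransGen (fun a b => h a = some b) u z

/-! ### Drawings produced by the greedy layout within the heavy-path framework -/

/-- The edges at `u` are drawn by the greedy balloon layout, where `X` gives the radii of the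
exclusive disks of the light children: there are `deg u` evenly spaced spokes, the balloon of a
light child `c` is the disk of radius `X c` about `c`, and the remaining edges at `u` (the
heavy edge to a child and the edge to the parent, as far as they exist) leave along
the free spokes. The radius of the disk about `u` that covers the layout is `x`. -/
def IsGreedyStar (G : SimpleGraph V) (r : V) (h : V → Option V) (p : V → ℂ) (X : V → ℝ)
    (u : V) (x : ℝ) : Prop :=
  ∃ (L F : List V) (θ ε : ℝ), (ε = 1 ∨ ε = -1) ∧
    L.Nodup ∧ (∀ v, v ∈ L ↔ IsLightChild G r h u v) ∧ (L.map X).Pairwise (· ≤ ·) ∧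
    F.Nodup ∧ (∀ v, v ∈ F ↔ G.Adj u v ∧ ¬ IsLightChild G r h u v) ∧
    List.Forall₂ (fun v q => p v = p u + (q.2 : ℂ) * spokeDir (deg G u) θ ε q.1) L
      (greedyLayout (deg G u) F.length (L.map X)).placed ∧
    List.Forall₂ (fun v s => ∃ t : ℝ, 0 < t ∧ p v = p u + (t : ℂ) * spokeDir (deg G u) θ ε s) F
      (greedyLayout (deg G u) F.length (L.map X)).free ∧
    x = (greedyLayout (deg G u) F.length (L.map X)).coverRadius (L.map X)

/-- The drawing `p` of the tree `G` with root `r` arises from the heavy-path decomposition `h` and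
the greedy balloon layout. `X u` is the radius of the exclusive disk of the subtree of
a heavy path with top node `u`; the disk is centred at `u`, so that an edge from `u` to a
point outside crosses its boundary orthogonally. `x z` is the radius of the disk about `z` that
covers the balloon layout at `z`. -/
structure IsGreedyHeavyPathDrawing (G : SimpleGraph V) (r : V) (h : V → Option V) (p : V → ℂ)
    (X x : V → ℝ) : Prop where
  /-- A degenerate heavy path, a single leaf, has an exclusive disk of radius one. -/
  leaf : ∀ u, IsTop h u → h u = none → X u = 1
  /-- Around every vertex the light subtrees are arranged by the greedy balloon layout. -/
  star : ∀ u, IsGreedyStar G r h p X u (x u)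
  /-- The covering disks of the balloon layouts on a heavy path have disjoint interiors, -/
  cover_disjoint : ∀ u z z', IsTop h u → OnHeavyPath h u z → OnHeavyPath h u z' → z ≠ z' →
    x z + x z' ≤ dist (p z) (p z')
  /-- and they are contained in the exclusive disk of the heavy path. -/
  cover_subset : ∀ u z, IsTop h u → OnHeavyPath h u z → dist (p u) (p z) + x z ≤ X u
  /-- The drawing of the subtree of a heavy path lies in its exclusive disk. -/
  subtree_subset : ∀ u, IsTop h u → ∀ w ∈ subtree G r u, p w ∈ Metric.closedBall (p u) (X u)
  /-- The light parent edge leaves the exclusive disk. -/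
  parent_outside : ∀ u v, IsLightChild G r h u v → X v ≤ dist (p u) (p v)

end Tree

end BalloonTree

namespace BalloonTree

/-! ### Numerical facts -/

/-! The metric core is an estimate for one star: when one or two spokes stay free, the disk covering
the greedy layout has radius at most κ times the sum of the radii (`coverRadius_greedyLayout_le`).
For a non-leaf `z` with covering radius `x z` put `y z = max (x z) (1/2)`, and reserve `3 * y z` for
`z` on its heavy path; a path with more than one node gets an exclusive disk whose radius is the sum
of these reserves. If the heavy child has subtree size a, the light children have sizes b ≤ a, and e
= 2 + log κ ≥ 3, induction bounds the radius by a^e + 3κ ∑ b^e + 3/2. As 3κ < 7 this is at most (a +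
1 + ∑ b)^e, because (a + b)^e ≥ a^e + 7 b^e for b ≤ a (`add_sum_rpow_ge`, `Plan.X_le`).

Separation in a star (`isSeparated_greedyLayout`): the remaining spokes always have gaps g₁, g₂, G,
…, G with G/2 ≤ gᵢ ≤ G (`keptSpokes_spokeList`). The balloons of one round lie in non-overlapping
wedges. A later balloon lies beyond a line orthogonal to its spoke which the earlier balloons do not
cross; after a wedge round this line may cut into the safe disk.

Size of a star (`size_greedyRounds`): a balloon touching the safe disk adds its diameter, less than
κ times its radius. A wedge layer instead starts afresh at r (1 + 1 / sin μ), which Jordan's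
inequality bounds linearly in the number of spokes; all later balloons have radius at least r, and
only one per layer matters, so their surplus pays. The constant κ = 1 + 1 / sin (2π/5) comes from
the last balloon between two free spokes, whose wedge has half-angle 2π/5. Six spokes, two of them
free, is the one case where the last balloon has to be pushed into the safe disk.

The drawing: two free spokes are at least 2π/3 apart, so a heavy path turns by at most π/3 at each
node, and by reflecting stars all its edges stay within π/3 of a fixed axis (`exists_turn`). Its
nodes are placed in concentric annuli about the top node, with a spare gap `y z` behind `z`. The gap
makes edges long and puts the next node at least as high, along the axis, as the whole disk about
`z`. Planarity amounts to disjointness of the half-open edges, the arms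
(`IsPlanDrawing.eq_of_mem_arm`): light subtrees stay in the exclusive disk or on the edge leading to
it, and whatever hangs below the heavy child is higher than this child or farther from the top node
than the disk about `z` reaches. -/

theorem sin_two_pi_div_five : Real.sin (2 * Real.pi / 5) * (kappa - 1) = 1 := by
  have h5 : (√5 : ℝ) ^ 2 = 5 := Real.sq_sqrt (by norm_num)
  have h5p : (0 : ℝ) < √5 := by positivity
  have hc : Real.cos (2 * Real.pi / 5) = (√5 - 1) / 4 := by
    rw [show 2 * Real.pi / 5 = 2 * (Real.pi / 5) by ring, Real.cos_two_mul, Real.cos_pi_div_five]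
    nlinarith
  have hs : 0 < Real.sin (2 * Real.pi / 5) :=
    Real.sin_pos_of_pos_of_lt_pi (by positivity) (by linarith [Real.pi_pos])
  have hs2 : Real.sin (2 * Real.pi / 5) ^ 2 = (5 + √5) / 8 := by
    rw [Real.sin_sq, hc]; nlinarith
  have hk : kappa - 1 = √(2 - 2 / √5) := by simp [kappa]
  have hi : (2 : ℝ) - 2 / √5 = 2 - 2 * √5 / 5 := by
    field_simp; nlinarith
  have hpos : (0 : ℝ) ≤ 2 - 2 / √5 := by
    rw [hi]; nlinarith
  have hk2 : (kappa - 1) ^ 2 = 2 - 2 * √5 / 5 := by rw [hk, Real.sq_sqrt hpos, hi]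
  have hk0 : 0 ≤ kappa - 1 := by rw [hk]; positivity
  have h1 : (Real.sin (2 * Real.pi / 5) * (kappa - 1)) ^ 2 = 1 := by
    rw [mul_pow, hs2, hk2]; nlinarith
  have h0 : 0 ≤ Real.sin (2 * Real.pi / 5) * (kappa - 1) := by positivity
  nlinarith

/-- The upper bound 2.0515 is fine enough for the exponent 3.0367; the lower bound pays for the
diameter of a balloon that touches the safe disk. -/
theorem kappa_bounds : 2 < kappa ∧ kappa < 4103 / 2000 := by
  have h5 : (√5 : ℝ) ^ 2 = 5 := Real.sq_sqrt (by norm_num)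
  have h5p : (0 : ℝ) < √5 := by positivity
  have hi : (2 : ℝ) - 2 / √5 = 2 - 2 * √5 / 5 := by
    field_simp; nlinarith
  have h5u : √5 < 2.2361 := by nlinarith
  have h5l : 2.236 < √5 := by nlinarith
  unfold kappa
  rw [hi]
  constructor
  · have : (1 : ℝ) < √(2 - 2 * √5 / 5) := by
      rw [Real.lt_sqrt (by norm_num)]; linarith
    linarith
  · have : √(2 - 2 * √5 / 5) < 2103 / 2000 := by
      rw [Real.sqrt_lt' (by norm_num)]; linarith
    linarith

theorem logb_kappa_lt : Real.logb 2 kappa < 1.0367 := by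
  have hk := kappa_bounds
  -- The fraction 113/109 ≈ 1.036697 reduces the claim to the integer powers 2.0515 ^ 109 < 2 ^ 113.
  have h1 : Real.logb 2 kappa < 113 / 109 := by
    rw [Real.logb_lt_iff_lt_rpow (by norm_num) (by linarith)]
    refine hk.2.trans ?_
    have : (4103 / 2000 : ℝ) ^ (109 : ℕ) < (2 ^ (113 / 109 : ℝ)) ^ (109 : ℕ) := by
      rw [← Real.rpow_natCast (2 ^ (113 / 109 : ℝ)), ← Real.rpow_mul (by norm_num)]
      norm_num
    exact lt_of_pow_lt_pow_left₀ 109 (by positivity) this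
  linarith [h1, show (113 / 109 : ℝ) < 1.0367 by norm_num]

theorem one_le_logb_kappa : 1 ≤ Real.logb 2 kappa := by
  have hk := kappa_bounds
  rw [Real.le_logb_iff_rpow_le (by norm_num) (by linarith)]
  simpa using hk.1.le

theorem sq_mul_rpow_lt {n : ℕ} (hn : 2 ≤ n) :
    (n : ℝ) ^ 2 * (n : ℝ) ^ Real.logb 2 kappa < (n : ℝ) ^ (3.0367 : ℝ) := by
  have h2 : (2 : ℝ) ≤ n := by exact_mod_cast hn
  rw [← Real.rpow_natCast, ← Real.rpow_add (by linarith)]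
  apply Real.rpow_lt_rpow_of_exponent_lt (by linarith)
  have := logb_kappa_lt
  norm_num at *
  linarith

/-- After division by `a ^ e`, the exponent 3 is the worst case for t = b / a ≤ 1, and 1 + 7 t³ ≤ (1
+ t)³ has equality at t = 1, as 7 = 2³ − 1. The factor 7 leaves room for 3κ. -/
theorem add_rpow_ge {e a b : ℝ} (he : 3 ≤ e) (hb : 0 ≤ b) (hba : b ≤ a) :
    a ^ e + 7 * b ^ e ≤ (a + b) ^ e := by
  rcases hb.eq_or_lt with rfl | hb0
  · simp [Real.zero_rpow (show e ≠ 0 by linarith)]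
  have ha : 0 < a := by linarith
  set t := b / a with ht
  have hbt : b = a * t := by rw [ht]; field_simp
  have ht0 : 0 ≤ t := by positivity
  have ht1 : t ≤ 1 := by rw [ht, div_le_one ha]; exact hba
  have h1 : (1 + t) ^ (3 : ℝ) ≤ (1 + t) ^ e :=
    Real.rpow_le_rpow_of_exponent_le (by linarith) he
  have h2 : t ^ e ≤ t ^ (3 : ℝ) := by
    refine Real.rpow_le_rpow_of_exponent_ge (by positivity) ht1 he
  have h3 : (1 + t) ^ (3 : ℝ) = (1 + t) ^ 3 := by exact_mod_cast Real.rpow_natCast (1 + t) 3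
  have h4 : t ^ (3 : ℝ) = t ^ 3 := by exact_mod_cast Real.rpow_natCast t 3
  have h5 : 1 + 7 * t ^ e ≤ (1 + t) ^ e := by
    rw [h3] at h1
    rw [h4] at h2
    nlinarith [mul_nonneg ht0 (sub_nonneg.2 ht1), mul_nonneg (mul_nonneg ht0 (sub_nonneg.2 ht1)) ht0]
  rw [hbt, show a + a * t = a * (1 + t) by ring, Real.mul_rpow ha.le ht0,
    Real.mul_rpow ha.le (by linarith)]
  have : 0 < a ^ e := by positivity
  nlinarith

/-- The terms are added one at a time; the sum so far is at least `a`, hence at least the next term.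
-/
theorem add_sum_rpow_ge {e a : ℝ} (he : 3 ≤ e) (l : List ℝ)
    (hl : ∀ b ∈ l, 0 ≤ b ∧ b ≤ a) :
    a ^ e + 7 * (l.map (· ^ e)).sum ≤ (a + l.sum) ^ e := by
  induction l with
  | nil => simp
  | cons b l ih =>
    have hb := hl b (by simp)
    have hl' : ∀ b ∈ l, 0 ≤ b ∧ b ≤ a := fun c hc => hl c (by simp [hc])
    have hs : 0 ≤ l.sum := List.sum_nonneg fun c hc => (hl' c hc).1
    have := add_rpow_ge he hb.1 (show b ≤ a + l.sum by linarith)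
    have ih := ih hl'
    simp only [List.map_cons, List.sum_cons]
    rw [show a + (b + l.sum) = a + l.sum + b by ring]
    linarith


/-! ### Angles between spokes -/

/-- The cosine of the angle between the spokes `s` and `t`. -/
noncomputable def cosAng (d s t : ℕ) : ℝ := Real.cos (2 * Real.pi * ((s : ℝ) - t) / d)

theorem cosAng_comm (d s t : ℕ) : cosAng d s t = cosAng d t s := by
  unfold cosAng
  rw [← Real.cos_neg]
  congr 1
  ring

/-- Reduction modulo `d` changes the angle by a multiple of 2π, so spokes may be handled through
unreduced offsets. -/
theorem cosAng_mod {d : ℕ} (hd : 0 < d) (m n : ℕ) :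
    cosAng d (m % d) (n % d) = Real.cos (2 * Real.pi * ((m : ℝ) - n) / d) := by
  have hd' : (d : ℝ) ≠ 0 := by positivity
  have hm : ((m % d : ℕ) : ℝ) = m - d * ((m / d : ℕ) : ℝ) := by
    have := Nat.mod_add_div m d
    have h : (((m % d + d * (m / d) : ℕ)) : ℝ) = m := by rw [this]
    push_cast at h; linarith
  have hn : ((n % d : ℕ) : ℝ) = n - d * ((n / d : ℕ) : ℝ) := by
    have := Nat.mod_add_div n d
    have h : (((n % d + d * (n / d) : ℕ)) : ℝ) = n := by rw [this]
    push_cast at h; linarith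
  unfold cosAng
  generalize m / d = a at hm
  generalize n / d = b at hn
  rw [hm, hn, ← Real.cos_add_int_mul_two_pi _ ((a : ℤ) - (b : ℤ))]
  congr 1
  push_cast
  field_simp
  ring

theorem cos_le_cos_of_mem {μ x : ℝ} (h0 : 0 ≤ μ) (h1 : μ ≤ x)
    (h2 : x ≤ 2 * Real.pi - μ) : Real.cos x ≤ Real.cos μ := by
  rcases le_total x Real.pi with h | h
  · exact Real.cos_le_cos_of_nonneg_of_le_pi h0 h h1
  · rw [← Real.cos_two_pi_sub x]
    exact Real.cos_le_cos_of_nonneg_of_le_pi h0 (by linarith) (by linarith)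

/-- The quotients of the two numbers by `d` are equal or differ by one; the second case is the
wrap-around. -/
theorem gap_mod_add {d x a b : ℕ} (h1 : a < b) (h2 : b < a + d) :
    gap d ((x + a) % d) ((x + b) % d) = b - a ∧
      gap d ((x + b) % d) ((x + a) % d) = d - (b - a) := by
  have hd : 0 < d := by omega
  have ha := Nat.mod_lt (x + a) hd
  have hb := Nat.mod_lt (x + b) hd
  have ea := Nat.mod_add_div (x + a) d
  have eb := Nat.mod_add_div (x + b) d
  have key : (x + b) / d = (x + a) / d ∨ (x + b) / d = (x + a) / d + 1 := by
    have h3 : (x + a) / d ≤ (x + b) / d := Nat.div_le_div_right (by omega)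
    have h4 : (x + b) / d ≤ (x + a + d) / d := Nat.div_le_div_right (by omega)
    rw [Nat.add_div_right _ hd] at h4
    omega
  generalize (x + a) % d = u at *
  generalize (x + b) % d = v at *
  unfold gap
  rcases key with h | h
  · rw [h] at eb
    have : v = u + (b - a) := by omega
    subst this
    constructor
    · rw [show u + (b - a) + d - u = (b - a) + d by omega, Nat.add_mod_right,
        Nat.mod_eq_of_lt (by omega)]
    · rw [Nat.mod_eq_of_lt (by omega)]; omega
  · rw [h, Nat.mul_add, Nat.mul_one] at eb
    have : v + d = u + (b - a) := by omega
    constructor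
    · rw [Nat.mod_eq_of_lt (by omega)]; omega
    · rw [show u + d - v = (d - (b - a)) + d by omega, Nat.add_mod_right,
        Nat.mod_eq_of_lt (by omega)]

/-- The cosine sees the shorter of the two arcs between the spokes, so both arcs must be at least
`μ`. -/
theorem cosAng_mod_add_le {d x a b : ℕ} {μ : ℝ} (h1 : a < b) (h2 : b < a + d) (h0 : 0 ≤ μ)
    (hμ : μ * d ≤ 2 * Real.pi * ((b - a : ℕ) : ℝ))
    (hμ' : μ * d ≤ 2 * Real.pi * ((d - (b - a) : ℕ) : ℝ)) :
    cosAng d ((x + a) % d) ((x + b) % d) ≤ Real.cos μ := by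
  have hd : 0 < d := by omega
  have hd' : (0 : ℝ) < d := by positivity
  rw [cosAng_comm, cosAng_mod hd]
  rw [Nat.cast_sub (by omega), Nat.cast_sub (by omega)] at hμ'
  rw [Nat.cast_sub (by omega)] at hμ
  apply cos_le_cos_of_mem h0
  · rw [le_div_iff₀ hd']; push_cast; linarith
  · rw [div_le_iff₀ hd']; push_cast; nlinarith

theorem minGap_le {d : ℕ} {S : List ℕ} {s t : ℕ} (ht : t ∈ S) (hts : t ≠ s) :
    minGap d S s ≤ gap d s t ∧ minGap d S s ≤ gap d t s := by
  have key : ∀ (l : List ℕ), ∀ a ∈ l, l.foldr min d ≤ a := by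
    intro l
    induction l with
    | nil => simp
    | cons b l ih =>
      intro a ha
      rcases List.mem_cons.1 ha with rfl | ha
      · simp
      · exact (min_le_right _ _).trans (ih a ha)
  have := key ((S.filter (· ≠ s)).map fun t => min (gap d s t) (gap d t s))
    (min (gap d s t) (gap d t s)) (List.mem_map.2 ⟨t, List.mem_filter.2 ⟨ht, by simpa using hts⟩, rfl⟩)
  exact ⟨this.trans (min_le_left _ _), this.trans (min_le_right _ _)⟩

theorem le_minGap {d g : ℕ} {S : List ℕ} {s : ℕ} (hg : g ≤ d)
    (h : ∀ t ∈ S, t ≠ s → g ≤ gap d s t ∧ g ≤ gap d t s) : g ≤ minGap d S s := by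
  have key : ∀ (l : List ℕ), (∀ a ∈ l, g ≤ a) → g ≤ l.foldr min d := by
    intro l
    induction l with
    | nil => simpa using hg
    | cons b l ih =>
      intro hl
      exact le_min (hl b (by simp)) (ih fun a ha => hl a (by simp [ha]))
  refine key _ fun a ha => ?_
  obtain ⟨t, ht, rfl⟩ := List.mem_map.1 ha
  obtain ⟨ht, hts⟩ := List.mem_filter.1 ht
  exact le_min (h t ht (by simpa using hts)).1 (h t ht (by simpa using hts)).2

/-! ### Lists of spokes given by offsets -/

/-- The list of the `l` spokes at offsets `o 0, …, o (l - 1)` from `x`, modulo `d`. -/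
def spokeList (d x : ℕ) (o : ℕ → ℕ) (l : ℕ) : List ℕ := (List.range l).map fun i => (x + o i) % d

theorem oddSpokes_map_range (f : ℕ → ℕ) (l : ℕ) :
    oddSpokes ((List.range l).map f) = (List.range ((l + 1) / 2)).map fun i => f (2 * i) := by
  induction l using Nat.strong_induction_on generalizing f with
  | _ l ih =>
    match l with
    | 0 => rfl
    | 1 => rfl
    | l + 2 =>
      rw [List.range_succ_eq_map, List.range_succ_eq_map,
        show (l + 2 + 1) / 2 = (l + 1) / 2 + 1 by omega, List.range_succ_eq_map]
      simp only [List.map_cons, List.map_map, oddSpokes]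
      congr 1
      exact ih l (by omega) (f ∘ Nat.succ ∘ Nat.succ)

theorem usedSpokes_map_range (f : ℕ → ℕ) (l : ℕ) :
    usedSpokes ((List.range l).map f) = (List.range (l / 2)).map fun i => f (2 * i + 1) := by
  induction l using Nat.strong_induction_on generalizing f with
  | _ l ih =>
    match l with
    | 0 => rfl
    | 1 => rfl
    | l + 2 =>
      rw [List.range_succ_eq_map, List.range_succ_eq_map,
        show (l + 2) / 2 = l / 2 + 1 by omega, List.range_succ_eq_map]
      simp only [List.map_cons, List.map_map, usedSpokes]
      congr 1
      exact ih l (by omega) (f ∘ Nat.succ ∘ Nat.succ)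

/-- Offsets with gaps `g₁, g₂, G, G, …`. -/
def offset (g₁ g₂ G : ℕ) : ℕ → ℕ
  | 0 => 0
  | 1 => g₁
  | i + 2 => g₁ + g₂ + i * G

/-- `l` spokes out of `d` with gaps `g₁, g₂, G, …, G`, where the first two gaps are at most `G` and
at least `G / 2`. -/
structure Spread (d l g₁ g₂ G : ℕ) : Prop where
  two_le : 2 ≤ l
  pos : 0 < G
  le₁ : g₁ ≤ G
  le₂ : g₂ ≤ G
  ge₁ : G ≤ 2 * g₁
  ge₂ : G ≤ 2 * g₂
  sum : offset g₁ g₂ G l = d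

/-- Dropping every second spoke merges gaps in pairs: G + G = 2G, and g₁ + g₂ lies between G and 2G.
The cyclic gap from the last kept spoke to the first one is G for odd `l` and 2G for even `l`;
moving the last spoke to the front makes it the new first gap. So only two gaps are ever short, and
by a factor of at most 2. -/
theorem keptSpokes_spokeList {d x l g₁ g₂ G : ℕ} (hl : 3 ≤ l) (h : Spread d l g₁ g₂ G) :
    ∃ x' g₁', keptSpokes (spokeList d x (offset g₁ g₂ G) l) =
        spokeList d x' (offset g₁' (g₁ + g₂) (2 * G)) ((l + 1) / 2) ∧
      Spread d ((l + 1) / 2) g₁' (g₁ + g₂) (2 * G) := by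
  obtain ⟨m, hm⟩ : ∃ m, (l + 1) / 2 = m + 2 := ⟨(l + 1) / 2 - 2, by omega⟩
  have hG := h.pos
  have h1 := h.le₁
  have h2 := h.le₂
  have h3 := h.ge₁
  have h4 := h.ge₂
  obtain ⟨k, rfl⟩ : ∃ k, l = k + 2 := ⟨l - 2, by omega⟩
  have hs := h.sum
  simp only [offset] at hs
  obtain ⟨g₁', hg', hge, hle⟩ : ∃ g₁', offset g₁ g₂ G (2 * (m + 1)) + g₁' = d ∧
      G ≤ g₁' ∧ g₁' ≤ 2 * G := by
    simp only [show 2 * (m + 1) = 2 * m + 2 by ring, offset]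
    have : k = 2 * m + 1 ∨ k = 2 * m + 2 := by omega
    rcases this with rfl | rfl
    · refine ⟨G, ?_, by omega, by omega⟩
      rw [← hs]; ring
    · refine ⟨2 * G, ?_, by omega, by omega⟩
      rw [← hs]; ring
  refine ⟨x + offset g₁ g₂ G (2 * (m + 1)), g₁', ?_, ?_⟩
  · unfold keptSpokes spokeList
    rw [oddSpokes_map_range, hm]
    apply List.ext_getElem
    · simp
    · intro i hi hi'
      simp only [List.length_map, List.length_range] at hi'
      rw [List.getElem_rotate]
      simp only [List.length_map, List.length_range, List.getElem_map, List.getElem_range]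
      match i with
      | 0 =>
        rw [Nat.zero_add, Nat.mod_eq_of_lt (show m + 2 - 1 < m + 2 by omega)]
        rfl
      | 1 =>
        rw [show (1 + (m + 2 - 1)) = m + 2 by omega, Nat.mod_self]
        rw [show offset g₁' (g₁ + g₂) (2 * G) 1 = g₁' from rfl, Nat.add_assoc, hg']
        simp [offset]
      | i + 2 =>
        rw [show (i + 2 + (m + 2 - 1)) = i + 1 + (m + 2) by omega, Nat.add_mod_right,
          Nat.mod_eq_of_lt (show i + 1 < m + 2 by omega)]
        rw [show 2 * (i + 1) = 2 * i + 2 by ring,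
          show offset g₁ g₂ G (2 * i + 2) = g₁ + g₂ + 2 * i * G from rfl,
          show offset g₁' (g₁ + g₂) (2 * G) (i + 2) = g₁' + (g₁ + g₂) + i * (2 * G) from rfl]
        rw [show x + offset g₁ g₂ G (2 * (m + 1)) + (g₁' + (g₁ + g₂) + i * (2 * G)) =
          x + (g₁ + g₂ + 2 * i * G) + (offset g₁ g₂ G (2 * (m + 1)) + g₁') by ring, hg',
          Nat.add_mod_right]
  · refine ⟨by omega, by omega, by omega, by omega, by omega, by omega, ?_⟩
    rw [hm, ← hg', show 2 * (m + 1) = 2 * m + 2 by ring]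
    simp only [offset]
    ring

theorem range_eq_spokeList {d : ℕ} (hd : 2 ≤ d) :
    List.range d = spokeList d 0 (offset 1 1 1) d ∧ Spread d d 1 1 1 := by
  have ho : ∀ i, offset 1 1 1 i = i := by
    intro i
    match i with
    | 0 => rfl
    | 1 => rfl
    | i + 2 => simp [offset]; omega
  refine ⟨?_, ⟨hd, by omega, by omega, by omega, by omega, by omega, ho d⟩⟩
  apply List.ext_getElem
  · simp [spokeList]
  · intro i hi _
    simp only [List.length_range] at hi
    simp [spokeList, ho, Nat.mod_eq_of_lt hi]

theorem Spread.strictMono {d l g₁ g₂ G : ℕ} (h : Spread d l g₁ g₂ G) :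
    StrictMono (offset g₁ g₂ G) := by
  have hG := h.pos
  have h3 := h.ge₁
  have h4 := h.ge₂
  apply strictMono_nat_of_lt_succ
  intro i
  match i with
  | 0 => simp only [offset]; omega
  | 1 => simp only [offset]; omega
  | i + 2 => simp only [offset]; nlinarith

section

variable {d x l : ℕ} {o : ℕ → ℕ}

theorem offset_lt (ho : StrictMono o) (hd : o l = d) {i j : ℕ} (hj : j < l) : o j < o i + d := by
  have := ho hj
  omega

theorem spokeList_nodup (ho : StrictMono o) (hd : o l = d) : (spokeList d x o l).Nodup := by
  unfold spokeList
  refine List.Nodup.map_on ?_ List.nodup_range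
  have key : ∀ i j, i < j → j < l → (x + o i) % d ≠ (x + o j) % d := by
    intro i j hij hj he
    have h1 := ho hij
    have h2 := gap_mod_add (x := x) h1 (offset_lt ho hd hj)
    rw [he] at h2
    have := offset_lt ho hd hj (i := i)
    have h3 := h2.1.symm.trans h2.2
    have h4 : gap d ((x + o j) % d) ((x + o j) % d) = 0 := by
      unfold gap
      rw [Nat.add_sub_cancel_left, Nat.mod_self]
    omega
  intro i hi j hj he
  simp only [List.mem_range] at hi hj
  rcases lt_trichotomy i j with h | h | h
  · exact (key i j h hj he).elim
  · exact h
  · exact (key j i h hi he.symm).elim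

/-- The wedge at an inner spoke of the list is determined by the two neighbouring spokes. -/
theorem minGap_spokeList (ho : StrictMono o) (h0 : o 0 = 0) (hd : o l = d) {k : ℕ}
    (hk : k + 1 < l) :
    minGap d (spokeList d x o l) ((x + o (k + 1)) % d) =
      min (o (k + 1) - o k) (o (k + 2) - o (k + 1)) := by
  have m1 : o k < o (k + 1) := ho (by omega)
  have m2 : o (k + 1) < o (k + 2) := ho (by omega)
  have m3 : o (k + 2) ≤ d := hd ▸ ho.monotone (by omega)
  have mem : ∀ i, i < l → (x + o i) % d ∈ spokeList d x o l := fun i hi =>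
    List.mem_map.2 ⟨i, List.mem_range.2 hi, rfl⟩
  have inj := spokeList_nodup (x := x) ho hd
  have ne : ∀ i, i < l → i ≠ k + 1 → (x + o i) % d ≠ (x + o (k + 1)) % d := by
    intro i hi hne he
    exact hne (List.inj_on_of_nodup_map inj (List.mem_range.2 hi) (List.mem_range.2 hk) he)
  apply le_antisymm
  · apply le_min
    · have h1 := (minGap_le (d := d) (mem k (by omega)) (ne k (by omega) (by omega))).2
      rwa [(gap_mod_add m1 (offset_lt ho hd hk)).1] at h1
    · rcases Nat.lt_or_ge (k + 2) l with h | h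
      · have h1 := (minGap_le (d := d) (mem (k + 2) h) (ne _ h (by omega))).1
        rwa [(gap_mod_add m2 (offset_lt ho hd h)).1] at h1
      -- The last spoke is followed cyclically by the first one, at offset `o l = d`.
      · have hl : k + 2 = l := by omega
        have h1 := (minGap_le (d := d) (mem 0 (by omega)) (ne 0 (by omega) (by omega))).1
        rw [(gap_mod_add (ho (by omega)) (offset_lt ho hd hk)).2] at h1
        rw [hl, hd]
        omega
  · apply le_minGap (by omega)
    intro t ht hts
    obtain ⟨i, hi, rfl⟩ := List.mem_map.1 ht
    rw [List.mem_range] at hi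
    rcases lt_trichotomy i (k + 1) with h | h | h
    · have := gap_mod_add (x := x) (ho h) (offset_lt ho hd hk)
      have h1 : o i ≤ o k := ho.monotone (by omega)
      rw [this.1, this.2]
      omega
    · exact (hts (by rw [h])).elim
    · have := gap_mod_add (x := x) (ho h) (offset_lt ho hd hi)
      have h1 : o (k + 2) ≤ o i := ho.monotone (by omega)
      have h2 : o i < d := hd ▸ ho hi
      rw [this.1, this.2]
      omega

end


/-! ### Separation of balloons

A placed balloon is a triple `((s, c), r)`: spoke, distance of the centre from the origin, radius. -/

/-- The ray along the spoke `t` avoids the open balloon `q`. -/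
def RayAvoids (d : ℕ) (q : (ℕ × ℝ) × ℝ) (t : ℕ) : Prop :=
  ∀ a : ℝ, 0 ≤ a → q.2 ^ 2 ≤ a ^ 2 + q.1.2 ^ 2 - 2 * a * q.1.2 * cosAng d q.1.1 t

/-- Two open balloons are disjoint, and neither meets the segment from the origin to the centre of
the other. -/
structure Compat (d : ℕ) (q q' : (ℕ × ℝ) × ℝ) : Prop where
  disks : (q.2 + q'.2) ^ 2 ≤ q.1.2 ^ 2 + q'.1.2 ^ 2 - 2 * q.1.2 * q'.1.2 * cosAng d q.1.1 q'.1.1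
  left : ∀ a : ℝ, 0 ≤ a → a ≤ q'.1.2 →
    q.2 ^ 2 ≤ a ^ 2 + q.1.2 ^ 2 - 2 * a * q.1.2 * cosAng d q.1.1 q'.1.1
  right : ∀ a : ℝ, 0 ≤ a → a ≤ q.1.2 →
    q'.2 ^ 2 ≤ a ^ 2 + q'.1.2 ^ 2 - 2 * a * q'.1.2 * cosAng d q.1.1 q'.1.1

theorem Compat.symm {d : ℕ} {q q' : (ℕ × ℝ) × ℝ} (h : Compat d q q') : Compat d q' q := by
  refine ⟨?_, ?_, ?_⟩
  · rw [cosAng_comm]; linarith [h.disks]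
  · intro a h0 h1; rw [cosAng_comm]; exact h.right a h0 h1
  · intro a h0 h1; rw [cosAng_comm]; exact h.left a h0 h1

/-- The balloon `q` lies in the wedge of half-angle `μ ≤ π / 2` about its spoke. -/
structure InWedge (q : (ℕ × ℝ) × ℝ) (μ : ℝ) : Prop where
  nonneg : 0 ≤ μ
  le : μ ≤ Real.pi / 2
  radius : 0 ≤ q.2
  dist : 0 ≤ q.1.2
  inside : q.2 ≤ q.1.2 * Real.sin μ

/-- Completing the square in `a` shows that a centre at distance c is at least c sin μ away from the
ray at angle μ; a smaller cosine only increases the distance. -/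
theorem InWedge.rayAvoids {d t : ℕ} {q : (ℕ × ℝ) × ℝ} {μ : ℝ} (h : InWedge q μ)
    (hc : cosAng d q.1.1 t ≤ Real.cos μ) : RayAvoids d q t := by
  intro a ha
  have h1 : q.2 ^ 2 ≤ (q.1.2 * Real.sin μ) ^ 2 := pow_le_pow_left₀ h.radius h.inside 2
  have h2 := Real.sin_sq_add_cos_sq μ
  have h3 : a * q.1.2 * cosAng d q.1.1 t ≤ a * q.1.2 * Real.cos μ :=
    mul_le_mul_of_nonneg_left hc (mul_nonneg ha h.dist)
  have h4 : (q.1.2 * Real.sin μ) ^ 2 = q.1.2 ^ 2 - (q.1.2 * Real.cos μ) ^ 2 := by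
    rw [mul_pow, mul_pow]; linear_combination q.1.2 ^ 2 * h2
  nlinarith [sq_nonneg (a - q.1.2 * Real.cos μ)]

/-- The two wedges do not overlap. In formulas: when the angle is exactly μ + μ', the squared
distance of the centres exceeds (c sin μ + c' sin μ')² by the square of c cos μ − c' cos μ'. -/
theorem InWedge.compat {d : ℕ} {q q' : (ℕ × ℝ) × ℝ} {μ μ' : ℝ} (h : InWedge q μ)
    (h' : InWedge q' μ') (hc : cosAng d q.1.1 q'.1.1 ≤ Real.cos (μ + μ')) : Compat d q q' := by
  have m1 : Real.cos (μ + μ') ≤ Real.cos μ :=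
    Real.cos_le_cos_of_nonneg_of_le_pi h.nonneg (by linarith [h.le, h'.le]) (by linarith [h'.nonneg])
  have m2 : Real.cos (μ + μ') ≤ Real.cos μ' :=
    Real.cos_le_cos_of_nonneg_of_le_pi h'.nonneg (by linarith [h.le, h'.le]) (by linarith [h.nonneg])
  refine ⟨?_, fun a ha _ => h.rayAvoids (hc.trans m1) a ha, fun a ha _ => ?_⟩
  · have h1 : (q.2 + q'.2) ^ 2 ≤ (q.1.2 * Real.sin μ + q'.1.2 * Real.sin μ') ^ 2 :=
      pow_le_pow_left₀ (add_nonneg h.radius h'.radius) (add_le_add h.inside h'.inside) 2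
    have h3 : q.1.2 * q'.1.2 * cosAng d q.1.1 q'.1.1 ≤ q.1.2 * q'.1.2 * Real.cos (μ + μ') :=
      mul_le_mul_of_nonneg_left hc (mul_nonneg h.dist h'.dist)
    rw [Real.cos_add] at h3
    have e1 := Real.sin_sq_add_cos_sq μ
    have e2 := Real.sin_sq_add_cos_sq μ'
    have e3 : (q.1.2 * Real.sin μ + q'.1.2 * Real.sin μ') ^ 2 =
        q.1.2 ^ 2 + q'.1.2 ^ 2 - (q.1.2 * Real.cos μ - q'.1.2 * Real.cos μ') ^ 2
        - 2 * (q.1.2 * q'.1.2 * (Real.cos μ * Real.cos μ' - Real.sin μ * Real.sin μ')) := by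
      linear_combination q.1.2 ^ 2 * e1 + q'.1.2 ^ 2 * e2
    nlinarith [sq_nonneg (q.1.2 * Real.cos μ - q'.1.2 * Real.cos μ')]
  · have := h'.rayAvoids (t := q.1.1) (d := d) (by rw [cosAng_comm]; exact hc.trans m2) a ha
    rwa [cosAng_comm] at this

theorem cosAng_abs_le (d s t : ℕ) : -1 ≤ cosAng d s t ∧ cosAng d s t ≤ 1 :=
  ⟨Real.neg_one_le_cos _, Real.cos_le_one _⟩

/-- A balloon beyond the line at distance `P` from the origin, orthogonal to its spoke, is separated
from balloons on the other side of this line. -/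
theorem compat_of_proj {d : ℕ} {e q : (ℕ × ℝ) × ℝ} {P : ℝ} (hray : RayAvoids d e q.1.1)
    (he : 0 ≤ e.2) (hproj : e.1.2 * cosAng d e.1.1 q.1.1 + e.2 ≤ P)
    (hP : 0 ≤ P) (hq : 0 ≤ q.2) (hPq : P ≤ q.1.2 - q.2) : Compat d e q := by
  obtain ⟨hk1, hk2⟩ := cosAng_abs_le d e.1.1 q.1.1
  generalize hk : cosAng d e.1.1 q.1.1 = k at *
  have hk3 : k ^ 2 ≤ 1 := by nlinarith
  have key : ∀ a : ℝ, (q.1.2 - a * k) ^ 2 ≤ a ^ 2 + q.1.2 ^ 2 - 2 * a * q.1.2 * k := by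
    intro a
    nlinarith [mul_nonneg (sq_nonneg a) (sub_nonneg.2 hk3)]
  refine ⟨?_, fun a ha _ => by simpa [hk] using hray a ha, fun a ha hae => ?_⟩
  · rw [hk]
    have h1 : e.2 + q.2 ≤ q.1.2 - e.1.2 * k := by linarith
    exact (pow_le_pow_left₀ (by linarith) h1 2).trans (by linarith [key e.1.2])
  · rw [hk]
    have h1 : q.2 ≤ q.1.2 - a * k := by
      rcases le_total 0 k with h | h
      · nlinarith
      · nlinarith [mul_nonneg ha (neg_nonneg.2 h)]
    exact (pow_le_pow_left₀ hq h1 2).trans (key a)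

/-! ### Wedges in a round -/

/-- Half the opening angle of the wedge at spoke `s`. -/
noncomputable def wedgeAngle (d : ℕ) (S : List ℕ) (s : ℕ) : ℝ :=
  min (2 * Real.pi * (minGap d S s : ℝ) / d) (Real.pi / 2)

theorem alpha_mul_sub {φ r : ℝ} (h : Real.sin (φ / 2) ≠ 0) :
    alpha φ * r - r = r / Real.sin (φ / 2) := by
  unfold alpha
  field_simp
  ring

/-- The function `alpha` is made so that the wedge term is r / sin μ, the distance at which the
balloon touches both sides of a wedge of half-angle μ. -/
theorem centerDist_eq {d : ℕ} {S : List ℕ} {s : ℕ} (h : 0 < wedgeAngle d S s) (safe r : ℝ) :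
    centerDist d S safe s r = max (r / Real.sin (wedgeAngle d S s)) (safe + r) := by
  have e : min (2 * (2 * Real.pi * (minGap d S s : ℝ) / (d : ℝ))) Real.pi / 2
      = wedgeAngle d S s := by
    unfold wedgeAngle
    rw [← min_div_div_right (by norm_num)]
    congr 1
    ring
  have hs : 0 < Real.sin (wedgeAngle d S s) :=
    Real.sin_pos_of_pos_of_lt_pi h (lt_of_le_of_lt (min_le_right _ _) (by linarith [Real.pi_pos]))
  unfold centerDist
  rw [alpha_mul_sub, e]
  rw [e]; exact hs.ne'

theorem inWedge_centerDist {d : ℕ} {S : List ℕ} {s : ℕ} (h : 0 < wedgeAngle d S s) {safe r : ℝ}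
    (hsafe : 0 ≤ safe) (hr : 0 ≤ r) :
    InWedge ((s, centerDist d S safe s r), r) (wedgeAngle d S s) := by
  have hs : 0 < Real.sin (wedgeAngle d S s) :=
    Real.sin_pos_of_pos_of_lt_pi h (lt_of_le_of_lt (min_le_right _ _) (by linarith [Real.pi_pos]))
  refine ⟨h.le, min_le_right _ _, hr, ?_, ?_⟩
  · simp only [centerDist_eq h]
    exact le_max_of_le_right (by linarith)
  · simp only [centerDist_eq h]
    rw [← div_le_iff₀ hs]
    exact le_max_left _ _

theorem le_centerDist (d : ℕ) (S : List ℕ) (s : ℕ) (safe r : ℝ) :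
    safe + r ≤ centerDist d S safe s r := le_max_right _ _

theorem cosAng_le_of_gap {d s t : ℕ} {μ : ℝ} (hs : s < d) (ht : t < d) (hst : s ≠ t) (h0 : 0 ≤ μ)
    (h1 : μ * d ≤ 2 * Real.pi * gap d s t) (h2 : μ * d ≤ 2 * Real.pi * gap d t s) :
    cosAng d s t ≤ Real.cos μ := by
  have key : ∀ s t : ℕ, s < t → t < d → μ * d ≤ 2 * Real.pi * gap d s t →
      μ * d ≤ 2 * Real.pi * gap d t s → cosAng d s t ≤ Real.cos μ := by
    intro s t hst ht h1 h2
    have hg := gap_mod_add (d := d) (x := 0) (a := s) (b := t) hst (by omega)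
    have hc := cosAng_mod_add_le (d := d) (x := 0) (μ := μ) (a := s) (b := t) hst (by omega) h0
    simp only [Nat.zero_add, Nat.mod_eq_of_lt ht, Nat.mod_eq_of_lt (hst.trans ht)] at hg hc
    rw [hg.1] at h1
    rw [hg.2] at h2
    exact hc h1 h2
  rcases lt_or_gt_of_ne hst with h | h
  · exact key s t h ht h1 h2
  · rw [cosAng_comm]; exact key t s h hs h2 h1

section Round

variable {d x l : ℕ} {o : ℕ → ℕ}

theorem lt_of_mem_spokeList (hd : 0 < d) {s : ℕ} (hs : s ∈ spokeList d x o l) : s < d := by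
  obtain ⟨i, _, rfl⟩ := List.mem_map.1 hs
  exact Nat.mod_lt _ hd

theorem usedSpokes_spokeList : usedSpokes (spokeList d x o l) =
    (List.range (l / 2)).map fun i => (x + o (2 * i + 1)) % d := usedSpokes_map_range _ _

theorem cosAng_le_cos_wedgeAngle (hd : 0 < d) {s t : ℕ} (hs : s ∈ spokeList d x o l)
    (ht : t ∈ spokeList d x o l) (hts : t ≠ s) :
    cosAng d s t ≤ Real.cos (wedgeAngle d (spokeList d x o l) s) := by
  have hd' : (0 : ℝ) < d := by positivity
  have hg := minGap_le (d := d) ht hts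
  have h1 : wedgeAngle d (spokeList d x o l) s * d ≤
      2 * Real.pi * (minGap d (spokeList d x o l) s : ℝ) := by
    rw [← le_div_iff₀ hd']
    exact min_le_left _ _
  have h2 : (minGap d (spokeList d x o l) s : ℝ) ≤ gap d s t := by exact_mod_cast hg.1
  have h3 : (minGap d (spokeList d x o l) s : ℝ) ≤ gap d t s := by exact_mod_cast hg.2
  apply cosAng_le_of_gap (lt_of_mem_spokeList hd hs) (lt_of_mem_spokeList hd ht) hts.symm
  · exact le_min (by positivity) (by positivity)
  · exact h1.trans (by gcongr)
  · exact h1.trans (by gcongr)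

/-- A wedge extends at most to the neighbouring spokes, and between two used spokes there is, in
either direction, a kept one. -/
theorem pairwise_usedSpokes (ho : StrictMono o) (h0 : o 0 = 0) (hd : o l = d) :
    (usedSpokes (spokeList d x o l)).Pairwise fun s t => cosAng d s t ≤
      Real.cos (wedgeAngle d (spokeList d x o l) s + wedgeAngle d (spokeList d x o l) t) := by
  rw [usedSpokes_spokeList, List.pairwise_map]
  refine List.Pairwise.imp_of_mem ?_ List.pairwise_lt_range
  intro i j hi hj hij
  rw [List.mem_range] at hi hj
  have m1 := minGap_spokeList (x := x) ho h0 hd (k := 2 * i) (by omega)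
  have m2 := minGap_spokeList (x := x) ho h0 hd (k := 2 * j) (by omega)
  have a1 : o (2 * i) < o (2 * i + 1) := ho (by omega)
  have a2 : o (2 * i + 1) < o (2 * i + 2) := ho (by omega)
  have a3 : o (2 * j) < o (2 * j + 1) := ho (by omega)
  have a4 : o (2 * j + 1) < o (2 * j + 2) := ho (by omega)
  have a5 : o (2 * i + 2) ≤ o (2 * j) := ho.monotone (by omega)
  have a6 : o (2 * j + 2) ≤ d := hd ▸ ho.monotone (by omega)
  have hd0 : 0 < d := by omega
  have hd' : (0 : ℝ) < d := by positivity
  have w : ∀ s, wedgeAngle d (spokeList d x o l) s * d ≤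
      2 * Real.pi * (minGap d (spokeList d x o l) s : ℝ) := by
    intro s
    rw [← le_div_iff₀ hd']
    exact min_le_left _ _
  have wn : ∀ s, 0 ≤ wedgeAngle d (spokeList d x o l) s := fun s =>
    le_min (by positivity) (by positivity)
  have w1 := w ((x + o (2 * i + 1)) % d)
  have w2 := w ((x + o (2 * j + 1)) % d)
  apply cosAng_mod_add_le (by omega) (by omega) (add_nonneg (wn _) (wn _))
  · have : (((minGap d (spokeList d x o l) ((x + o (2 * i + 1)) % d) +
        minGap d (spokeList d x o l) ((x + o (2 * j + 1)) % d) : ℕ)) : ℝ) ≤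
        ((o (2 * j + 1) - o (2 * i + 1) : ℕ) : ℝ) := by
      exact_mod_cast (by omega)
    push_cast at this
    nlinarith [mul_le_mul_of_nonneg_left this (by positivity : 0 ≤ 2 * Real.pi)]
  · have : (((minGap d (spokeList d x o l) ((x + o (2 * i + 1)) % d) +
        minGap d (spokeList d x o l) ((x + o (2 * j + 1)) % d) : ℕ)) : ℝ) ≤
        ((d - (o (2 * j + 1) - o (2 * i + 1)) : ℕ) : ℝ) := by
      exact_mod_cast (by omega)
    push_cast at this
    nlinarith [mul_le_mul_of_nonneg_left this (by positivity : 0 ≤ 2 * Real.pi)]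

end Round

/-- Both short gaps meet at the first used spoke. If g is the smaller one, the other and each G are
at most 2g, whence d ≤ (1 + 2 + 2 (l − 2)) g. Every other used spoke has G on both sides, and d ≤ l
G. -/
theorem Spread.le_minGap_used {d x l g₁ g₂ G : ℕ} (h : Spread d l g₁ g₂ G) {i : ℕ}
    (hi : 2 * i + 1 < l) :
    d ≤ (2 * l - 1) * minGap d (spokeList d x (offset g₁ g₂ G) l)
        ((x + offset g₁ g₂ G (2 * i + 1)) % d) ∧
      (0 < i → d ≤ l * minGap d (spokeList d x (offset g₁ g₂ G) l)
        ((x + offset g₁ g₂ G (2 * i + 1)) % d)) := by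
  rw [minGap_spokeList h.strictMono rfl h.sum hi]
  have hs := h.sum
  obtain ⟨k, rfl⟩ : ∃ k, l = k + 2 := ⟨l - 2, by have := h.two_le; omega⟩
  simp only [offset] at hs
  have hG := h.pos
  have h1 := h.le₁
  have h2 := h.le₂
  have h3 := h.ge₁
  have h4 := h.ge₂
  have hdG : d ≤ (k + 2) * G := by rw [← hs]; nlinarith
  match i with
  | 0 =>
    refine ⟨?_, fun h => absurd h (by omega)⟩
    have e : min (offset g₁ g₂ G (2 * 0 + 1) - offset g₁ g₂ G (2 * 0))
      (offset g₁ g₂ G (2 * 0 + 2) - offset g₁ g₂ G (2 * 0 + 1)) = min g₁ g₂ := by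
      simp [offset]
    rw [e, show 2 * (k + 2) - 1 = 2 * k + 3 by omega, ← hs]
    rcases le_total g₁ g₂ with h | h
    · rw [min_eq_left h]; nlinarith
    · rw [min_eq_right h]; nlinarith
  | i + 1 =>
    have e : min (offset g₁ g₂ G (2 * (i + 1) + 1) - offset g₁ g₂ G (2 * (i + 1)))
      (offset g₁ g₂ G (2 * (i + 1) + 2) - offset g₁ g₂ G (2 * (i + 1) + 1)) = G := by
      rw [show 2 * (i + 1) + 1 = (2 * i + 1) + 2 by ring, show 2 * (i + 1) = 2 * i + 2 by ring]
      simp only [offset]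
      rw [show g₁ + g₂ + (2 * i + 1) * G = g₁ + g₂ + 2 * i * G + G by ring,
        show g₁ + g₂ + (2 * i + 2) * G = g₁ + g₂ + 2 * i * G + G + G by ring]
      simp
    rw [e]
    refine ⟨hdG.trans ?_, fun _ => hdG⟩
    exact Nat.mul_le_mul_right _ (by omega)

theorem le_wedgeAngle {d m : ℕ} {S : List ℕ} {s : ℕ} (hd : 0 < d) (hm : 4 ≤ m)
    (h : d ≤ m * minGap d S s) : 2 * Real.pi / m ≤ wedgeAngle d S s := by
  have hd' : (0 : ℝ) < d := by positivity
  have hm' : (4 : ℝ) ≤ m := by exact_mod_cast hm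
  have h' : (d : ℝ) ≤ m * minGap d S s := by exact_mod_cast h
  have hp := Real.pi_pos
  apply le_min
  · rw [div_le_div_iff₀ (by linarith) hd']
    nlinarith
  · rw [div_le_div_iff₀ (by linarith) (by norm_num)]
    nlinarith

theorem Spread.le_wedgeAngle_used {d x l g₁ g₂ G : ℕ} (h : Spread d l g₁ g₂ G) (hl : 4 ≤ l) {s : ℕ}
    (hs : s ∈ usedSpokes (spokeList d x (offset g₁ g₂ G) l)) :
    2 * Real.pi / (2 * (l : ℝ) - 1) ≤ wedgeAngle d (spokeList d x (offset g₁ g₂ G) l) s := by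
  rw [usedSpokes_spokeList] at hs
  obtain ⟨i, hi, rfl⟩ := List.mem_map.1 hs
  rw [List.mem_range] at hi
  have hd : 0 < d := h.sum ▸ (h.strictMono (show 0 < l by omega))
  have := le_wedgeAngle hd (by omega) (h.le_minGap_used (x := x) (i := i) (by omega)).1
  rw [Nat.cast_sub (by omega)] at this
  push_cast at this
  exact this

/-! ### The pushed line -/

theorem pushed_le {safe : ℝ} (h : 0 ≤ safe) (w : Option ℕ) : pushed safe w ≤ safe := by
  cases w with
  | none => exact le_rfl
  | some l =>
    simp only [pushed]
    set β := 2 * Real.pi / (2 * (l : ℝ) - 1)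
    have h1 : 0 ≤ Real.sin β + 1 := by linarith [Real.neg_one_le_sin β]
    -- A vanishing denominator makes the quotient 0.
    rcases h1.eq_or_lt with h0 | h0
    · rw [← h0]; simpa using h
    · rw [div_le_iff₀ h0]
      exact mul_le_mul_of_nonneg_left (by linarith [Real.cos_le_one β]) h

/-- The projection of a balloon onto a ray at angle μ is extremal when the balloon fills its wedge,
r = c sin μ, and reaches the safe circle, c + r = s; it is then s (sin μ + cos μ) / (sin μ + 1).
This quotient decreases in μ, so a lower bound β for the wedge angles gives the line used by
`pushed`. -/
theorem proj_le_pushed {c r s β μ : ℝ} (hc : 0 ≤ c) (hr : 0 ≤ r) (hβ : 0 ≤ β) (hβμ : β ≤ μ)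
    (hμ : μ ≤ Real.pi / 2) (hin : r ≤ c * Real.sin μ) (hs : c + r ≤ s) :
    c * Real.cos μ + r ≤ s * (Real.sin β + Real.cos β) / (Real.sin β + 1) := by
  have hp := Real.pi_pos
  have s1 : 0 ≤ Real.sin β := Real.sin_nonneg_of_nonneg_of_le_pi hβ (by linarith)
  have s2 : 0 ≤ Real.sin μ := Real.sin_nonneg_of_nonneg_of_le_pi (by linarith) (by linarith)
  have c1 : 0 ≤ Real.cos β := Real.cos_nonneg_of_neg_pi_div_two_le_of_le (by linarith) (by linarith)
  have c2 : 0 ≤ Real.cos μ := Real.cos_nonneg_of_neg_pi_div_two_le_of_le (by linarith) hμ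
  have hcos : Real.cos μ ≤ Real.cos β :=
    Real.cos_le_cos_of_nonneg_of_le_pi hβ (by linarith) hβμ
  have s3 : 0 ≤ Real.sin (μ - β) := Real.sin_nonneg_of_nonneg_of_le_pi (by linarith) (by linarith)
  have hsub := Real.sin_sub μ β
  have hsin : Real.sin μ ≤ Real.sin β + Real.sin (μ - β) := by
    have : Real.sin μ = Real.sin (μ - β) * Real.cos β + Real.cos (μ - β) * Real.sin β := by
      rw [← Real.sin_add]; congr 1; ring
    rw [this]
    nlinarith [Real.cos_le_one β, Real.cos_le_one (μ - β)]
  have k1 : (c * Real.cos μ + r) * (1 + Real.sin μ) ≤ s * (Real.sin μ + Real.cos μ) := by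
    have := mul_nonneg (sub_nonneg.2 (Real.cos_le_one μ)) (sub_nonneg.2 hin)
    nlinarith [mul_le_mul_of_nonneg_right hs (add_nonneg s2 c2)]
  have k2 : (Real.sin μ + Real.cos μ) * (Real.sin β + 1) ≤
      (Real.sin β + Real.cos β) * (Real.sin μ + 1) := by
    nlinarith
  have hs0 : 0 ≤ s := by linarith
  rw [le_div_iff₀ (by linarith)]
  have k3 := mul_le_mul_of_nonneg_right k1 (show 0 ≤ Real.sin β + 1 by linarith)
  have k4 := mul_le_mul_of_nonneg_left k2 hs0
  have k5 : (c * Real.cos μ + r) * (Real.sin β + 1) * (1 + Real.sin μ) ≤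
      s * (Real.sin β + Real.cos β) * (1 + Real.sin μ) := by nlinarith
  exact le_of_mul_le_mul_right k5 (by linarith)

theorem one_le_sin_add_cos {μ : ℝ} (h0 : 0 ≤ μ) (h1 : μ ≤ Real.pi / 2) :
    1 ≤ Real.sin μ + Real.cos μ := by
  have s2 : 0 ≤ Real.sin μ := Real.sin_nonneg_of_nonneg_of_le_pi h0 (by linarith [Real.pi_pos])
  have c2 : 0 ≤ Real.cos μ := Real.cos_nonneg_of_neg_pi_div_two_le_of_le (by linarith) h1
  nlinarith [Real.sin_sq_add_cos_sq μ]


/-! ### Rounds of the greedy strategy -/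

theorem le_foldr_max (l : List ℝ) (b : ℝ) : b ≤ l.foldr max b ∧ ∀ a ∈ l, a ≤ l.foldr max b := by
  induction l with
  | nil => simp
  | cons c l ih =>
    refine ⟨ih.1.trans (le_max_right _ _), fun a ha => ?_⟩
    rcases List.mem_cons.1 ha with rfl | ha
    · exact le_max_left _ _
    · exact (ih.2 a ha).trans (le_max_right _ _)

theorem foldr_max_le {l : List ℝ} {b M : ℝ} (hb : b ≤ M) (h : ∀ a ∈ l, a ≤ M) :
    l.foldr max b ≤ M := by
  induction l with
  | nil => simpa
  | cons c l ih => exact max_le (h c (by simp)) (ih fun a ha => h a (by simp [ha]))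

theorem foldr_max_mem (l : List ℝ) (b : ℝ) : l.foldr max b = b ∨ l.foldr max b ∈ l := by
  induction l with
  | nil => simp
  | cons c l ih =>
    rcases max_choice c (l.foldr max b) with h | h
    · right; simp [h]
    · simp only [List.foldr_cons, h]
      rcases ih with hl | hl
      · exact Or.inl hl
      · exact Or.inr (List.mem_cons_of_mem _ hl)

/-- The spokes and radii of the balloons that are placed in the next round. -/
def roundBalloons (S : List ℕ) (rs : List ℝ) : List (ℕ × ℝ) :=
  List.zip (usedSpokes S) (rs.take (usedSpokes S).length)

/-- The radius of the safe disk after the next round. -/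
noncomputable def roundSafe (d : ℕ) (S : List ℕ) (safe : ℝ) (rs : List ℝ) : ℝ :=
  ((roundBalloons S rs).map fun q => centerDist d S safe q.1 q.2 + q.2).foldr max safe

open Classical in
/-- The record whether the next round is a wedge round. -/
noncomputable def roundWedge (d : ℕ) (S : List ℕ) (safe : ℝ) (rs : List ℝ) : Option ℕ :=
  if ∃ q ∈ roundBalloons S rs, safe + q.2 < centerDist d S safe q.1 q.2 then some S.length else none

theorem greedyRounds_of_lt {d f : ℕ} {S : List ℕ} (h : f + 2 < S.length) (safe : ℝ)
    (wedge : Option ℕ) (rs : List ℝ) :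
    greedyRounds d f S safe wedge rs =
      ⟨((roundBalloons S rs).map fun q => (q.1, centerDist d S safe q.1 q.2)) ++
        (greedyRounds d f (keptSpokes S) (roundSafe d S safe rs) (roundWedge d S safe rs)
          (rs.drop (usedSpokes S).length)).placed,
        (greedyRounds d f (keptSpokes S) (roundSafe d S safe rs) (roundWedge d S safe rs)
          (rs.drop (usedSpokes S).length)).free⟩ := by
  rw [greedyRounds, dif_pos h]
  rfl

theorem greedyRounds_of_not_lt {d f : ℕ} {S : List ℕ} (h : ¬ f + 2 < S.length) (safe : ℝ)
    (wedge : Option ℕ) (rs : List ℝ) :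
    greedyRounds d f S safe wedge rs = terminalLayout d f S safe wedge rs := by
  rw [greedyRounds, dif_neg h]

theorem zip_map_zip {α β γ : Type*} (g : α × β → γ) (u : List α) (t : List β)
    (h : u.length = t.length) :
    List.zip ((List.zip u t).map fun q => (q.1, g q)) t =
      (List.zip u t).map fun q => ((q.1, g q), q.2) := by
  induction u generalizing t with
  | nil => simp
  | cons a u ih =>
    match t with
    | [] => simp at h
    | b :: t =>
      simp only [List.zip_cons_cons, List.map_cons]
      rw [ih t (by simpa using h)]

theorem usedSpokes_kept_perm (S : List ℕ) : (usedSpokes S ++ keptSpokes S).Perm S := by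
  have h : ∀ S : List ℕ, (usedSpokes S ++ oddSpokes S).Perm S := by
    intro S
    induction S using oddSpokes.induct with
    | case1 a b t ih =>
      simp only [usedSpokes, oddSpokes, List.cons_append]
      refine List.Perm.trans (List.Perm.cons b List.perm_middle) ?_
      exact (List.Perm.swap a b _).trans ((ih.cons b).cons a)
    | case2 l hl =>
      match l, hl with
      | [], _ => simp [usedSpokes, oddSpokes]
      | [a], _ => simp [usedSpokes, oddSpokes]
      | a :: b :: t, hl => exact (hl a b t rfl).elim
  exact (List.Perm.append_left _ (List.rotate_perm _ _)).trans (h S)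

/-- The properties of a layout on the spokes `S`: `P` bounds the distance of the origin from the
balloons. -/
structure IsSeparated (d f : ℕ) (S : List ℕ) (P : ℝ) (rs : List ℝ) (lay : Layout) : Prop where
  length : lay.placed.length = rs.length
  perm : (lay.placed.map Prod.fst ++ lay.free).Perm S
  free_length : lay.free.length = f
  inner : ∀ q ∈ List.zip lay.placed rs, P ≤ q.1.2 - q.2
  pairwise : (List.zip lay.placed rs).Pairwise (Compat d)
  ray : ∀ q ∈ List.zip lay.placed rs, ∀ s ∈ lay.free, RayAvoids d q s
  angle : ∀ a b, lay.free = [a, b] → cosAng d a b ≤ -(1 / 2)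

theorem mem_of_mem_zip_placed {lay : Layout} {rs : List ℝ} {q : (ℕ × ℝ) × ℝ}
    (h : q ∈ List.zip lay.placed rs) : q.1.1 ∈ lay.placed.map Prod.fst ∧ q.2 ∈ rs := by
  have := List.of_mem_zip (a := q.1) (b := q.2) h
  exact ⟨List.mem_map.2 ⟨_, this.1, rfl⟩, this.2⟩

/-- Wedges separate the balloons of the round from each other and from the kept spokes. Against a
later balloon, a line orthogonal to the later spoke is used, at the distance `pushed` of the new
safe radius: the round projects to its inner side, and the induction hypothesis puts later balloons
on its outer side. -/
theorem isSeparated_round {d f l x g₁ g₂ G : ℕ} (hsp : Spread d l g₁ g₂ G) (hf : f = 1 ∨ f = 2)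
    (hl : f + 2 < l) {safe : ℝ} {wedge : Option ℕ} {rs : List ℝ} (hrs : rs.length + f = l)
    (hr : ∀ r ∈ rs, 0 ≤ r) (hsafe : 0 ≤ safe)
    (ih : 0 ≤ roundSafe d (spokeList d x (offset g₁ g₂ G) l) safe rs →
      0 ≤ pushed (roundSafe d (spokeList d x (offset g₁ g₂ G) l) safe rs)
        (roundWedge d (spokeList d x (offset g₁ g₂ G) l) safe rs) →
      IsSeparated d f (keptSpokes (spokeList d x (offset g₁ g₂ G) l))
        (pushed (roundSafe d (spokeList d x (offset g₁ g₂ G) l) safe rs)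
          (roundWedge d (spokeList d x (offset g₁ g₂ G) l) safe rs))
        (rs.drop (usedSpokes (spokeList d x (offset g₁ g₂ G) l)).length)
        (greedyRounds d f (keptSpokes (spokeList d x (offset g₁ g₂ G) l))
          (roundSafe d (spokeList d x (offset g₁ g₂ G) l) safe rs)
          (roundWedge d (spokeList d x (offset g₁ g₂ G) l) safe rs)
          (rs.drop (usedSpokes (spokeList d x (offset g₁ g₂ G) l)).length))) :
    IsSeparated d f (spokeList d x (offset g₁ g₂ G) l) (pushed safe wedge) rs
      (greedyRounds d f (spokeList d x (offset g₁ g₂ G) l) safe wedge rs) := by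
  have hpw := pairwise_usedSpokes (x := x) hsp.strictMono rfl hsp.sum
  have hβw : ∀ s ∈ usedSpokes (spokeList d x (offset g₁ g₂ G) l), _ :=
    fun s hs => hsp.le_wedgeAngle_used (by omega) hs
  have hnd := spokeList_nodup (x := x) hsp.strictMono hsp.sum
  have hd : 0 < d := hsp.sum ▸ (hsp.strictMono (show 0 < l by omega))
  have hcos : ∀ s t, s ∈ spokeList d x (offset g₁ g₂ G) l → t ∈ spokeList d x (offset g₁ g₂ G) l →
      t ≠ s → cosAng d s t ≤ Real.cos (wedgeAngle d (spokeList d x (offset g₁ g₂ G) l) s) :=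
    fun s t hs ht hts => cosAng_le_cos_wedgeAngle hd hs ht hts
  have hlen : (spokeList d x (offset g₁ g₂ G) l).length = l := by simp [spokeList]
  have hul : (usedSpokes (spokeList d x (offset g₁ g₂ G) l)).length = l / 2 := by
    rw [usedSpokes_spokeList]; simp
  rw [greedyRounds_of_lt (by rw [hlen]; exact hl)]
  generalize spokeList d x (offset g₁ g₂ G) l = S at *
  have hperm := usedSpokes_kept_perm S
  have htl : (usedSpokes S).length = (rs.take (usedSpokes S).length).length := by
    rw [List.length_take, hul]; omega
  set β := 2 * Real.pi / (2 * (l : ℝ) - 1) with hβ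
  have hl' : (4 : ℝ) ≤ l := by exact_mod_cast (show 4 ≤ l by omega)
  have hβ0 : 0 < β := by
    have := Real.pi_pos
    apply div_pos <;> linarith
  have hmemS : ∀ q ∈ roundBalloons S rs, q.1 ∈ usedSpokes S ∧ 0 ≤ q.2 := by
    intro q hq
    have := List.of_mem_zip (a := q.1) (b := q.2) hq
    exact ⟨this.1, hr _ (List.mem_of_mem_take this.2)⟩
  have husedS : ∀ s ∈ usedSpokes S, s ∈ S := fun s hs =>
    hperm.subset (List.mem_append_left _ hs)
  have hkeptS : ∀ s ∈ keptSpokes S, s ∈ S := fun s hs =>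
    hperm.subset (List.mem_append_right _ hs)
  have hdisj : ∀ s ∈ usedSpokes S, ∀ t ∈ keptSpokes S, t ≠ s := by
    have := (List.nodup_append.1 (hperm.symm.nodup hnd)).2.2
    intro s hs t ht hts
    exact this s hs t ht hts.symm
  have hwedge : ∀ q ∈ roundBalloons S rs,
      InWedge ((q.1, centerDist d S safe q.1 q.2), q.2) (wedgeAngle d S q.1) := fun q hq =>
    inWedge_centerDist (hβ0.trans_le (hβw _ (hmemS q hq).1)) hsafe (hmemS q hq).2
  have hsafe_le : safe ≤ roundSafe d S safe rs := (le_foldr_max _ _).1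
  have hle_safe : ∀ q ∈ roundBalloons S rs,
      centerDist d S safe q.1 q.2 + q.2 ≤ roundSafe d S safe rs := fun q hq =>
    (le_foldr_max _ _).2 _ (List.mem_map.2 ⟨q, hq, rfl⟩)
  have hproj' : ∀ q ∈ roundBalloons S rs,
      centerDist d S safe q.1 q.2 * Real.cos (wedgeAngle d S q.1) + q.2 ≤
        pushed (roundSafe d S safe rs) (roundWedge d S safe rs) := by
    intro q hq
    have hw := hwedge q hq
    unfold roundWedge
    split_ifs with hif
    · rw [hlen]
      exact proj_le_pushed hw.dist hw.radius hβ0.le (hβw _ (hmemS q hq).1) hw.le hw.inside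
        (hle_safe q hq)
    · simp only [pushed]
      refine le_trans ?_ (hle_safe q hq)
      have := mul_le_mul_of_nonneg_left (Real.cos_le_one (wedgeAngle d S q.1)) hw.dist
      simp only at this
      linarith
  have hproj : ∀ q ∈ roundBalloons S rs, ∀ t ∈ keptSpokes S,
      centerDist d S safe q.1 q.2 * cosAng d q.1 t + q.2 ≤
        pushed (roundSafe d S safe rs) (roundWedge d S safe rs) := by
    intro q hq t ht
    have hc := hcos q.1 t (husedS _ (hmemS q hq).1) (hkeptS t ht) (hdisj _ (hmemS q hq).1 t ht)
    have := mul_le_mul_of_nonneg_left hc (hwedge q hq).dist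
    simp only at this
    linarith [hproj' q hq]
  -- The new line does not fall behind the old safe disk. In a wedge round some balloon has c = r /
  -- sin μ > safe + r, and its projection c cos μ + r = c (cos μ + sin μ) is at least c.
  have hsp' : safe ≤ pushed (roundSafe d S safe rs) (roundWedge d S safe rs) := by
    by_cases hif : ∃ q ∈ roundBalloons S rs, safe + q.2 < centerDist d S safe q.1 q.2
    · obtain ⟨q, hq, hlt⟩ := hif
      refine le_trans ?_ (hproj' q hq)
      have hpos := hβ0.trans_le (hβw _ (hmemS q hq).1)
      have hw := hwedge q hq
      have hsin : 0 < Real.sin (wedgeAngle d S q.1) :=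
        Real.sin_pos_of_pos_of_lt_pi hpos (by linarith [hw.le, Real.pi_pos])
      have he : centerDist d S safe q.1 q.2 = q.2 / Real.sin (wedgeAngle d S q.1) := by
        rw [centerDist_eq hpos] at hlt ⊢
        rcases max_choice (q.2 / Real.sin (wedgeAngle d S q.1)) (safe + q.2) with h | h
        · exact h
        · rw [h] at hlt; exact absurd hlt (lt_irrefl _)
      have he' : q.2 = centerDist d S safe q.1 q.2 * Real.sin (wedgeAngle d S q.1) := by
        rw [he]; field_simp
      have h1 := one_le_sin_add_cos hpos.le hw.le
      have hc : 0 ≤ centerDist d S safe q.1 q.2 := hw.dist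
      generalize centerDist d S safe q.1 q.2 = c at *
      nlinarith [mul_le_mul_of_nonneg_left h1 hc, mul_nonneg hc hsin.le]
    · unfold roundWedge
      rw [if_neg hif]
      exact hsafe_le
  have ih := ih (hsafe.trans hsafe_le) (hsafe.trans hsp')
  set rest := greedyRounds d f (keptSpokes S) (roundSafe d S safe rs) (roundWedge d S safe rs)
          (rs.drop (usedSpokes S).length)
  have hzip : List.zip (((roundBalloons S rs).map fun q => (q.1, centerDist d S safe q.1 q.2)) ++
      rest.placed) rs = ((roundBalloons S rs).map fun q =>
        ((q.1, centerDist d S safe q.1 q.2), q.2)) ++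
        List.zip rest.placed (rs.drop (usedSpokes S).length) := by
    conv_lhs => rw [← List.take_append_drop (usedSpokes S).length rs]
    rw [List.zip_append]
    · rw [List.take_append_drop]
      congr 1
      exact zip_map_zip (fun q => centerDist d S safe q.1 q.2) _ _ htl
    · rw [List.take_append_drop]
      simp only [roundBalloons, List.length_map, List.length_zip]
      omega
  have hfst : (roundBalloons S rs).map Prod.fst = usedSpokes S := by
    unfold roundBalloons
    exact List.map_fst_zip htl.le
  have hplS : ∀ q ∈ List.zip rest.placed (rs.drop (usedSpokes S).length),
      q.1.1 ∈ keptSpokes S ∧ 0 ≤ q.2 := fun q hq =>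
    ⟨ih.perm.subset (List.mem_append_left _ (mem_of_mem_zip_placed hq).1),
      hr _ (List.mem_of_mem_drop (mem_of_mem_zip_placed hq).2)⟩
  have hfrS : ∀ s ∈ rest.free, s ∈ keptSpokes S := fun s hs =>
    ih.perm.subset (List.mem_append_right _ hs)
  have hray : ∀ q ∈ roundBalloons S rs, ∀ t ∈ keptSpokes S,
      RayAvoids d ((q.1, centerDist d S safe q.1 q.2), q.2) t := fun q hq t ht =>
    (hwedge q hq).rayAvoids
      (hcos q.1 t (husedS _ (hmemS q hq).1) (hkeptS t ht) (hdisj _ (hmemS q hq).1 t ht))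
  refine ⟨?_, ?_, ih.free_length, ?_, ?_, ?_, ih.angle⟩
  · have := ih.length
    simp only [List.length_append, List.length_map, this, List.length_drop, roundBalloons,
      List.length_zip]
    omega
  · simp only [List.map_append, List.map_map, List.append_assoc]
    rw [show (Prod.fst ∘ fun q : ℕ × ℝ => (q.1, centerDist d S safe q.1 q.2)) = Prod.fst from rfl,
      hfst]
    exact (List.Perm.append_left _ ih.perm).trans hperm
  · simp only [hzip]
    intro q hq
    rcases List.mem_append.1 hq with hq | hq
    · obtain ⟨q, hq, rfl⟩ := List.mem_map.1 hq
      simp only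
      linarith [le_centerDist d S q.1 safe q.2, pushed_le hsafe wedge]
    · linarith [ih.inner q hq, pushed_le hsafe wedge]
  · simp only [hzip]
    rw [List.pairwise_append]
    refine ⟨?_, ih.pairwise, ?_⟩
    · rw [List.pairwise_map]
      rw [← hfst, List.pairwise_map] at hpw
      refine hpw.imp_of_mem ?_
      intro q q' hq hq' h
      exact (hwedge q hq).compat (hwedge q' hq') h
    · intro e he q hq
      obtain ⟨e', he', rfl⟩ := List.mem_map.1 he
      exact compat_of_proj (hray e' he' _ (hplS q hq).1) (hmemS e' he').2
        (hproj e' he' _ (hplS q hq).1)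
        (hsafe.trans hsp') (hplS q hq).2 (ih.inner q hq)
  · simp only [hzip]
    intro q hq s hs
    rcases List.mem_append.1 hq with hq | hq
    · obtain ⟨q', hq', rfl⟩ := List.mem_map.1 hq
      exact hray q' hq' s (hfrS s hs)
    · exact ih.ray q hq s hs


/-! ### The terminal cases -/

theorem inWedge_half_pi {s : ℕ} {safe r : ℝ} (hsafe : 0 ≤ safe) (hr : 0 ≤ r) :
    InWedge ((s, safe + r), r) (Real.pi / 2) :=
  ⟨by positivity, le_rfl, hr, add_nonneg hsafe hr, by
    simp only [Real.sin_pi_div_two, mul_one]; linarith⟩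

theorem inWedge_max_alpha {s : ℕ} {φ t r : ℝ} (hφ : 0 < φ) (hφ' : φ ≤ Real.pi) (ht : 0 ≤ t)
    (hr : 0 ≤ r) : InWedge ((s, max (alpha φ * r - r) (t + r)), r) (φ / 2) := by
  have hs : 0 < Real.sin (φ / 2) :=
    Real.sin_pos_of_pos_of_lt_pi (by linarith) (by linarith [Real.pi_pos])
  refine ⟨by linarith, by linarith, hr, le_max_of_le_right (by simpa using add_nonneg ht hr), ?_⟩
  rw [alpha_mul_sub hs.ne', ← div_le_iff₀ hs]
  exact le_max_left _ _

/-- Writing the angle as m π / k turns the conditions on the arcs into inequalities between natural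
numbers, which `omega` decides from the bounds on the gaps. -/
theorem cosAng_mod_add_le' {d x a b m k : ℕ} (h1 : a < b) (h2 : b < a + d) (hk : 0 < k)
    (hm : m * d ≤ 2 * k * (b - a)) (hm' : m * d ≤ 2 * k * (d - (b - a))) {μ : ℝ}
    (hμ : μ = m * Real.pi / k) :
    cosAng d ((x + a) % d) ((x + b) % d) ≤ Real.cos μ := by
  have hk' : (0 : ℝ) < k := by positivity
  have hp := Real.pi_pos
  have e1 : (m : ℝ) * d ≤ 2 * k * ((b - a : ℕ) : ℝ) := by exact_mod_cast hm
  have e2 : (m : ℝ) * d ≤ 2 * k * ((d - (b - a) : ℕ) : ℝ) := by exact_mod_cast hm'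
  subst hμ
  apply cosAng_mod_add_le h1 h2 (by positivity)
  · rw [div_mul_eq_mul_div, div_le_iff₀ hk']; nlinarith
  · rw [div_mul_eq_mul_div, div_le_iff₀ hk']; nlinarith

theorem cos_two_pi_div_three : Real.cos (2 * Real.pi / 3) = -(1 / 2) := by
  rw [show 2 * Real.pi / 3 = Real.pi - Real.pi / 3 by ring, Real.cos_pi_sub, Real.cos_pi_div_three]

section Terminal

variable {d x g₁ g₂ G : ℕ} {safe : ℝ} {wedge : Option ℕ}

theorem isSeparated_two (h : Spread d 2 g₁ g₂ G) {r : ℝ} (hr : 0 ≤ r) (hsafe : 0 ≤ safe) :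
    IsSeparated d 1 (spokeList d x (offset g₁ g₂ G) 2) (pushed safe wedge) [r]
      (terminalLayout d 1 (spokeList d x (offset g₁ g₂ G) 2) safe wedge [r]) := by
  obtain ⟨-, hG, h1, h2, h3, h4, hs⟩ := h
  simp only [offset] at hs
  have hS : spokeList d x (offset g₁ g₂ G) 2 = [(x + 0) % d, (x + g₁) % d] := rfl
  have hp := pushed_le hsafe wedge
  rw [hS]
  simp only [terminalLayout]
  have ab : cosAng d ((x + 0) % d) ((x + g₁) % d) ≤ Real.cos (Real.pi / 2) :=
    cosAng_mod_add_le' (m := 1) (k := 2) (by omega) (by omega) (by omega) (by omega) (by omega)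
      (by norm_num)
  refine ⟨rfl, by simp, rfl, ?_, by simp, ?_, by simp⟩
  · simp; linarith
  · simpa using (inWedge_half_pi hsafe hr).rayAvoids ab

/-- The outer spokes are at least d/3 apart both ways, and 2π/3 = π/6 + π/2 leaves room for a wedge
of half-angle π/6 and a half-plane. The larger of g₁ and g₂ is at least d/4, so the free spoke does
not enter the half-plane of the larger balloon. -/
theorem isSeparated_three_one (h : Spread d 3 g₁ g₂ G) {r r' : ℝ} (hr : 0 ≤ r) (hr' : 0 ≤ r')
    (hsafe : 0 ≤ safe) :
    IsSeparated d 1 (spokeList d x (offset g₁ g₂ G) 3) (pushed safe wedge) [r', r]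
      (terminalLayout d 1 (spokeList d x (offset g₁ g₂ G) 3) safe wedge [r', r]) := by
  obtain ⟨-, hG, h1, h2, h3, h4, hs⟩ := h
  simp only [offset] at hs
  have hS : spokeList d x (offset g₁ g₂ G) 3 =
      [(x + 0) % d, (x + g₁) % d, (x + (g₁ + g₂ + 0 * G)) % d] := rfl
  rw [Nat.zero_mul, Nat.add_zero (g₁ + g₂)] at hS
  have hp := pushed_le hsafe wedge
  have hpi := Real.pi_pos
  rw [hS]
  simp only [terminalLayout]
  rw [(gap_mod_add (x := x) (show 0 < g₁ by omega) (by omega)).1,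
    (gap_mod_add (x := x) (show g₁ < g₁ + g₂ by omega) (by omega)).1]
  have ac : cosAng d ((x + 0) % d) ((x + (g₁ + g₂)) % d) ≤
      Real.cos (Real.pi / 3 / 2 + Real.pi / 2) :=
    cosAng_mod_add_le' (m := 2) (k := 3) (by omega) (by omega) (by omega) (by omega) (by omega)
      (by push_cast; ring)
  split_ifs with hif
  · have ab : cosAng d ((x + 0) % d) ((x + g₁) % d) ≤ Real.cos (Real.pi / 3 / 2) :=
      cosAng_mod_add_le' (m := 1) (k := 6) (by omega) (by omega) (by omega) (by omega) (by omega)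
        (by push_cast; ring)
    have bc : cosAng d ((x + g₁) % d) ((x + (g₁ + g₂)) % d) ≤ Real.cos (Real.pi / 2) :=
      cosAng_mod_add_le' (m := 1) (k := 2) (by omega) (by omega) (by omega) (by omega) (by omega)
        (by norm_num)
    have wa : InWedge (((x + 0) % d, max (alpha (Real.pi / 3) * r' - r') (safe + r')), r') _ :=
      inWedge_max_alpha (by linarith) (by linarith) hsafe hr'
    have wc : InWedge (((x + (g₁ + g₂)) % d, safe + r), r) _ := inWedge_half_pi hsafe hr
    refine ⟨rfl, ?_, rfl, ?_, ?_, ?_, by simp⟩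
    · simp only [List.map_cons, List.map_nil, List.cons_append, List.nil_append]
      exact (List.Perm.swap _ _ _).cons _
    · simp only [List.zip_cons_cons, List.zip_nil_right, List.mem_cons, List.not_mem_nil, or_false]
      rintro q (rfl | rfl)
      · have := le_max_right (alpha (Real.pi / 3) * r' - r') (safe + r')
        simp only; linarith
      · simp only; linarith
    · simpa using wa.compat wc ac
    · simp only [List.zip_cons_cons, List.zip_nil_right, List.mem_cons, List.not_mem_nil, or_false]
      rintro q (rfl | rfl) s rfl
      · exact wa.rayAvoids ab
      · exact wc.rayAvoids (by rw [cosAng_comm]; exact bc)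
  · have ab : cosAng d ((x + 0) % d) ((x + g₁) % d) ≤ Real.cos (Real.pi / 2) :=
      cosAng_mod_add_le' (m := 1) (k := 2) (by omega) (by omega) (by omega) (by omega) (by omega)
        (by norm_num)
    have bc : cosAng d ((x + g₁) % d) ((x + (g₁ + g₂)) % d) ≤ Real.cos (Real.pi / 3 / 2) :=
      cosAng_mod_add_le' (m := 1) (k := 6) (by omega) (by omega) (by omega) (by omega) (by omega)
        (by push_cast; ring)
    have wc : InWedge (((x + (g₁ + g₂)) % d,
        max (alpha (Real.pi / 3) * r' - r') (safe + r')), r') _ :=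
      inWedge_max_alpha (by linarith) (by linarith) hsafe hr'
    have wa : InWedge (((x + 0) % d, safe + r), r) _ := inWedge_half_pi hsafe hr
    refine ⟨rfl, ?_, rfl, ?_, ?_, ?_, by simp⟩
    · simp only [List.map_cons, List.map_nil, List.cons_append, List.nil_append]
      exact ((List.Perm.swap _ _ _).trans ((List.Perm.swap _ _ _).cons _))
    · simp only [List.zip_cons_cons, List.zip_nil_right, List.mem_cons, List.not_mem_nil, or_false]
      rintro q (rfl | rfl)
      · have := le_max_right (alpha (Real.pi / 3) * r' - r') (safe + r')
        simp only; linarith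
      · simp only; linarith
    · simpa using wc.compat wa (by rw [cosAng_comm]; exact ac)
    · simp only [List.zip_cons_cons, List.zip_nil_right, List.mem_cons, List.not_mem_nil, or_false]
      rintro q (rfl | rfl) s rfl
      · exact wc.rayAvoids (by rw [cosAng_comm]; exact bc)
      · exact wa.rayAvoids ab

/-- Since g₁ + g₂ + G ≤ 5 gᵢ, the balloon has a wedge of half-angle 2π/5. The free spokes are d/3 or
more apart both ways, as g₁ + g₂ ≥ G ≥ d/3; the heavy path needs this angle 2π/3. -/
theorem isSeparated_three_two (h : Spread d 3 g₁ g₂ G) {r : ℝ} (hr : 0 ≤ r)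
    (hP : 0 ≤ pushed safe wedge) :
    IsSeparated d 2 (spokeList d x (offset g₁ g₂ G) 3) (pushed safe wedge) [r]
      (terminalLayout d 2 (spokeList d x (offset g₁ g₂ G) 3) safe wedge [r]) := by
  obtain ⟨-, hG, h1, h2, h3, h4, hs⟩ := h
  simp only [offset] at hs
  have hS : spokeList d x (offset g₁ g₂ G) 3 =
      [(x + 0) % d, (x + g₁) % d, (x + (g₁ + g₂ + 0 * G)) % d] := rfl
  rw [Nat.zero_mul, Nat.add_zero (g₁ + g₂)] at hS
  have hpi := Real.pi_pos
  rw [hS]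
  simp only [terminalLayout]
  have ac : cosAng d ((x + 0) % d) ((x + (g₁ + g₂)) % d) ≤ Real.cos (2 * Real.pi / 3) :=
    cosAng_mod_add_le' (m := 2) (k := 3) (by omega) (by omega) (by omega) (by omega) (by omega)
      (by norm_num)
  have ab : cosAng d ((x + 0) % d) ((x + g₁) % d) ≤ Real.cos (4 * Real.pi / 5 / 2) :=
    cosAng_mod_add_le' (m := 2) (k := 5) (by omega) (by omega) (by omega) (by omega) (by omega)
      (by push_cast; ring)
  have bc : cosAng d ((x + g₁) % d) ((x + (g₁ + g₂)) % d) ≤ Real.cos (4 * Real.pi / 5 / 2) :=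
    cosAng_mod_add_le' (m := 2) (k := 5) (by omega) (by omega) (by omega) (by omega) (by omega)
      (by push_cast; ring)
  have wb : InWedge (((x + g₁) % d,
      max (alpha (4 * Real.pi / 5) * r - r) (pushed safe wedge + r)), r) _ :=
    inWedge_max_alpha (by linarith) (by linarith) hP hr
  refine ⟨rfl, ?_, rfl, ?_, by simp, ?_, ?_⟩
  · simp only [List.map_cons, List.map_nil, List.cons_append, List.nil_append]
    exact List.Perm.swap _ _ _
  · simp only [List.zip_cons_cons, List.zip_nil_right, List.mem_cons, List.not_mem_nil, or_false]
    rintro q rfl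
    have := le_max_right (alpha (4 * Real.pi / 5) * r - r) (pushed safe wedge + r)
    simp only; linarith
  · simp only [List.zip_cons_cons, List.zip_nil_right, List.mem_cons, List.not_mem_nil, or_false]
    rintro q rfl s (rfl | rfl)
    · exact wb.rayAvoids (by rw [cosAng_comm]; exact ab)
    · exact wb.rayAvoids bc
  · rintro a b h
    simp only [List.cons.injEq, and_true] at h
    rw [← h.1, ← h.2, ← cos_two_pi_div_three]
    exact ac

/-- Since g₁ + g₂ + 2G ≤ 7 gᵢ, the smaller balloon has a wedge of half-angle 2π/7. The larger one
has a half-plane, and 2π/7 + π/2 = 11π/14 is available between the two. -/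
theorem isSeparated_four (h : Spread d 4 g₁ g₂ G) {r r' : ℝ} (hr : 0 ≤ r) (hr' : 0 ≤ r')
    (hsafe : 0 ≤ safe) :
    IsSeparated d 2 (spokeList d x (offset g₁ g₂ G) 4) (pushed safe wedge) [r', r]
      (terminalLayout d 2 (spokeList d x (offset g₁ g₂ G) 4) safe wedge [r', r]) := by
  obtain ⟨-, hG, h1, h2, h3, h4, hs⟩ := h
  simp only [offset] at hs
  have hS : spokeList d x (offset g₁ g₂ G) 4 =
      [(x + 0) % d, (x + g₁) % d, (x + (g₁ + g₂ + 0 * G)) % d, (x + (g₁ + g₂ + 1 * G)) % d] := rfl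
  rw [Nat.zero_mul, Nat.one_mul, Nat.add_zero (g₁ + g₂)] at hS
  have hp := pushed_le hsafe wedge
  have hpi := Real.pi_pos
  rw [hS]
  simp only [terminalLayout]
  have ac : cosAng d ((x + 0) % d) ((x + (g₁ + g₂)) % d) ≤ Real.cos (2 * Real.pi / 3) :=
    cosAng_mod_add_le' (m := 2) (k := 3) (by omega) (by omega) (by omega) (by omega) (by omega)
      (by norm_num)
  have ab : cosAng d ((x + 0) % d) ((x + g₁) % d) ≤ Real.cos (4 * Real.pi / 7 / 2) :=
    cosAng_mod_add_le' (m := 2) (k := 7) (by omega) (by omega) (by omega) (by omega) (by omega)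
      (by push_cast; ring)
  have bc : cosAng d ((x + g₁) % d) ((x + (g₁ + g₂)) % d) ≤ Real.cos (4 * Real.pi / 7 / 2) :=
    cosAng_mod_add_le' (m := 2) (k := 7) (by omega) (by omega) (by omega) (by omega) (by omega)
      (by push_cast; ring)
  have ae : cosAng d ((x + 0) % d) ((x + (g₁ + g₂ + G)) % d) ≤ Real.cos (Real.pi / 2) :=
    cosAng_mod_add_le' (m := 1) (k := 2) (by omega) (by omega) (by omega) (by omega) (by omega)
      (by norm_num)
  have ce : cosAng d ((x + (g₁ + g₂)) % d) ((x + (g₁ + g₂ + G)) % d) ≤ Real.cos (Real.pi / 2) :=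
    cosAng_mod_add_le' (m := 1) (k := 2) (by omega) (by omega) (by omega) (by omega) (by omega)
      (by norm_num)
  have be : cosAng d ((x + g₁) % d) ((x + (g₁ + g₂ + G)) % d) ≤
      Real.cos (4 * Real.pi / 7 / 2 + Real.pi / 2) :=
    cosAng_mod_add_le' (m := 11) (k := 14) (by omega) (by omega) (by omega) (by omega) (by omega)
      (by push_cast; ring)
  have wb : InWedge (((x + g₁) % d,
      max (alpha (4 * Real.pi / 7) * r' - r') (safe + r')), r') _ :=
    inWedge_max_alpha (by linarith) (by linarith) hsafe hr'
  have we : InWedge (((x + (g₁ + g₂ + G)) % d, safe + r), r) _ := inWedge_half_pi hsafe hr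
  refine ⟨rfl, ?_, rfl, ?_, ?_, ?_, ?_⟩
  · simp only [List.map_cons, List.map_nil, List.cons_append, List.nil_append]
    refine List.Perm.trans ?_ (List.Perm.swap _ _ _)
    exact ((List.Perm.swap _ _ _).trans ((List.Perm.swap _ _ _).cons _)).cons _
  · simp only [List.zip_cons_cons, List.zip_nil_right, List.mem_cons, List.not_mem_nil, or_false]
    rintro q (rfl | rfl)
    · have := le_max_right (alpha (4 * Real.pi / 7) * r' - r') (safe + r')
      simp only; linarith
    · simp only; linarith
  · simpa using wb.compat we be
  · simp only [List.zip_cons_cons, List.zip_nil_right, List.mem_cons, List.not_mem_nil, or_false]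
    rintro q (rfl | rfl) s (rfl | rfl)
    · exact wb.rayAvoids (by rw [cosAng_comm]; exact ab)
    · exact wb.rayAvoids bc
    · exact we.rayAvoids (by rw [cosAng_comm]; exact ae)
    · exact we.rayAvoids (by rw [cosAng_comm]; exact ce)
  · rintro a b h
    simp only [List.cons.injEq, and_true] at h
    rw [← h.1, ← h.2, ← cos_two_pi_div_three]
    exact ac

end Terminal

theorem isSeparated_greedyRounds {d f : ℕ} (hf : f = 1 ∨ f = 2) (l : ℕ) :
    ∀ {x g₁ g₂ G : ℕ} {safe : ℝ} {wedge : Option ℕ} {rs : List ℝ}, Spread d l g₁ g₂ G → f < l →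
      rs.length + f = l → (∀ r ∈ rs, 0 ≤ r) → 0 ≤ safe → 0 ≤ pushed safe wedge →
      IsSeparated d f (spokeList d x (offset g₁ g₂ G) l) (pushed safe wedge) rs
        (greedyRounds d f (spokeList d x (offset g₁ g₂ G) l) safe wedge rs) := by
  induction l using Nat.strong_induction_on with
  | _ l ih =>
    intro x g₁ g₂ G safe wedge rs hsp hfl hrs hr hsafe hP
    have hlen : (spokeList d x (offset g₁ g₂ G) l).length = l := by simp [spokeList]
    have hul : (usedSpokes (spokeList d x (offset g₁ g₂ G) l)).length = l / 2 := by
      rw [usedSpokes_spokeList]; simp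
    by_cases hl : f + 2 < l
    · refine isSeparated_round hsp hf hl hrs hr hsafe fun h1 h2 => ?_
      obtain ⟨x', g₁', hk, hsp'⟩ := keptSpokes_spokeList (x := x) (by omega) hsp
      rw [hk] at *
      refine ih _ (by omega) hsp' (by omega) ?_ (fun r h => hr r (List.mem_of_mem_drop h)) h1 h2
      rw [List.length_drop, hul]
      omega
    · rw [greedyRounds_of_not_lt (by rw [hlen]; exact hl)]
      have hcase : f = 1 ∧ l = 2 ∨ f = 1 ∧ l = 3 ∨ f = 2 ∧ l = 3 ∨ f = 2 ∧ l = 4 := by omega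
      rcases hcase with ⟨rfl, rfl⟩ | ⟨rfl, rfl⟩ | ⟨rfl, rfl⟩ | ⟨rfl, rfl⟩
      · obtain ⟨r, rfl⟩ := List.length_eq_one_iff.1 (show rs.length = 1 by omega)
        exact isSeparated_two hsp (hr r (by simp)) hsafe
      · obtain ⟨r', r, rfl⟩ := List.length_eq_two.1 (show rs.length = 2 by omega)
        exact isSeparated_three_one hsp (hr r (by simp)) (hr r' (by simp)) hsafe
      · obtain ⟨r, rfl⟩ := List.length_eq_one_iff.1 (show rs.length = 1 by omega)
        exact isSeparated_three_two hsp (hr r (by simp)) hP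
      · obtain ⟨r', r, rfl⟩ := List.length_eq_two.1 (show rs.length = 2 by omega)
        exact isSeparated_four hsp (hr r (by simp)) (hr r' (by simp)) hsafe

/-- The greedy layout separates the balloons, for one or two free spokes. -/
theorem isSeparated_greedyLayout {d f : ℕ} {rs : List ℝ} (hd : rs.length + f = d)
    (hf : f = 1 ∨ f = 2) (hr : ∀ r ∈ rs, 0 ≤ r) :
    IsSeparated d f (List.range d) 0 rs (greedyLayout d f rs) := by
  by_cases hfd : f < d
  · obtain ⟨h1, h2⟩ := range_eq_spokeList (d := d) (by omega)
    unfold greedyLayout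
    rw [h1]
    exact isSeparated_greedyRounds (safe := 0) (wedge := none) hf d h2 hfd hd hr le_rfl
      (le_refl (0 : ℝ))
  · obtain rfl : rs = [] := List.length_eq_zero_iff.1 (by omega)
    obtain rfl : f = d := by simpa using hd
    unfold greedyLayout
    rw [greedyRounds_of_not_lt (by simp)]
    have : terminalLayout f f (List.range f) 0 none [] = ⟨[], List.range f⟩ := by
      rcases hf with rfl | rfl <;> rfl
    rw [this]
    refine ⟨rfl, by simp, by simp, by simp, by simp, by simp, ?_⟩
    rcases hf with rfl | rfl
    · simp
    · intro a b h
      have h' : [0, 1] = [a, b] := h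
      simp only [List.cons.injEq, and_true] at h'
      rw [← h'.1, ← h'.2]
      unfold cosAng
      rw [show 2 * Real.pi * (((0 : ℕ) : ℝ) - (1 : ℕ)) / ((2 : ℕ) : ℝ) = -Real.pi by
        push_cast; ring, Real.cos_neg, Real.cos_pi]
      norm_num


/-! ### The size of the greedy layout -/

theorem add_mul_le_sum {a b : ℝ} {t : List ℝ} (hb : b ∈ t) (h : ∀ c ∈ t, a ≤ c) :
    b + ((t.length : ℝ) - 1) * a ≤ t.sum := by
  induction t with
  | nil => simp at hb
  | cons c t ih =>
    have hc := h c (by simp)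
    have ht : ∀ c ∈ t, a ≤ c := fun c hc => h c (by simp [hc])
    simp only [List.length_cons, List.sum_cons]
    push_cast
    rcases List.mem_cons.1 hb with rfl | hb
    · have := List.card_nsmul_le_sum t a ht
      rw [nsmul_eq_mul] at this
      linarith
    · have := ih hb ht
      linarith

/-- Jordan's inequality sin x ≥ 2x/π, at x = 2π/k. -/
theorem one_div_sin_le {μ k : ℝ} (hk : 4 ≤ k) (hμ : 2 * Real.pi / k ≤ μ) (hμ' : μ ≤ Real.pi / 2) :
    1 / Real.sin μ ≤ k / 4 := by
  have hp := Real.pi_pos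
  have h0 : 0 < 2 * Real.pi / k := by positivity
  have h1 := Real.mul_le_sin h0.le (hμ.trans hμ')
  have h2 : 2 / Real.pi * (2 * Real.pi / k) = 4 / k := by field_simp; norm_num
  have h3 : Real.sin (2 * Real.pi / k) ≤ Real.sin μ :=
    Real.sin_le_sin_of_le_of_le_pi_div_two (by linarith) hμ' hμ
  rw [div_le_iff₀ (lt_of_lt_of_le (by rw [← h2] at *; positivity) (h1.trans h3))]
  rw [h2] at h1
  have h4 : k / 4 * (4 / k) = 1 := by field_simp
  have h5 := mul_le_mul_of_nonneg_left (h1.trans h3) (show 0 ≤ k / 4 by linarith)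
  linarith

theorem alpha_four_pi_div_five : alpha (4 * Real.pi / 5) = kappa := by
  have h := sin_two_pi_div_five
  have hs : Real.sin (2 * Real.pi / 5) ≠ 0 := by
    intro h0; rw [h0] at h; simp at h
  unfold alpha
  rw [show 4 * Real.pi / 5 / 2 = 2 * Real.pi / 5 by ring]
  rw [div_eq_iff hs]
  linarith

theorem one_add_one_div_sin_le_kappa {μ : ℝ} (hμ : 2 * Real.pi / 5 ≤ μ) (hμ' : μ ≤ Real.pi / 2) :
    1 + 1 / Real.sin μ ≤ kappa := by
  have hp := Real.pi_pos
  have h := sin_two_pi_div_five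
  have hk := kappa_bounds.1
  have h3 : Real.sin (2 * Real.pi / 5) ≤ Real.sin μ :=
    Real.sin_le_sin_of_le_of_le_pi_div_two (by linarith) hμ' hμ
  have h4 : 0 < Real.sin (2 * Real.pi / 5) :=
    Real.sin_pos_of_pos_of_lt_pi (by positivity) (by linarith)
  have h5 : 1 / Real.sin μ ≤ kappa - 1 := by
    rw [div_le_iff₀ (by linarith)]
    nlinarith
  linarith

/-- A wedge of half-angle π/3 can give the safe radius (1 + 2/√3) ρ ≈ 2.155 ρ, more than κ ρ.
Pushing brings it down to 2 ρ; with β = 2π/11 the crude bounds cos β ≤ √3/2 and sin β ≤ √2/2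
suffice. -/
theorem pushed_six_le {s ρ μ : ℝ} (hρ : 0 ≤ ρ) (hμ : 2 * Real.pi / 6 ≤ μ) (hμ' : μ ≤ Real.pi / 2)
    (hs : s = ρ / Real.sin μ + ρ) : pushed s (some 6) ≤ 2 * ρ := by
  have hp := Real.pi_pos
  have h3 : √3 ^ 2 = 3 := Real.sq_sqrt (by norm_num)
  have h30 : 0 ≤ √3 := Real.sqrt_nonneg 3
  have h3l : 1.732 < √3 := by nlinarith
  have h3u : √3 < 1.7321 := by nlinarith
  have hsin : √3 / 2 ≤ Real.sin μ := by
    rw [← Real.sin_pi_div_three]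
    exact Real.sin_le_sin_of_le_of_le_pi_div_two (by linarith) hμ' (by linarith)
  have hs' : s ≤ 2.1548 * ρ := by
    have : ρ / Real.sin μ ≤ 1.1548 * ρ := by
      rw [div_le_iff₀ (by linarith)]
      nlinarith
    linarith
  have hs0 : 0 ≤ s := by
    rw [hs]
    have : 0 < Real.sin μ := by linarith
    positivity
  simp only [pushed]
  push_cast
  rw [show 2 * Real.pi / (2 * 6 - 1) = 2 * Real.pi / 11 by norm_num]
  set β := 2 * Real.pi / 11 with hβ
  have c1 : Real.cos β ≤ √3 / 2 := by
    rw [← Real.cos_pi_div_six]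
    exact Real.cos_le_cos_of_nonneg_of_le_pi (by linarith) (by rw [hβ]; linarith) (by rw [hβ]; linarith)
  have c0 : 0 ≤ Real.cos β :=
    Real.cos_nonneg_of_neg_pi_div_two_le_of_le (by rw [hβ]; linarith) (by rw [hβ]; linarith)
  have s1 : Real.sin β ≤ √2 / 2 := by
    rw [← Real.sin_pi_div_four]
    exact Real.sin_le_sin_of_le_of_le_pi_div_two (by rw [hβ]; linarith) (by linarith)
      (by rw [hβ]; linarith)
  have s0 : 0 ≤ Real.sin β :=
    Real.sin_nonneg_of_nonneg_of_le_pi (by rw [hβ]; linarith) (by rw [hβ]; linarith)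
  have h2 : √2 ^ 2 = 2 := Real.sq_sqrt (by norm_num)
  have h2u : √2 < 1.5 := by nlinarith [Real.sqrt_nonneg 2]
  rw [div_le_iff₀ (by linarith)]
  calc s * (Real.sin β + Real.cos β) ≤ 2.1548 * ρ * (Real.sin β + Real.cos β) :=
        mul_le_mul_of_nonneg_right hs' (by linarith)
    _ = ρ * (2.1548 * (Real.sin β + Real.cos β)) := by ring
    _ ≤ ρ * (2 * (Real.sin β + 1)) := mul_le_mul_of_nonneg_left (by linarith) hρ
    _ = 2 * ρ * (Real.sin β + 1) := by ring

/-- The radius of a layout on `l` spokes, `f` of which stay free, when the radii are at least `a`. -/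
noncomputable def sizeBound (l f : ℕ) (a safe : ℝ) (rs : List ℝ) : ℝ :=
  max (safe + kappa * (rs.sum - ((l : ℝ) - 1 - f) / 2 * a)) (kappa * rs.sum)

/-- A balloon touching the safe disk falls under the first term of the maximum, as its diameter is
below κ r. A balloon held by its wedge does not depend on `safe` and falls under the second: it
reaches κ r on three spokes with two free, and otherwise at most 3 r', which κ (r' + r) covers
because r' ≤ r. -/
theorem size_terminal {d f l x g₁ g₂ G : ℕ} (hf : f = 1 ∨ f = 2) (hfl : f < l)
    (hl : ¬ f + 2 < l) {a safe : ℝ} {wedge : Option ℕ} {rs : List ℝ} (hrs : rs.length + f = l)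
    (ha : 0 ≤ a) (har : ∀ r ∈ rs, a ≤ r) (hsort : rs.Pairwise (· ≤ ·)) (hsafe : 0 ≤ safe) :
    ∀ q ∈ List.zip (terminalLayout d f (spokeList d x (offset g₁ g₂ G) l) safe wedge rs).placed rs,
      q.1.2 + q.2 ≤ sizeBound l f a safe rs := by
  have hk := kappa_bounds
  have hp := Real.pi_pos
  have hcase : f = 1 ∧ l = 2 ∨ f = 1 ∧ l = 3 ∨ f = 2 ∧ l = 3 ∨ f = 2 ∧ l = 4 := by omega
  rcases hcase with ⟨rfl, rfl⟩ | ⟨rfl, rfl⟩ | ⟨rfl, rfl⟩ | ⟨rfl, rfl⟩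
  · obtain ⟨r, rfl⟩ := List.length_eq_one_iff.1 (show rs.length = 1 by omega)
    have har := har r (by simp)
    have hS : spokeList d x (offset g₁ g₂ G) 2 = [(x + 0) % d, (x + g₁) % d] := rfl
    rw [hS]
    simp only [terminalLayout, List.zip_cons_cons, List.zip_nil_right, List.mem_cons,
      List.not_mem_nil, or_false, sizeBound]
    rintro q rfl
    apply le_max_of_le_left
    simp
    norm_num
    nlinarith
  · obtain ⟨r', r, rfl⟩ := List.length_eq_two.1 (show rs.length = 2 by omega)
    have hr' := har r' (by simp)
    have hr : r' ≤ r := by simpa using hsort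
    have hS : spokeList d x (offset g₁ g₂ G) 3 =
      [(x + 0) % d, (x + g₁) % d, (x + (g₁ + g₂ + 0 * G)) % d] := rfl
    have hα : alpha (Real.pi / 3) * r' - r' = 2 * r' := by
      rw [alpha_mul_sub] <;> rw [show Real.pi / 3 / 2 = Real.pi / 6 by ring, Real.sin_pi_div_six]
      · ring
      · norm_num
    have e1 : max (alpha (Real.pi / 3) * r' - r') (safe + r') + r' ≤
        sizeBound 3 1 a safe [r', r] := by
      rw [hα, ← max_add_add_right, max_comm]
      apply max_le_max
      · simp
        norm_num
        nlinarith
      · simp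
        nlinarith
    have e2 : safe + r + r ≤ sizeBound 3 1 a safe [r', r] := by
      apply le_max_of_le_left
      simp
      norm_num
      nlinarith
    rw [hS]
    simp only [terminalLayout]
    split_ifs
    all_goals
      simp only [List.zip_cons_cons, List.zip_nil_right, List.mem_cons, List.not_mem_nil, or_false]
      rintro q (rfl | rfl)
      · exact e1
      · exact e2
  · obtain ⟨r, rfl⟩ := List.length_eq_one_iff.1 (show rs.length = 1 by omega)
    have har := har r (by simp)
    have hS : spokeList d x (offset g₁ g₂ G) 3 =
      [(x + 0) % d, (x + g₁) % d, (x + (g₁ + g₂ + 0 * G)) % d] := rfl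
    rw [hS]
    simp only [terminalLayout, List.zip_cons_cons, List.zip_nil_right, List.mem_cons,
      List.not_mem_nil, or_false, sizeBound]
    rintro q rfl
    have hpu := pushed_le hsafe wedge
    rw [alpha_four_pi_div_five]
    simp only
    rw [← max_add_add_right, max_comm]
    apply max_le_max
    · simp
      norm_num
      nlinarith
    · simp
  · obtain ⟨r', r, rfl⟩ := List.length_eq_two.1 (show rs.length = 2 by omega)
    have hr' := har r' (by simp)
    have hr : r' ≤ r := by simpa using hsort
    have hS : spokeList d x (offset g₁ g₂ G) 4 =
      [(x + 0) % d, (x + g₁) % d, (x + (g₁ + g₂ + 0 * G)) % d, (x + (g₁ + g₂ + 1 * G)) % d] := rfl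
    have hα : alpha (4 * Real.pi / 7) * r' - r' ≤ 7 / 4 * r' := by
      have h1 := one_div_sin_le (μ := 2 * Real.pi / 7) (k := 7) (by norm_num) le_rfl (by linarith)
      have h2 : 0 < Real.sin (2 * Real.pi / 7) :=
        Real.sin_pos_of_pos_of_lt_pi (by linarith) (by linarith)
      rw [alpha_mul_sub] <;> rw [show 4 * Real.pi / 7 / 2 = 2 * Real.pi / 7 by ring]
      · rw [div_eq_mul_one_div, mul_comm]
        exact mul_le_mul_of_nonneg_right h1 (ha.trans hr')
      · exact h2.ne'
    rw [hS]
    simp only [terminalLayout, List.zip_cons_cons, List.zip_nil_right, List.mem_cons,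
      List.not_mem_nil, or_false, sizeBound]
    rintro q (rfl | rfl)
    · simp only
      rw [← max_add_add_right, max_comm]
      apply max_le_max
      · simp
        norm_num
        nlinarith
      · simp
        nlinarith
    · apply le_max_of_le_left
      simp
      norm_num
      nlinarith

-- In later rounds only one balloon per layer determines the growth, so the others, of radius at
-- least `a`, are partly saved: half an `a` for each remaining balloon but one. A layer touching the
-- safe disk preserves this account. A wedge layer forgets `safe` and restarts at q (1 + 1 / sin μ);
-- all later radii are at least q, so the account restarts with `a = q` and its savings cover the
-- excess.
set_option maxHeartbeats 1000000 in
theorem size_greedyRounds {d f : ℕ} (hf : f = 1 ∨ f = 2) (l : ℕ) :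
    ∀ {x g₁ g₂ G : ℕ} {a safe : ℝ} {wedge : Option ℕ} {rs : List ℝ}, Spread d l g₁ g₂ G → f < l →
      rs.length + f = l → 0 ≤ a → (∀ r ∈ rs, a ≤ r) → rs.Pairwise (· ≤ ·) → 0 ≤ safe →
      ∀ q ∈ List.zip (greedyRounds d f (spokeList d x (offset g₁ g₂ G) l) safe wedge rs).placed rs,
        q.1.2 + q.2 ≤ sizeBound l f a safe rs := by
  induction l using Nat.strong_induction_on with
  | _ l ih =>
    intro x g₁ g₂ G a safe wedge rs hsp hfl hrs ha har hsort hsafe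
    have hlen : (spokeList d x (offset g₁ g₂ G) l).length = l := by simp [spokeList]
    have hul : (usedSpokes (spokeList d x (offset g₁ g₂ G) l)).length = l / 2 := by
      rw [usedSpokes_spokeList]; simp
    by_cases hl : f + 2 < l
    swap
    · rw [greedyRounds_of_not_lt (by rw [hlen]; exact hl)]
      exact size_terminal hf hfl hl hrs ha har hsort hsafe
    obtain ⟨x', g₁', hkept, hsp'⟩ := keptSpokes_spokeList (x := x) (by omega) hsp
    have hk := kappa_bounds
    have hd : 0 < d := hsp.sum ▸ (hsp.strictMono (show 0 < l by omega))
    rw [greedyRounds_of_lt (by rw [hlen]; exact hl)]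
    have hwl : ∀ (i : ℕ) (hi : i < (usedSpokes (spokeList d x (offset g₁ g₂ G) l)).length),
        2 * Real.pi / (2 * (l : ℝ) - 1) ≤ wedgeAngle d (spokeList d x (offset g₁ g₂ G) l)
          ((usedSpokes (spokeList d x (offset g₁ g₂ G) l))[i]) ∧
        (0 < i → 2 * Real.pi / (l : ℝ) ≤ wedgeAngle d (spokeList d x (offset g₁ g₂ G) l)
          ((usedSpokes (spokeList d x (offset g₁ g₂ G) l))[i])) := by
      intro i hi
      refine ⟨hsp.le_wedgeAngle_used (by omega) (List.getElem_mem _), fun h0 => ?_⟩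
      have e : (usedSpokes (spokeList d x (offset g₁ g₂ G) l))[i] =
          (x + offset g₁ g₂ G (2 * i + 1)) % d := by
        simp [usedSpokes_spokeList]
      rw [e]
      rw [hul] at hi
      exact le_wedgeAngle hd (by omega) ((hsp.le_minGap_used (by omega)).2 h0)
    have hw' : roundWedge d (spokeList d x (offset g₁ g₂ G) l) safe rs = some l ∨
      ∀ q ∈ roundBalloons (spokeList d x (offset g₁ g₂ G) l) rs,
        centerDist d (spokeList d x (offset g₁ g₂ G) l) safe q.1 q.2 ≤ safe + q.2 := by
      unfold roundWedge
      split_ifs with hif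
      · left; rw [hlen]
      · right; intro q hq
        exact not_lt.1 fun h => hif ⟨q, hq, h⟩
    generalize spokeList d x (offset g₁ g₂ G) l = S at *
    have htl : (rs.take (usedSpokes S).length).length = l / 2 := by
      rw [List.length_take, hul]; omega
    have hsafe_le : safe ≤ roundSafe d S safe rs := (le_foldr_max _ _).1
    have hle_safe : ∀ q ∈ roundBalloons S rs,
        centerDist d S safe q.1 q.2 + q.2 ≤ roundSafe d S safe rs := fun q hq =>
      (le_foldr_max _ _).2 _ (List.mem_map.2 ⟨q, hq, rfl⟩)
    have hattain : roundSafe d S safe rs = safe ∨ ∃ q ∈ roundBalloons S rs,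
        roundSafe d S safe rs = centerDist d S safe q.1 q.2 + q.2 := by
      rcases foldr_max_mem ((roundBalloons S rs).map
        fun q => centerDist d S safe q.1 q.2 + q.2) safe with h | h
      · exact Or.inl h
      · obtain ⟨q, hq, he⟩ := List.mem_map.1 h
        exact Or.inr ⟨q, hq, he.symm⟩
    have hzip : ∀ P : List (ℕ × ℝ), List.zip (((roundBalloons S rs).map
        fun q => (q.1, centerDist d S safe q.1 q.2)) ++ P) rs =
        ((roundBalloons S rs).map fun q => ((q.1, centerDist d S safe q.1 q.2), q.2)) ++
        List.zip P (rs.drop (usedSpokes S).length) := by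
      intro P
      conv_lhs => rw [← List.take_append_drop (usedSpokes S).length rs]
      rw [List.zip_append]
      · rw [List.take_append_drop]
        congr 1
        exact zip_map_zip (fun q => centerDist d S safe q.1 q.2) _ _ (hul.trans htl.symm)
      · rw [List.take_append_drop]
        simp only [roundBalloons, List.length_map, List.length_zip]
        omega
    have hsum : rs.sum = (rs.take (usedSpokes S).length).sum +
        (rs.drop (usedSpokes S).length).sum := by
      rw [← List.sum_append, List.take_append_drop]
    have hdl : (rs.drop (usedSpokes S).length).length + f = (l + 1) / 2 := by
      rw [List.length_drop, hul]; omega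
    have hsort' := hsort
    rw [← List.take_append_drop (usedSpokes S).length rs, List.pairwise_append] at hsort'
    obtain ⟨hst, hsd, htd⟩ := hsort'
    have hta : ∀ r ∈ rs.take (usedSpokes S).length, a ≤ r := fun r h =>
      har r (List.mem_of_mem_take h)
    have hda : ∀ r ∈ rs.drop (usedSpokes S).length, a ≤ r := fun r h =>
      har r (List.mem_of_mem_drop h)
    have hm : ((l / 2 : ℕ) : ℝ) + (((l + 1) / 2 : ℕ) : ℝ) = l := by
      exact_mod_cast (show l / 2 + (l + 1) / 2 = l by omega)
    have hm2 : (2 : ℝ) ≤ ((l / 2 : ℕ) : ℝ) := by exact_mod_cast (show 2 ≤ l / 2 by omega)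
    have hmm : ((l / 2 : ℕ) : ℝ) ≤ (((l + 1) / 2 : ℕ) : ℝ) := by
      exact_mod_cast (show l / 2 ≤ (l + 1) / 2 by omega)
    have hdl' : ((rs.drop (usedSpokes S).length).length : ℝ) + f = (((l + 1) / 2 : ℕ) : ℝ) := by
      exact_mod_cast hdl
    have hfr : (f : ℝ) ≤ 2 ∧ (1 : ℝ) ≤ f := by
      rcases hf with rfl | rfl <;> norm_num
    have hfl' : (f : ℝ) + 3 ≤ l := by exact_mod_cast (show f + 3 ≤ l by omega)
    simp only [hzip, hkept]
    generalize hR : roundSafe d S safe rs = safe' at *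
    generalize ht : rs.take (usedSpokes S).length = t at *
    generalize hdr : rs.drop (usedSpokes S).length = rs' at *
    generalize roundWedge d S safe rs = w' at *
    generalize hnow : roundBalloons S rs = now at *
    -- The lower bound for the remaining radii is free: it stays `a` unless the extremal balloon is
    -- held by its wedge, and then becomes the radius of this balloon.
    have suff : ∀ a', 0 ≤ a' → (∀ r ∈ rs', a' ≤ r) →
        safe' + kappa * (rs'.sum - ((((l + 1) / 2 : ℕ) : ℝ) - 1 - f) / 2 * a') ≤
          sizeBound l f a safe rs →
        ∀ q ∈ (now.map fun q => ((q.1, centerDist d S safe q.1 q.2), q.2)) ++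
          List.zip (greedyRounds d f (spokeList d x' (offset g₁' (g₁ + g₂) (2 * G)) ((l + 1) / 2))
            safe' w' rs').placed rs', q.1.2 + q.2 ≤ sizeBound l f a safe rs := by
      intro a' ha' har' hb q hq
      have hsz : (rs'.length : ℝ) * a' ≤ rs'.sum := by
        have := List.card_nsmul_le_sum rs' a' har'
        rwa [nsmul_eq_mul] at this
      have hpos : 0 ≤ rs'.sum - ((((l + 1) / 2 : ℕ) : ℝ) - 1 - f) / 2 * a' := by
        have : (0 : ℝ) ≤ rs'.length := by positivity
        nlinarith
      rcases List.mem_append.1 hq with hq | hq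
      · obtain ⟨q', hq', rfl⟩ := List.mem_map.1 hq
        have := hle_safe q' hq'
        simp only
        nlinarith
      · refine (ih _ (by omega) hsp' (by omega) (by omega) ha' har' hsd (hsafe.trans hsafe_le) q
          hq).trans ?_
        refine max_le hb (le_max_of_le_right ?_)
        have : 0 ≤ t.sum := List.sum_nonneg fun r h => ha.trans (hta r h)
        nlinarith
    rcases hattain with h | ⟨q, hq, h⟩
    · refine suff a ha hda (le_max_of_le_left ?_)
      have h1 := List.card_nsmul_le_sum t a hta
      rw [nsmul_eq_mul, htl] at h1
      rw [h, hsum, ← hm]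
      have h2 : 0 ≤ ((l / 2 : ℕ) : ℝ) * a := by positivity
      have h3 : rs'.sum - ((((l + 1) / 2 : ℕ) : ℝ) - 1 - f) / 2 * a ≤ t.sum + rs'.sum -
          (((l / 2 : ℕ) : ℝ) + (((l + 1) / 2 : ℕ) : ℝ) - 1 - f) / 2 * a := by linarith
      have := mul_le_mul_of_nonneg_left h3 (show 0 ≤ kappa by linarith)
      linarith
    · have hnow' : now = List.zip (usedSpokes S) t := by rw [← hnow, ← ht]; rfl
      have hqt : q.2 ∈ t := by
        rw [hnow'] at hq
        exact (List.of_mem_zip (a := q.1) (b := q.2) hq).2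
      have hq0 : 0 ≤ q.2 := ha.trans (hta _ hqt)
      by_cases hc : centerDist d S safe q.1 q.2 ≤ safe + q.2
      · refine suff a ha hda (le_max_of_le_left ?_)
        have h1 := add_mul_le_sum hqt hta
        rw [htl] at h1
        rw [h, hsum, ← hm]
        -- With m = ⌊l/2⌋ ≥ 2 balloons in the round, their sum is at least q + (m − 1) a, while the
        -- savings shrink by m a / 2 only.
        have h2 : 0 ≤ (((l / 2 : ℕ) : ℝ) - 2) * a := mul_nonneg (by linarith) ha
        have h3 : q.2 + (rs'.sum - ((((l + 1) / 2 : ℕ) : ℝ) - 1 - f) / 2 * a) ≤ t.sum + rs'.sum -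
            (((l / 2 : ℕ) : ℝ) + (((l + 1) / 2 : ℕ) : ℝ) - 1 - f) / 2 * a := by linarith
        have := mul_le_mul_of_nonneg_left h3 (show 0 ≤ kappa by linarith)
        nlinarith
      · have hq't : ∀ r ∈ rs', q.2 ≤ r := fun r hr => htd _ hqt r hr
        have hwe : w' = some l := hw'.resolve_right fun h' => hc (h' q hq)
        obtain ⟨i, hi, hqi⟩ := List.mem_iff_getElem.1 hq
        have hiu : i < (usedSpokes S).length := by
          rw [hnow', List.length_zip] at hi; omega
        have hit : i < t.length := by
          rw [hnow', List.length_zip] at hi; omega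
        have hq1 : q.1 = (usedSpokes S)[i] := by
          rw [← hqi]; simp only [hnow', List.getElem_zip]
        have hq2 : q.2 = t[i] := by
          rw [← hqi]; simp only [hnow', List.getElem_zip]
        obtain ⟨hw0, hw1⟩ := hwl i hiu
        rw [← hq1] at hw0 hw1
        set μ := wedgeAngle d S q.1 with hμ
        have hμ2 : μ ≤ Real.pi / 2 := min_le_right _ _
        have hp := Real.pi_pos
        have hμ0 : 0 < μ := lt_of_lt_of_le (by apply div_pos <;> linarith) hw0
        have hcd : centerDist d S safe q.1 q.2 = q.2 / Real.sin μ := by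
          rw [centerDist_eq hμ0] at hc ⊢
          rcases max_choice (q.2 / Real.sin (wedgeAngle d S q.1)) (safe + q.2) with h' | h'
          · exact h'
          · exact absurd h'.le hc
        have hs' : safe' = q.2 * (1 + 1 / Real.sin μ) := by rw [h, hcd]; ring
        have main : (1 + 1 / Real.sin μ) * q.2 ≤
            kappa * (t.sum + ((((l + 1) / 2 : ℕ) : ℝ) - 1 - f) / 2 * q.2) →
            ∀ q ∈ (now.map fun q => ((q.1, centerDist d S safe q.1 q.2), q.2)) ++
              List.zip (greedyRounds d f (spokeList d x' (offset g₁' (g₁ + g₂) (2 * G))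
                ((l + 1) / 2)) safe' w' rs').placed rs', q.1.2 + q.2 ≤ sizeBound l f a safe rs := by
          intro hle
          refine suff q.2 hq0 hq't (le_max_of_le_right ?_)
          rw [hs', hsum]
          nlinarith
        -- The first used spoke may have the narrow wedge 2π / (2l − 1), but it carries the smallest
        -- balloon, so the whole round has radii at least q. At any other spoke the wedge is at
        -- least 2π / l, and q alone has to suffice from this round.
        rcases Nat.eq_zero_or_pos i with hi0 | hi0
        · have hall : ∀ r ∈ t, q.2 ≤ r := by
            intro r hr
            obtain ⟨j, hj, rfl⟩ := List.mem_iff_getElem.1 hr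
            subst hi0
            rw [hq2]
            rcases Nat.eq_zero_or_pos j with rfl | hj0
            · exact le_rfl
            · exact List.pairwise_iff_getElem.1 hst 0 j hit hj hj0
          have h1 := List.card_nsmul_le_sum t q.2 hall
          rw [nsmul_eq_mul, htl] at h1
          have h2 := one_div_sin_le (k := 2 * (l : ℝ) - 1) (by linarith) hw0 hμ2
          apply main
          have h3 : (1 + 1 / Real.sin μ) ≤
              2 * (((l / 2 : ℕ) : ℝ) + ((((l + 1) / 2 : ℕ) : ℝ) - 1 - f) / 2) := by linarith
          have h4 := mul_le_mul_of_nonneg_right h3 hq0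
          have h5 : 0 ≤ (((l / 2 : ℕ) : ℝ) + ((((l + 1) / 2 : ℕ) : ℝ) - 1 - f) / 2) * q.2 :=
            mul_nonneg (by linarith) hq0
          nlinarith
        · have h1 := add_mul_le_sum (a := 0) hqt fun r hr => ha.trans (hta r hr)
          rw [mul_zero, add_zero] at h1
          have hw1 := hw1 hi0
          have h2 := one_div_sin_le (k := (l : ℝ)) (by linarith) hw1 hμ2
          -- The inequality needed is 1 + l/4 ≤ 2 + ⌈l/2⌉ − 1 − f. It fails only for f = 2 with five
          -- or six spokes.
          by_cases hbig : f = 1 ∨ 7 ≤ l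
          · apply main
            have h3 : (1 + 1 / Real.sin μ) ≤ 2 * (1 + ((((l + 1) / 2 : ℕ) : ℝ) - 1 - f) / 2) := by
              rcases hbig with rfl | h7
              · push_cast at hfl' ⊢
                linarith
              · have h8 : l = 7 ∨ 8 ≤ l := by omega
                rcases h8 with rfl | h8
                · norm_num at h2 ⊢
                  linarith
                · have h8' : (8 : ℝ) ≤ l := by exact_mod_cast h8
                  linarith
            have h4 := mul_le_mul_of_nonneg_right h3 hq0
            have h5 : 0 ≤ (1 + ((((l + 1) / 2 : ℕ) : ℝ) - 1 - f) / 2) * q.2 :=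
              mul_nonneg (by linarith) hq0
            nlinarith
          · obtain ⟨rfl, h56⟩ : f = 2 ∧ (l = 5 ∨ l = 6) := by omega
            rcases h56 with rfl | rfl
            -- On five spokes the wedge is at least 2π/5, so the cost is at most κ q without any
            -- savings.
            · apply main
              have h3 := one_add_one_div_sin_le_kappa (by exact_mod_cast hw1) hμ2
              have h4 := mul_le_mul_of_nonneg_right h3 hq0
              have e : ((((5 + 1) / 2 : ℕ) : ℝ) - 1 - (2 : ℕ)) / 2 = 0 := by norm_num
              rw [e]
              nlinarith
            -- On six spokes a single balloon r is left. Pushed, it reaches at most 2q + 2r; held by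
            -- its wedge, κ r.
            · subst hwe
              have hpu := pushed_six_le hq0 (by exact_mod_cast hw1) hμ2
                (show safe' = q.2 / Real.sin μ + q.2 by rw [hs']; ring)
              obtain ⟨r, rfl⟩ := List.length_eq_one_iff.1 (show rs'.length = 1 by omega)
              have hqr : q.2 ≤ r := hq't r (by simp)
              have hsum' : q.2 + r ≤ rs.sum := by rw [hsum]; simpa using h1
              have hb : kappa * (q.2 + r) ≤ sizeBound 6 2 a safe rs :=
                le_max_of_le_right (mul_le_mul_of_nonneg_left hsum' (by linarith))
              intro q₀ hq₀
              refine le_trans ?_ hb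
              rcases List.mem_append.1 hq₀ with hq₀ | hq₀
              · obtain ⟨q', hq', rfl⟩ := List.mem_map.1 hq₀
                have := hle_safe q' hq'
                simp only
                refine this.trans ?_
                rw [hs']
                push_cast at h2
                have := mul_le_mul_of_nonneg_left h2 hq0
                nlinarith
              · rw [greedyRounds_of_not_lt (by simp [spokeList])] at hq₀
                have hS : spokeList d x' (offset g₁' (g₁ + g₂) (2 * G)) ((6 + 1) / 2) =
                  [(x' + 0) % d, (x' + g₁') % d, (x' + (g₁' + (g₁ + g₂) + 0 * (2 * G))) % d] := rfl
                rw [hS] at hq₀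
                simp only [terminalLayout, List.zip_cons_cons, List.zip_nil_right, List.mem_cons,
                  List.not_mem_nil, or_false] at hq₀
                subst hq₀
                simp only
                rw [alpha_four_pi_div_five, ← max_add_add_right]
                apply max_le
                · nlinarith
                · nlinarith

theorem Layout.coverRadius_eq (lay : Layout) (rs : List ℝ) :
    lay.coverRadius rs = ((List.zip lay.placed rs).map fun q => q.1.2 + q.2).foldr max 0 := by
  unfold Layout.coverRadius
  rw [List.zip, List.map_zipWith]

theorem Layout.le_coverRadius {lay : Layout} {rs : List ℝ} {q : (ℕ × ℝ) × ℝ}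
    (h : q ∈ List.zip lay.placed rs) : q.1.2 + q.2 ≤ lay.coverRadius rs := by
  rw [Layout.coverRadius_eq]
  exact (le_foldr_max _ _).2 _ (List.mem_map.2 ⟨q, h, rfl⟩)

theorem Layout.coverRadius_nonneg (lay : Layout) (rs : List ℝ) : 0 ≤ lay.coverRadius rs := by
  rw [Layout.coverRadius_eq]
  exact (le_foldr_max _ _).1

/-- The disk that covers the greedy layout is at most `kappa` times as large as the balloons in
total. -/
theorem coverRadius_greedyLayout_le {d f : ℕ} {rs : List ℝ} (hd : rs.length + f = d)
    (hf : f = 1 ∨ f = 2) (hr : ∀ r ∈ rs, 0 ≤ r) (hsort : rs.Pairwise (· ≤ ·)) :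
    (greedyLayout d f rs).coverRadius rs ≤ kappa * rs.sum := by
  have hk := kappa_bounds
  have hsum : 0 ≤ rs.sum := List.sum_nonneg hr
  by_cases hfd : f < d
  · obtain ⟨h1, h2⟩ := range_eq_spokeList (d := d) (by omega)
    rw [Layout.coverRadius_eq]
    refine foldr_max_le (by nlinarith) fun b hb => ?_
    obtain ⟨q, hq, rfl⟩ := List.mem_map.1 hb
    unfold greedyLayout at hq
    rw [h1] at hq
    have := size_greedyRounds hf d h2 hfd hd le_rfl hr hsort le_rfl q hq
    simpa [sizeBound] using this
  · obtain rfl : rs = [] := List.length_eq_zero_iff.1 (by omega)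
    simp [Layout.coverRadius]


/-! ### Rooted trees -/

section RootedTree

variable {V : Type*} {G : SimpleGraph V} {r : V}

theorem isChild_or_isChild (hG : G.IsTree) (r : V) {u v : V} (h : G.Adj u v) :
    IsChild G r u v ∨ IsChild G r v u := by
  rcases hG.dist_eq_dist_add_one_of_adj r h with h' | h'
  · exact Or.inr ⟨h.symm, h'⟩
  · exact Or.inl ⟨h, h'⟩

theorem IsChild.not_isChild {u v : V} (h : IsChild G r u v) : ¬ IsChild G r v u := by
  intro h'
  have := h.2
  have := h'.2
  omega

theorem IsChild.ne_root {u v : V} (h : IsChild G r u v) : v ≠ r := by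
  rintro rfl
  have := h.2
  simp at this

/-- The parent is the last vertex but one on the unique path from the root. -/
theorem IsChild.unique (hG : G.IsTree) {u u' v : V} (h : IsChild G r u v)
    (h' : IsChild G r u' v) : u = u' := by
  obtain ⟨q, hq, hql⟩ := hG.connected.exists_path_of_dist r v
  have key : ∀ w, IsChild G r w v → w = q.penultimate := by
    intro w hw
    obtain ⟨p, hp, hpl⟩ := hG.connected.exists_path_of_dist r w
    have hv : v ∉ p.support := by
      intro hv
      have := congrArg SimpleGraph.Walk.length (hG.isAcyclic.path_concat hq hp hw.1.symm hv)
      rw [SimpleGraph.Walk.length_concat, hql, hpl] at this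
      have := hw.2
      omega
    have hs := hG.isAcyclic.mem_support_of_ne_mem_support_of_adj_of_isPath hq hp hw.1.symm hv
    exact hG.isAcyclic.eq_penultimate_of_adj_end hq hw.1.symm hs
  rw [key u h, key u' h']

theorem exists_adj_dist_add_one (hG : G.IsTree) {a b : V} (h : a ≠ b) :
    ∃ c, G.Adj c b ∧ G.dist a b = G.dist a c + 1 := by
  obtain ⟨p, hpl⟩ := hG.connected.exists_walk_length_eq_dist a b
  have hn : ¬ p.Nil := SimpleGraph.Walk.not_nil_of_ne h
  have hadj := p.adj_penultimate hn
  refine ⟨p.penultimate, hadj, ?_⟩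
  have h1 := SimpleGraph.dist_le p.dropLast
  have h2 : p.dropLast.length + 1 = p.length := SimpleGraph.Walk.length_dropLast_add_one hn
  have h3 := hG.connected.dist_triangle (u := a) (v := p.penultimate) (w := b)
  rw [SimpleGraph.dist_eq_one_iff_adj.2 hadj] at h3
  omega

theorem exists_isChild (hG : G.IsTree) {v : V} (h : v ≠ r) : ∃ u, IsChild G r u v := by
  obtain ⟨c, hc, hd⟩ := exists_adj_dist_add_one hG h.symm
  exact ⟨c, hc, hd⟩

/-- `w` is `u` or a descendant of `u`. -/
def Desc (G : SimpleGraph V) (r : V) : V → V → Prop := Relation.ReflTransGen (IsChild G r)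

theorem Desc.dist_le {u w : V} (h : Desc G r u w) :
    G.dist r u ≤ G.dist r w ∧ (G.dist r u = G.dist r w → u = w) := by
  induction h with
  | refl => simp
  | tail _ hc ih =>
    have := hc.2
    refine ⟨by omega, fun h => by omega⟩

theorem mem_subtree_iff (hG : G.IsTree) {u w : V} : w ∈ subtree G r u ↔ Desc G r u w := by
  constructor
  · intro h
    obtain ⟨n, hn⟩ : ∃ n, G.dist u w = n := ⟨_, rfl⟩
    induction n generalizing w with
    | zero =>
      rw [hG.connected.dist_eq_zero_iff] at hn
      subst hn
      exact Relation.ReflTransGen.refl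
    | succ n ih =>
      have hne : u ≠ w := by rintro rfl; simp at hn
      obtain ⟨c, hc, hd⟩ := exists_adj_dist_add_one hG hne
      have h' : G.dist r w = G.dist r u + G.dist u w := h
      have h1 := hG.connected.dist_triangle (u := r) (v := u) (w := c)
      have h2 := hG.connected.dist_triangle (u := r) (v := c) (w := w)
      rw [SimpleGraph.dist_eq_one_iff_adj.2 hc] at h2
      refine Relation.ReflTransGen.tail (ih (w := c) ?_ (by omega)) ⟨hc, by omega⟩
      change G.dist r c = G.dist r u + G.dist u c
      omega
  · intro h
    induction h with
    | refl => simp [subtree]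
    | @tail b c _ hc ih =>
      have ih' : G.dist r b = G.dist r u + G.dist u b := ih
      have h1 := hG.connected.dist_triangle (u := r) (v := u) (w := c)
      have h2 := hG.connected.dist_triangle (u := u) (v := b) (w := c)
      rw [SimpleGraph.dist_eq_one_iff_adj.2 hc.1] at h2
      have := hc.2
      change G.dist r c = G.dist r u + G.dist u c
      omega

theorem desc_root (hG : G.IsTree) (w : V) : Desc G r r w := by
  rw [← mem_subtree_iff hG]
  simp [subtree]

theorem Desc.total (hG : G.IsTree) {a b w : V} (ha : Desc G r a w) (hb : Desc G r b w) :
    Desc G r a b ∨ Desc G r b a := by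
  have U : Relator.RightUnique (Function.swap (IsChild G r)) := fun _ _ _ h h' => h.unique hG h'
  rcases Relation.ReflTransGen.total_of_right_unique U (Relation.reflTransGen_swap.2 ha)
    (Relation.reflTransGen_swap.2 hb) with h | h
  · exact Or.inr (Relation.reflTransGen_swap.1 h)
  · exact Or.inl (Relation.reflTransGen_swap.1 h)

/-- Two different vertices are in an ancestral relation or in the subtrees of two children of the
same vertex. -/
theorem desc_trichotomy (hG : G.IsTree) (v w : V) (hvw : v ≠ w) :
    (∃ c, IsChild G r v c ∧ Desc G r c w) ∨ (∃ c, IsChild G r w c ∧ Desc G r c v) ∨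
      ∃ z c c', IsChild G r z c ∧ IsChild G r z c' ∧ c ≠ c' ∧ Desc G r c v ∧ Desc G r c' w := by
  have key : ∀ w, Desc G r r w → v ≠ w → (∃ c, IsChild G r v c ∧ Desc G r c w) ∨
      (∃ c, IsChild G r w c ∧ Desc G r c v) ∨
      ∃ z c c', IsChild G r z c ∧ IsChild G r z c' ∧ c ≠ c' ∧ Desc G r c v ∧ Desc G r c' w := by
    intro w hw
    induction hw with
    | refl =>
      intro h
      have := desc_root (r := r) hG v
      rcases Relation.ReflTransGen.cases_head this with h' | ⟨c, hc, hcv⟩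
      · exact (h h'.symm).elim
      · exact Or.inr (Or.inl ⟨c, hc, hcv⟩)
    | @tail z w _ hzw ih =>
      intro hvw
      by_cases hvz : v = z
      · subst hvz
        exact Or.inl ⟨w, hzw, Relation.ReflTransGen.refl⟩
      rcases ih hvz with ⟨c, hc, hcz⟩ | ⟨c, hc, hcv⟩ | ⟨z', c, c', h1, h2, h3, h4, h5⟩
      · exact Or.inl ⟨c, hc, hcz.tail hzw⟩
      · by_cases hcw : c = w
        · subst hcw
          rcases Relation.ReflTransGen.cases_head hcv with h' | ⟨c', hc', hcv'⟩
          · exact (hvw h'.symm).elim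
          · exact Or.inr (Or.inl ⟨c', hc', hcv'⟩)
        · exact Or.inr (Or.inr ⟨z, c, w, hc, hzw, hcw, hcv, Relation.ReflTransGen.refl⟩)
      · exact Or.inr (Or.inr ⟨z', c, c', h1, h2, h3, h4, h5.tail hzw⟩)
  exact key w (desc_root hG w) hvw

theorem one_add_sum_ncard_subtree_le [Finite V] (hG : G.IsTree) {u : V} {l : List V}
    (hl : l.Nodup) (h : ∀ c ∈ l, IsChild G r u c) :
    1 + (l.map fun c => (subtree G r c).ncard).sum ≤ (subtree G r u).ncard := by
  have hsum : ∀ l : List V, l.Nodup → (∀ c ∈ l, IsChild G r u c) →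
      (l.map fun c => (subtree G r c).ncard).sum = (⋃ c ∈ l, subtree G r c).ncard := by
    intro l hl h
    induction l with
    | nil => simp
    | cons a l ih =>
      rw [List.map_cons, List.sum_cons, ih hl.of_cons fun c hc => h c (by simp [hc])]
      have he : (⋃ c ∈ a :: l, subtree G r c) = subtree G r a ∪ ⋃ c ∈ l, subtree G r c := by
        ext w; simp
      rw [he, Set.ncard_union_eq _ (Set.toFinite _) (Set.toFinite _)]
      rw [Set.disjoint_left]
      intro w hw hw'
      simp only [Set.mem_iUnion] at hw'
      obtain ⟨c, hc, hcw⟩ := hw'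
      rw [mem_subtree_iff hG] at hw hcw
      have h1 := (h a (by simp)).2
      have h2 := (h c (by simp [hc])).2
      have hac : a = c := by
        rcases hw.total hG hcw with h' | h'
        · exact h'.dist_le.2 (by omega)
        · exact (h'.dist_le.2 (by omega)).symm
      subst hac
      exact (List.nodup_cons.1 hl).1 hc
  rw [hsum l hl h]
  have hu : u ∉ ⋃ c ∈ l, subtree G r c := by
    intro hu
    simp only [Set.mem_iUnion] at hu
    obtain ⟨c, hc, hcu⟩ := hu
    rw [mem_subtree_iff hG] at hcu
    have := hcu.dist_le.1
    have := (h c hc).2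
    omega
  rw [add_comm, ← Set.ncard_insert_of_notMem hu (Set.toFinite _)]
  apply Set.ncard_le_ncard _ (Set.toFinite _)
  intro w hw
  rw [mem_subtree_iff hG]
  rcases hw with rfl | hw
  · exact Relation.ReflTransGen.refl
  · simp only [Set.mem_iUnion] at hw
    obtain ⟨c, hc, hcw⟩ := hw
    rw [mem_subtree_iff hG] at hcw
    exact Relation.ReflTransGen.head (h c hc) hcw

theorem wellFounded_child [Finite V] (G : SimpleGraph V) (r : V) :
    WellFounded fun v u => IsChild G r u v := by
  cases nonempty_fintype V
  obtain ⟨N, hN⟩ : ∃ N, ∀ v, G.dist r v ≤ N := by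
    obtain ⟨N, hN⟩ := (Set.toFinite (Set.range fun v => G.dist r v)).bddAbove
    exact ⟨N, fun v => hN ⟨v, rfl⟩⟩
  refine Subrelation.wf (r := InvImage (· < ·) fun v => N - G.dist r v) ?_
    (InvImage.wf _ wellFounded_lt)
  intro v u h
  have h1 := hN v
  have h2 := h.2
  change N - G.dist r v < N - G.dist r u
  omega

/-- Choice of a state for every vertex of a rooted tree, from the root to the leaves. -/
theorem exists_state {σ : Type*} (hG : G.IsTree) (Valid : V → σ → Prop)
    (Rel : V → σ → (V → σ) → Prop)
    (hRel : ∀ z s n n', (∀ v, IsChild G r z v → n v = n' v) → Rel z s n → Rel z s n') (s₀ : σ)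
    (h₀ : Valid r s₀)
    (hstep : ∀ z s, Valid z s → ∃ n, Rel z s n ∧ ∀ v, IsChild G r z v → Valid v (n v)) :
    ∃ st : V → σ, st r = s₀ ∧ ∀ z, Valid z (st z) ∧ Rel z (st z) st := by
  classical
  have : Nonempty σ := ⟨s₀⟩
  choose! n hn using hstep
  have hpar : ∀ v : V, ∃ u, v ≠ r → IsChild G r u v := by
    intro v
    by_cases h : v = r
    · exact ⟨v, fun h' => (h' h).elim⟩
    · obtain ⟨u, hu⟩ := exists_isChild hG h
      exact ⟨u, fun _ => hu⟩
  choose par hpar using hpar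
  let wf : WellFounded fun u v : V => G.dist r u < G.dist r v :=
    InvImage.wf (fun v => G.dist r v) wellFounded_lt
  -- A non-root vertex takes the value that the choice made for the state of its parent assigns to
  -- it.
  let F : ∀ v, (∀ u, G.dist r u < G.dist r v → σ) → σ := fun v rec =>
    if hv : v = r then s₀ else n (par v) (rec (par v) (by have := (hpar v hv).2; omega)) v
  let st : V → σ := wf.fix F
  have hst : ∀ v, st v = if v = r then s₀ else n (par v) (st (par v)) v := by
    intro v
    have := wf.fix_eq F v
    rw [show st v = wf.fix F v from rfl, this]
    by_cases hv : v = r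
    · simp [F, hv]
    · simp [F, hv, st]
  have hchild : ∀ z v, IsChild G r z v → st v = n z (st z) v := by
    intro z v h
    rw [hst v, if_neg h.ne_root, (hpar v h.ne_root).unique hG h]
  have hvalid : ∀ z, Valid z (st z) := by
    intro z
    have := desc_root (r := r) hG z
    induction this with
    | refl => rw [hst, if_pos rfl]; exact h₀
    | @tail z v _ h ih =>
      rw [hchild z v h]
      exact (hn z _ ih).2 v h
  refine ⟨st, by rw [hst, if_pos rfl], fun z => ⟨hvalid z, ?_⟩⟩
  exact hRel z _ _ _ (fun v h => (hchild z v h).symm) (hn z _ (hvalid z)).1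

end RootedTree


/-! ### Radii and stars -/

theorem exists_map_eq {V α : Type*} [Nonempty α] {l : List V} (hl : l.Nodup) {m : List α}
    (h : m.length = l.length) : ∃ f : V → α, m = l.map f := by
  classical
  induction l generalizing m with
  | nil => exact ⟨fun _ => Classical.arbitrary α, by simpa using h⟩
  | cons a l ih =>
    match m with
    | [] => simp at h
    | b :: m =>
      obtain ⟨f, hf⟩ := ih hl.of_cons (m := m) (by simpa using h)
      refine ⟨Function.update f a b, ?_⟩
      rw [List.map_cons, Function.update_self, hf]
      congr 1
      apply List.map_congr_left
      intro v hv
      rw [Function.update_of_ne]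
      rintro rfl
      exact (List.nodup_cons.1 hl).1 hv

/-- The spokes `sp` and the distances `cd` describe the layout `lay` of the balloons with labels `L`
and the free spokes with labels `F`. -/
structure IsStarPlan {V : Type*} (d : ℕ) (L F : List V) (X : V → ℝ) (lay : Layout) (sp : V → ℕ)
    (cd : V → ℝ) : Prop where
  placed : lay.placed = L.map fun v => (sp v, cd v)
  free : lay.free = F.map sp
  lt : ∀ v, v ∈ L ∨ v ∈ F → sp v < d
  inj : ∀ v w, v ∈ L ∨ v ∈ F → w ∈ L ∨ w ∈ F → sp v = sp w → v = w
  le_cd : ∀ v ∈ L, X v ≤ cd v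
  compat : ∀ v ∈ L, ∀ w ∈ L, v ≠ w → Compat d ((sp v, cd v), X v) ((sp w, cd w), X w)
  ray : ∀ v ∈ L, ∀ w ∈ F, RayAvoids d ((sp v, cd v), X v) (sp w)
  angle : ∀ v w, F = [v, w] → cosAng d (sp v) (sp w) ≤ -(1 / 2)
  cover : ∀ v ∈ L, cd v + X v ≤ lay.coverRadius (L.map X)

/-- Since labels and spokes are distinct, the lists of the layout can be read as functions on the
neighbours. -/
theorem IsSeparated.exists_isStarPlan {V : Type*} {d : ℕ} {L F : List V} {X : V → ℝ}
    {lay : Layout} (hL : L.Nodup) (hF : F.Nodup) (hLF : ∀ v ∈ L, v ∉ F)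
    (h : IsSeparated d F.length (List.range d) 0 (L.map X) lay) :
    ∃ sp cd, IsStarPlan d L F X lay sp cd := by
  classical
  obtain ⟨f, hf⟩ := exists_map_eq hL (m := lay.placed) (by rw [h.length, List.length_map])
  obtain ⟨g, hg⟩ := exists_map_eq hF (m := lay.free) h.free_length
  set sp : V → ℕ := fun v => if v ∈ L then (f v).1 else g v with hsp
  have spL : ∀ v ∈ L, sp v = (f v).1 := fun v hv => by simp [hsp, hv]
  have spF : ∀ v ∈ F, sp v = g v := fun v hv => by
    have : v ∉ L := fun h => hLF v h hv
    simp [hsp, this]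
  have placed : lay.placed = L.map fun v => (sp v, (f v).2) := by
    rw [hf]
    apply List.map_congr_left
    intro v hv
    rw [spL v hv]
  have free : lay.free = F.map sp := by
    rw [hg]
    apply List.map_congr_left
    intro v hv
    rw [spF v hv]
  have hz : List.zip lay.placed (L.map X) = L.map fun v => ((sp v, (f v).2), X v) := by
    rw [placed, List.zip_map']
  have hmap : lay.placed.map Prod.fst ++ lay.free = (L ++ F).map sp := by
    rw [placed, free, List.map_append, List.map_map]
    rfl
  have hmem : ∀ v, v ∈ L ∨ v ∈ F ↔ v ∈ L ++ F := fun v => List.mem_append.symm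
  have hperm := h.perm
  rw [hmap] at hperm
  refine ⟨sp, fun v => (f v).2, placed, free, ?_, ?_, ?_, ?_, ?_, ?_, ?_⟩
  · intro v hv
    rw [hmem] at hv
    exact List.mem_range.1 (hperm.subset (List.mem_map_of_mem hv))
  · intro v w hv hw he
    rw [hmem] at hv hw
    exact List.inj_on_of_nodup_map (hperm.symm.nodup List.nodup_range) hv hw he
  · intro v hv
    have := h.inner ((sp v, (f v).2), X v) (by rw [hz]; exact List.mem_map_of_mem hv)
    simp only at this
    linarith
  · intro v hv w hw hvw
    have h' := h.pairwise
    rw [hz, List.pairwise_map] at h'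
    have : Std.Symm fun v w => Compat d ((sp v, (f v).2), X v) ((sp w, (f w).2), X w) :=
      ⟨fun _ _ h => h.symm⟩
    exact h'.forall (R := fun v w => Compat d ((sp v, (f v).2), X v) ((sp w, (f w).2), X w))
      hv hw hvw
  · intro v hv w hw
    refine h.ray _ (by rw [hz]; exact List.mem_map_of_mem hv) _ ?_
    rw [free]
    exact List.mem_map_of_mem hw
  · intro v w he
    apply h.angle
    rw [free, he]
    rfl
  · intro v hv
    have : ((sp v, (f v).2), X v) ∈ List.zip lay.placed (L.map X) := by
      rw [hz]; exact List.mem_map_of_mem hv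
    simpa using Layout.le_coverRadius this

/-! ### Radii and stars for the whole tree -/

section Plan

variable {V : Type*} {G : SimpleGraph V} {r : V} {h : V → Option V}

/-- The radii of all disks and the layout of all stars, up to rotation and reflection. The number
`y u` replaces `x u` as the radius of the disk reserved on the heavy path, and `Z u` is the space
needed by the part of the heavy path below `u`. -/
structure Plan (G : SimpleGraph V) (r : V) (h : V → Option V) where
  X : V → ℝ
  x : V → ℝ
  y : V → ℝ
  Z : V → ℝ
  L : V → List V
  F : V → List V
  sp : V → V → ℕ
  cd : V → V → ℝ
  nodupL : ∀ u, (L u).Nodup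
  memL : ∀ u v, v ∈ L u ↔ IsLightChild G r h u v
  sortedL : ∀ u, ((L u).map X).Pairwise (· ≤ ·)
  nodupF : ∀ u, (F u).Nodup
  memF : ∀ u v, v ∈ F u ↔ G.Adj u v ∧ ¬ IsLightChild G r h u v
  eqF : ∀ z u v, IsChild G r z u → h u = some v → F u = [z, v]
  star : ∀ u, IsStarPlan (deg G u) (L u) (F u) X
    (greedyLayout (deg G u) (F u).length ((L u).map X)) (sp u) (cd u)
  x_eq : ∀ u, x u = (greedyLayout (deg G u) (F u).length ((L u).map X)).coverRadius ((L u).map X)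
  x_le : ∀ u, x u ≤ kappa * ((L u).map X).sum
  y_leaf : ∀ u, h u = none → y u = 0
  y_some : ∀ u v, h u = some v → y u = max (x u) (1 / 2)
  Z_leaf : ∀ u, h u = none → Z u = 0
  Z_some : ∀ u v, h u = some v → Z u = 3 * y u + Z v
  X_leaf : ∀ u, h u = none → X u = 1
  X_some : ∀ u v, h u = some v → X u = Z u

theorem deg_eq_length {L F : List V} {u : V} (hL : L.Nodup) (hF : F.Nodup)
    (mL : ∀ v, v ∈ L ↔ IsLightChild G r h u v)
    (mF : ∀ v, v ∈ F ↔ G.Adj u v ∧ ¬ IsLightChild G r h u v) : deg G u = L.length + F.length := by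
  classical
  have hn : (L ++ F).Nodup := by
    rw [List.nodup_append]
    refine ⟨hL, hF, ?_⟩
    rintro a ha b hb rfl
    exact ((mF a).1 hb).2 ((mL a).1 ha)
  have hs : G.neighborSet u = ((L ++ F).toFinset : Set V) := by
    ext v
    simp only [SimpleGraph.mem_neighborSet, List.coe_toFinset, Set.mem_ofPred_eq, List.mem_append,
      mL, mF]
    constructor
    · intro hv
      by_cases hl : IsLightChild G r h u v
      · exact Or.inl hl
      · exact Or.inr ⟨hv, hl⟩
    · rintro (hv | hv)
      · exact hv.1.1
      · exact hv.1
  rw [deg, hs, Set.ncard_coe_finset, List.toFinset_card_of_nodup hn, List.length_append]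

/-- The free edges lead to the parent and to the heavy child; if both exist, the parent comes first.
The list is empty only if the vertex has no neighbour at all. -/
theorem exists_free_list (hG : G.IsTree) (hh : IsHeavyChoice G r h) (u : V) :
    ∃ F : List V, F.Nodup ∧ (∀ v, v ∈ F ↔ G.Adj u v ∧ ¬ IsLightChild G r h u v) ∧
      (∀ z v, IsChild G r z u → h u = some v → F = [z, v]) ∧
      (F.length = 1 ∨ F.length = 2 ∨ F = [] ∧ ∀ v, ¬ G.Adj u v) := by
  have hnl : ∀ v, G.Adj u v ∧ ¬ IsLightChild G r h u v ↔ IsChild G r v u ∨ h u = some v := by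
    intro v
    constructor
    · rintro ⟨h1, h2⟩
      rcases isChild_or_isChild hG r h1 with h3 | h3
      · exact Or.inr (not_not.1 fun h4 => h2 ⟨h3, h4⟩)
      · exact Or.inl h3
    · rintro (h1 | h1)
      · exact ⟨h1.1.symm, fun h2 => h1.not_isChild h2.1⟩
      · exact ⟨(hh.isChild u v h1).1, fun h2 => h2.2 h1⟩
  simp only [hnl]
  by_cases hu : u = r
  · subst hu
    have hno : ∀ z, ¬ IsChild G u z u := fun z hz => hz.ne_root rfl
    cases hv : h u with
    | none =>
      refine ⟨[], by simp, by simp [hno], fun z v hz => (hno z hz).elim,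
        Or.inr (Or.inr ⟨rfl, fun v hv' => ?_⟩)⟩
      rcases isChild_or_isChild hG u hv' with h3 | h3
      · exact hh.exists_of_child u v h3 hv
      · exact hno v h3
    | some w =>
      refine ⟨[w], by simp, by simp [hno, eq_comm], fun z v hz => (hno z hz).elim, by simp⟩
  · obtain ⟨z, hz⟩ := exists_isChild hG hu
    have hzu : ∀ v, IsChild G r v u ↔ v = z :=
      fun v => ⟨fun hv => hv.unique hG hz, fun hv => hv ▸ hz⟩
    simp only [hzu]
    cases hv : h u with
    | none => exact ⟨[z], by simp, by simp, by simp, by simp⟩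
    | some w =>
      have hzw : z ≠ w := by
        rintro rfl
        exact hz.not_isChild (hh.isChild u z hv)
      refine ⟨[z, w], by simpa using hzw, by simp [eq_comm], ?_, by simp⟩
      rintro z' v rfl hv'
      rw [Option.some.inj hv']

/-- Only `Z` is defined by recursion, from the leaves to the root; the other radii at a vertex are
functions of `Z` at the vertex and its children. Sorting the light children depends on these radii,
so the lists are chosen for every candidate function. -/
theorem exists_radii [Finite V] (F : V → List V) :
    ∃ (X x y Z : V → ℝ) (L : V → List V), (∀ u, (L u).Nodup) ∧
      (∀ u v, v ∈ L u ↔ IsLightChild G r h u v) ∧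
      (∀ u, ((L u).map X).Pairwise (· ≤ ·)) ∧
      (∀ u, x u =
        (greedyLayout (deg G u) (F u).length ((L u).map X)).coverRadius ((L u).map X)) ∧
      (∀ u, h u = none → y u = 0) ∧ (∀ u v, h u = some v → y u = max (x u) (1 / 2)) ∧
      (∀ u, h u = none → Z u = 0) ∧
      (∀ u v, h u = some v → IsChild G r u v → Z u = 3 * y u + Z v) ∧
      (∀ u, h u = none → X u = 1) ∧ (∀ u v, h u = some v → X u = Z u) := by
  classical
  cases nonempty_fintype V
  let Xof : (V → ℝ) → V → ℝ := fun g v => if h v = none then 1 else g v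
  have hL : ∀ (g : V → ℝ) (u : V), ∃ L : List V, L.Nodup ∧
      (∀ v, v ∈ L ↔ IsLightChild G r h u v) ∧ (L.map (Xof g)).Pairwise (· ≤ ·) := by
    intro g u
    refine ⟨((Finset.univ.filter fun v => IsLightChild G r h u v).toList).mergeSort
      fun a b => decide (Xof g a ≤ Xof g b), ?_, ?_, ?_⟩
    · rw [(List.mergeSort_perm _ _).nodup_iff]
      exact Finset.nodup_toList _
    · intro v
      rw [(List.mergeSort_perm _ _).mem_iff]
      simp
    · rw [List.pairwise_map]
      have := List.pairwise_mergeSort (le := fun a b => decide (Xof g a ≤ Xof g b))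
        (fun a b c hab hbc => by
          simp only [decide_eq_true_eq] at *
          exact hab.trans hbc)
        (fun a b => by
          simp only [Bool.or_eq_true, decide_eq_true_eq]
          exact le_total _ _)
        ((Finset.univ.filter fun v => IsLightChild G r h u v).toList)
      simpa using this
  choose Lg hLn hLm hLs using hL
  let xof : (V → ℝ) → V → ℝ := fun g u =>
    (greedyLayout (deg G u) (F u).length ((Lg g u).map (Xof g))).coverRadius
      ((Lg g u).map (Xof g))
  let yof : (V → ℝ) → V → ℝ := fun g u => if h u = none then 0 else max (xof g u) (1 / 2)
  let Φ : V → (V → ℝ) → ℝ := fun u g =>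
    match h u with
    | none => 0
    | some v => 3 * yof g u + g v
  let wf := wellFounded_child G r
  let Z : V → ℝ := wf.fix fun u rec => Φ u fun v => if hc : IsChild G r u v then rec v hc else 0
  -- The recursion sees `Z` at the children of `u` only. Cutting `Z` off elsewhere reproduces
  -- exactly what it sees and does not affect the radii of the light children.
  let res : V → V → ℝ := fun u v => if IsChild G r u v then Z v else 0
  have hZ : ∀ u, Z u = Φ u (res u) := by
    intro u
    rw [show Z u = _ from wf.fix_eq _ u]
    rfl
  have hXmap : ∀ u, (Lg (res u) u).map (Xof (res u)) = (Lg (res u) u).map (Xof Z) := by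
    intro u
    apply List.map_congr_left
    intro v hv
    have := ((hLm (res u) u v).1 hv).1
    simp [Xof, res, this]
  refine ⟨Xof Z, fun u => xof (res u) u, fun u => yof (res u) u, Z, fun u => Lg (res u) u,
    fun u => hLn _ u, fun u => hLm _ u, ?_, ?_, ?_, ?_, ?_, ?_, ?_, ?_⟩
  · intro u
    rw [← hXmap]
    exact hLs _ u
  · intro u
    rw [← hXmap]
  · intro u hu
    simp [yof, hu]
  · intro u v hu
    simp [yof, hu]
  · intro u hu
    rw [hZ]
    simp [Φ, hu]
  · intro u v hu hc
    rw [hZ]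
    simp [Φ, hu, res, hc]
  · intro u hu
    simp [Xof, hu]
  · intro u v hu
    simp [Xof, hu]

theorem exists_plan [Finite V] (hG : G.IsTree) (hh : IsHeavyChoice G r h) :
    Nonempty (Plan G r h) := by
  choose F hFn hFm hFe hFl using exists_free_list hG hh
  obtain ⟨X, x, y, Z, L, hLn, hLm, hLs, hx, hy0, hy1, hZ0, hZ1, hX0, hX1⟩ :=
    exists_radii (G := G) (r := r) (h := h) F
  have hZ1' : ∀ u v, h u = some v → Z u = 3 * y u + Z v := fun u v hu =>
    hZ1 u v hu (hh.isChild u v hu)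
  have hx0 : ∀ u, 0 ≤ x u := fun u => by rw [hx]; exact Layout.coverRadius_nonneg _ _
  have hy : ∀ u, 0 ≤ y u := by
    intro u
    cases hu : h u with
    | none => rw [hy0 u hu]
    | some v => rw [hy1 u v hu]; exact le_max_of_le_left (hx0 u)
  have hZ : ∀ u, 0 ≤ Z u := by
    intro u
    induction u using (wellFounded_child G r).induction with
    | _ u ih =>
      cases hu : h u with
      | none => rw [hZ0 u hu]
      | some v =>
        rw [hZ1' u v hu]
        linarith [hy u, ih v (hh.isChild u v hu)]
  have hX : ∀ u, 0 ≤ X u := by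
    intro u
    cases hu : h u with
    | none => rw [hX0 u hu]; norm_num
    | some v => rw [hX1 u v hu]; exact hZ u
  have hXL : ∀ u, ∀ ρ ∈ (L u).map X, 0 ≤ ρ := by
    intro u ρ hρ
    obtain ⟨v, _, rfl⟩ := List.mem_map.1 hρ
    exact hX v
  have hdeg : ∀ u, deg G u = (L u).length + (F u).length := fun u =>
    deg_eq_length (hLn u) (hFn u) (hLm u) (hFm u)
  have hLF : ∀ u, ∀ v ∈ L u, v ∉ F u := fun u v hv hv' =>
    ((hFm u v).1 hv').2 ((hLm u v).1 hv)
  have hnil : ∀ u, (∀ v, ¬ G.Adj u v) → L u = [] := by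
    intro u hu
    rw [List.eq_nil_iff_forall_not_mem]
    intro v hv
    exact hu v ((hLm u v).1 hv).1.1
  have hstar : ∀ u, ∃ sp cd, IsStarPlan (deg G u) (L u) (F u) X
      (greedyLayout (deg G u) (F u).length ((L u).map X)) sp cd := by
    intro u
    apply IsSeparated.exists_isStarPlan (hLn u) (hFn u) (hLF u)
    rcases hFl u with hl | hl | ⟨hl, hadj⟩
    · exact isSeparated_greedyLayout (by rw [List.length_map, hdeg]) (Or.inl hl) (hXL u)
    · exact isSeparated_greedyLayout (by rw [List.length_map, hdeg]) (Or.inr hl) (hXL u)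
    · rw [hdeg, hl, hnil u hadj]
      have : greedyLayout 0 0 [] = ⟨[], []⟩ := by
        unfold greedyLayout
        rw [greedyRounds_of_not_lt (by simp)]
        rfl
      simp only [List.length_nil, List.map_nil, Nat.add_zero, this]
      exact ⟨rfl, by simp, rfl, by simp, by simp, by simp, by simp⟩
  choose sp cd hstar using hstar
  refine ⟨⟨X, x, y, Z, L, F, sp, cd, hLn, hLm, hLs, hFn, hFm, fun z u v => hFe u z v, hstar, hx, ?_,
    hy0, hy1, hZ0, hZ1', hX0, hX1⟩⟩
  intro u
  rw [hx]
  rcases hFl u with hl | hl | ⟨hl, hadj⟩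
  · exact coverRadius_greedyLayout_le (by rw [List.length_map, hdeg]) (Or.inl hl) (hXL u) (hLs u)
  · exact coverRadius_greedyLayout_le (by rw [List.length_map, hdeg]) (Or.inr hl) (hXL u) (hLs u)
  · rw [hnil u hadj]
    simp [Layout.coverRadius]

end Plan


/-! ### Bounds for the radii -/

section PlanBounds

variable {V : Type*} {G : SimpleGraph V} {r : V} {h : V → Option V}

theorem Plan.x_nonneg (P : Plan G r h) (u : V) : 0 ≤ P.x u := by
  rw [P.x_eq]; exact Layout.coverRadius_nonneg _ _

theorem Plan.x_leaf (P : Plan G r h) (hh : IsHeavyChoice G r h) {u : V} (hu : h u = none) :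
    P.x u = 0 := by
  have : P.L u = [] := by
    rw [List.eq_nil_iff_forall_not_mem]
    intro v hv
    exact hh.exists_of_child u v ((P.memL u v).1 hv).1 hu
  rw [P.x_eq, this]
  simp [Layout.coverRadius]

theorem Plan.x_le_y (P : Plan G r h) (hh : IsHeavyChoice G r h) (u : V) : P.x u ≤ P.y u := by
  cases hu : h u with
  | none => rw [P.x_leaf hh hu, P.y_leaf u hu]
  | some v => rw [P.y_some u v hu]; exact le_max_left _ _

theorem Plan.y_nonneg (P : Plan G r h) (hh : IsHeavyChoice G r h) (u : V) : 0 ≤ P.y u :=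
  (P.x_nonneg u).trans (P.x_le_y hh u)

theorem Plan.half_le_y (P : Plan G r h) {u v : V} (hu : h u = some v) : 1 / 2 ≤ P.y u := by
  rw [P.y_some u v hu]; exact le_max_right _ _

theorem Plan.Z_nonneg [Finite V] (P : Plan G r h) (hh : IsHeavyChoice G r h) (u : V) :
    0 ≤ P.Z u := by
  induction u using (wellFounded_child G r).induction with
  | _ u ih =>
    cases hu : h u with
    | none => rw [P.Z_leaf u hu]
    | some v =>
      rw [P.Z_some u v hu]
      linarith [P.y_nonneg hh u, ih v (hh.isChild u v hu)]

theorem Plan.one_le_X [Finite V] (P : Plan G r h) (hh : IsHeavyChoice G r h) (u : V) :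
    1 ≤ P.X u := by
  cases hu : h u with
  | none => rw [P.X_leaf u hu]
  | some v =>
    rw [P.X_some u v hu, P.Z_some u v hu]
    linarith [P.half_le_y hu, P.Z_nonneg hh v]

theorem Plan.X_le [Finite V] (P : Plan G r h) (hG : G.IsTree) (hh : IsHeavyChoice G r h) (u : V) :
    P.X u ≤ ((subtree G r u).ncard : ℝ) ^ (2 + Real.logb 2 kappa) := by
  have he : 3 ≤ 2 + Real.logb 2 kappa := by linarith [one_le_logb_kappa]
  generalize 2 + Real.logb 2 kappa = e at he
  have hk := kappa_bounds
  have hpos : ∀ u, (1 : ℝ) ≤ ((subtree G r u).ncard : ℝ) := by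
    intro u
    have : (subtree G r u).Nonempty := ⟨u, by simp [subtree]⟩
    exact_mod_cast (Set.ncard_pos (Set.toFinite _)).2 this
  have hone : ∀ u, (1 : ℝ) ≤ ((subtree G r u).ncard : ℝ) ^ e := fun u =>
    Real.one_le_rpow (hpos u) (by linarith)
  have key : ∀ u, P.Z u ≤ ((subtree G r u).ncard : ℝ) ^ e ∧
      P.X u ≤ ((subtree G r u).ncard : ℝ) ^ e := by
    intro u
    induction u using (wellFounded_child G r).induction with
    | _ u ih =>
      cases hu : h u with
      | none =>
        rw [P.Z_leaf u hu, P.X_leaf u hu]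
        exact ⟨by linarith [hone u], hone u⟩
      | some v =>
        rw [P.X_some u v hu, and_self]
        have hv := hh.isChild u v hu
        have hLc : ∀ c ∈ P.L u, IsChild G r u c := fun c hc => ((P.memL u c).1 hc).1
        have hcard := one_add_sum_ncard_subtree_le hG (l := v :: P.L u) (u := u)
          (List.nodup_cons.2 ⟨fun hvL => ((P.memL u v).1 hvL).2 hu, P.nodupL u⟩) (by
            intro c hc
            rcases List.mem_cons.1 hc with rfl | hc
            · exact hv
            · exact hLc c hc)
        -- The entry 1 stands for `u` itself. Its share 7 pays for the 3/2 in `3 * y u`; the light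
        -- children need 3κ < 7.
        have hsum := add_sum_rpow_ge (a := ((subtree G r v).ncard : ℝ)) he
          (1 :: (P.L u).map fun c => ((subtree G r c).ncard : ℝ)) (by
            intro b hb
            rcases List.mem_cons.1 hb with rfl | hb
            · exact ⟨by norm_num, hpos v⟩
            · obtain ⟨c, hc, rfl⟩ := List.mem_map.1 hb
              exact ⟨by positivity, by exact_mod_cast hh.largest u v hu c (hLc c hc)⟩)
        have hcard' : ((subtree G r v).ncard : ℝ) +
            (1 :: (P.L u).map fun c => ((subtree G r c).ncard : ℝ)).sum ≤
            ((subtree G r u).ncard : ℝ) := by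
          have e1 : ((P.L u).map fun c => ((subtree G r c).ncard : ℝ)).sum =
              (((P.L u).map fun c => (subtree G r c).ncard).sum : ℕ) := by
            rw [Nat.cast_list_sum, List.map_map]; rfl
          rw [List.sum_cons, e1]
          rw [List.map_cons, List.sum_cons] at hcard
          have : ((1 + ((subtree G r v).ncard + ((P.L u).map fun c => (subtree G r c).ncard).sum) :
            ℕ) : ℝ) ≤ ((subtree G r u).ncard : ℝ) := by exact_mod_cast hcard
          push_cast at this
          push_cast
          linarith
        have hXs : ((P.L u).map P.X).sum ≤
            ((P.L u).map fun c => ((subtree G r c).ncard : ℝ) ^ e).sum :=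
          List.sum_le_sum fun c hc => (ih c (hLc c hc)).2
        have hs0 : 0 ≤ ((P.L u).map fun c => ((subtree G r c).ncard : ℝ) ^ e).sum :=
          List.sum_nonneg fun b hb => by
            obtain ⟨c, hc, rfl⟩ := List.mem_map.1 hb
            positivity
        have hy : P.y u ≤
            kappa * ((P.L u).map fun c => ((subtree G r c).ncard : ℝ) ^ e).sum + 1 / 2 := by
          rw [P.y_some u v hu]
          apply max_le
          · have := P.x_le u
            have := mul_le_mul_of_nonneg_left hXs (show 0 ≤ kappa by linarith)
            linarith
          · have : 0 ≤ kappa * ((P.L u).map fun c => ((subtree G r c).ncard : ℝ) ^ e).sum :=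
              mul_nonneg (by linarith) hs0
            linarith
        have hmono := Real.rpow_le_rpow (add_nonneg (by positivity) (List.sum_nonneg (by
          intro b hb
          rcases List.mem_cons.1 hb with rfl | hb
          · norm_num
          · obtain ⟨c, hc, rfl⟩ := List.mem_map.1 hb
            positivity))) hcard' (show 0 ≤ e by linarith)
        rw [List.map_cons, List.sum_cons, List.map_map, Real.one_rpow] at hsum
        rw [P.Z_some u v hu]
        have hiv := (ih v hv).1
        have e2 : ((P.L u).map ((fun x => x ^ e) ∘ fun c => ((subtree G r c).ncard : ℝ))).sum =
          ((P.L u).map fun c => ((subtree G r c).ncard : ℝ) ^ e).sum := rfl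
        rw [e2] at hsum
        nlinarith
  exact (key u).2

end PlanBounds

/-! ### Construction of the drawing -/

/-- The scalar product of `q` with `a`. -/
noncomputable def proj (a q : ℂ) : ℝ := (q * (starRingEnd ℂ) a).re

theorem proj_add (a q q' : ℂ) : proj a (q + q') = proj a q + proj a q' := by
  simp [proj]; ring

theorem proj_sub (a q q' : ℂ) : proj a (q - q') = proj a q - proj a q' := by
  simp [proj]; ring

theorem proj_mul (a q : ℂ) (t : ℝ) : proj a (t * q) = t * proj a q := by
  simp [proj]; ring

theorem proj_le (a q : ℂ) (ha : ‖a‖ = 1) : |proj a q| ≤ ‖q‖ := by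
  have := Complex.abs_re_le_norm (q * (starRingEnd ℂ) a)
  rwa [norm_mul, RCLike.norm_conj, ha, mul_one] at this

theorem proj_self (a : ℂ) (ha : ‖a‖ = 1) : proj a a = 1 := by
  simp only [proj, Complex.mul_conj, Complex.ofReal_re]
  rw [Complex.normSq_eq_norm_sq, ha]; norm_num

theorem norm_spokeDir (d : ℕ) (θ ε : ℝ) (s : ℕ) : ‖spokeDir d θ ε s‖ = 1 :=
  Complex.norm_exp_ofReal_mul_I _

theorem exists_spokeDir_eq (d : ℕ) (ε : ℝ) (s : ℕ) {u : ℂ} (hu : ‖u‖ = 1) :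
    ∃ θ, spokeDir d θ ε s = u := by
  refine ⟨u.arg - ε * (2 * Real.pi * s / d), ?_⟩
  unfold spokeDir
  rw [sub_add_cancel]
  have := Complex.norm_mul_exp_arg_mul_I u
  rwa [hu, Complex.ofReal_one, one_mul] at this

theorem spokeDir_eq_mul (d : ℕ) (θ ε : ℝ) (s t : ℕ) :
    spokeDir d θ ε t = spokeDir d θ ε s *
      Complex.exp (((ε * (2 * Real.pi * ((t : ℝ) - s) / d) : ℝ) : ℂ) * Complex.I) := by
  unfold spokeDir
  rw [← Complex.exp_add]
  congr 1
  push_cast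
  ring

/-- Used for the cosines of two angles in [0, π/3], whose difference has cosine at least 1/2. If the
claim failed, multiplying by c and inserting ac < 1/2 would contradict (1 − c)(4c² + 2c − 1) ≥ 0. -/
theorem sq_add_sq_sub_mul_le {a c : ℝ} (ha : 1 / 2 ≤ a) (hac : a ≤ c) (hc : c ≤ 1)
    (h : a * c < 1 / 2) : a ^ 2 + c ^ 2 - a * c ≤ 3 / 4 := by
  have e1 : a ^ 2 - a * c ≤ (a - c) / 2 := by
    nlinarith [mul_nonneg (sub_nonneg.2 ha) (sub_nonneg.2 hac)]
  by_contra hcon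
  push Not at hcon
  have e2 : 3 / 4 < c ^ 2 + (a - c) / 2 := by linarith
  have e3 : 3 / 4 * c < (c ^ 2 + (a - c) / 2) * c := mul_lt_mul_of_pos_right e2 (by linarith)
  have e4 : 0 ≤ (1 - c) * (4 * c ^ 2 + 2 * c - 1) := mul_nonneg (by linarith) (by nlinarith)
  nlinarith

/-- A path that turns by at most `π / 3` can be continued, for one of the two orientations, within
the wedge of half-angle `π / 3`. -/
theorem exists_turn {d s t : ℕ} (hc : cosAng d s t ≤ -(1 / 2)) {dir axis : ℂ} (hd : ‖dir‖ = 1)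
    (ha : ‖axis‖ = 1) (hp : 1 / 2 ≤ proj axis dir) :
    ∃ θ ε : ℝ, (ε = 1 ∨ ε = -1) ∧ spokeDir d θ ε s = -dir ∧ 1 / 2 ≤ proj axis (spokeDir d θ ε t) := by
  set φ : ℝ := 2 * Real.pi * ((t : ℝ) - s) / d with hφ
  have hcos : Real.cos φ ≤ -(1 / 2) := by rw [cosAng_comm] at hc; exact hc
  set w : ℂ := dir * (starRingEnd ℂ) axis with hw
  have hwn : w.re ^ 2 + w.im ^ 2 = 1 := by
    have h1 : ‖w‖ = 1 := by rw [hw, norm_mul, RCLike.norm_conj, hd, ha, mul_one]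
    have := Complex.normSq_eq_norm_sq w
    rw [h1, Complex.normSq_apply] at this
    nlinarith
  have hwr : 1 / 2 ≤ w.re := hp
  have key : ∀ ε θ : ℝ, spokeDir d θ ε s = -dir →
      proj axis (spokeDir d θ ε t) = -w.re * Real.cos (ε * φ) + w.im * Real.sin (ε * φ) := by
    intro ε θ h
    rw [spokeDir_eq_mul d θ ε s t, h, ← hφ, proj, Complex.exp_mul_I,
      ← Complex.ofReal_cos, ← Complex.ofReal_sin]
    rw [show -dir * ((Real.cos (ε * φ) : ℂ) + (Real.sin (ε * φ) : ℂ) * Complex.I) *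
      (starRingEnd ℂ) axis = -w * ((Real.cos (ε * φ) : ℂ) + (Real.sin (ε * φ) : ℂ) * Complex.I) by
        rw [hw]; ring]
    generalize Real.cos (ε * φ) = A
    generalize Real.sin (ε * φ) = B
    simp [Complex.mul_re]
    ring
  have hsc := Real.sin_sq_add_cos_sq φ
  -- Let δ be the unsigned angle between `dir` and `axis`, and τ the unsigned turn; both are at most
  -- π/3, and the right side is cos (δ − τ). The absolute value is realised by the choice of the
  -- reflection `ε`, which turns the path towards the axis.
  have hbound : 1 / 2 ≤ -w.re * Real.cos φ + |w.im * Real.sin φ| := by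
    by_contra hcon
    push Not at hcon
    have h0 := abs_nonneg (w.im * Real.sin φ)
    have h1 : (w.im * Real.sin φ) ^ 2 < (1 / 2 + w.re * Real.cos φ) ^ 2 := by
      rw [← sq_abs (w.im * Real.sin φ)]
      exact pow_lt_pow_left₀ (by linarith) h0 (by norm_num)
    have h2 : (w.im * Real.sin φ) ^ 2 = (1 - w.re ^ 2) * (1 - Real.cos φ ^ 2) := by
      rw [mul_pow]
      have e1 : w.im ^ 2 = 1 - w.re ^ 2 := by linarith
      have e2 : Real.sin φ ^ 2 = 1 - Real.cos φ ^ 2 := by linarith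
      rw [e1, e2]
    set a := w.re
    set c := -Real.cos φ with hcdef
    have hca : Real.cos φ = -c := by rw [hcdef]; ring
    rw [hca] at h1 h2 hcon
    have ha1 : a ≤ 1 := by nlinarith [sq_nonneg w.im]
    have hc1 : c ≤ 1 := by rw [hcdef]; linarith [Real.neg_one_le_cos φ]
    have hc2 : 1 / 2 ≤ c := by rw [hcdef]; linarith
    have hac : a * c < 1 / 2 := by nlinarith
    have h3 : 3 / 4 < a ^ 2 + c ^ 2 - a * c := by nlinarith
    rcases le_total a c with hle | hle
    · linarith [sq_add_sq_sub_mul_le hwr hle hc1 hac]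
    · linarith [sq_add_sq_sub_mul_le hc2 hle ha1 (by linarith)]
  have hnd : ‖-dir‖ = 1 := by rw [norm_neg, hd]
  rcases le_total 0 (w.im * Real.sin φ) with h0 | h0
  · obtain ⟨θ, hθ⟩ := exists_spokeDir_eq d 1 s hnd
    refine ⟨θ, 1, Or.inl rfl, hθ, ?_⟩
    rw [key 1 θ hθ, one_mul]
    rwa [abs_of_nonneg h0] at hbound
  · obtain ⟨θ, hθ⟩ := exists_spokeDir_eq d (-1) s hnd
    refine ⟨θ, -1, Or.inr rfl, hθ, ?_⟩
    rw [key (-1) θ hθ, neg_one_mul, Real.cos_neg, Real.sin_neg]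
    rw [abs_of_nonpos h0] at hbound
    linarith

/-- A ray that starts inside a circle meets it, by the intermediate value theorem; so the distance
of the next path node from the top can be prescribed. -/
theorem exists_norm_add_mul_eq {q u : ℂ} {ρ : ℝ} (hq : ‖q‖ < ρ) (hu : ‖u‖ = 1) :
    ∃ t : ℝ, 0 < t ∧ ‖q + t * u‖ = ρ := by
  have hcont : ContinuousOn (fun t : ℝ => ‖q + t * u‖) (Set.Icc 0 (ρ + ‖q‖)) := by fun_prop
  have h0 : 0 ≤ ρ + ‖q‖ := by linarith [norm_nonneg q]
  have hend : ρ ≤ ‖q + ((ρ + ‖q‖ : ℝ) : ℂ) * u‖ := by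
    have h1 : ‖((ρ + ‖q‖ : ℝ) : ℂ) * u‖ = ρ + ‖q‖ := by
      rw [norm_mul, hu, mul_one, Complex.norm_real, Real.norm_of_nonneg h0]
    have h2 := norm_sub_norm_le (((ρ + ‖q‖ : ℝ) : ℂ) * u) (-q)
    rw [h1, norm_neg, sub_neg_eq_add, add_comm _ q] at h2
    linarith
  obtain ⟨t, ht, he⟩ := intermediate_value_Icc h0 hcont ⟨by simpa using hq.le, hend⟩
  refine ⟨t, lt_of_le_of_ne ht.1 ?_, he⟩
  rintro rfl
  simp at he
  linarith


/-! ### Placing the vertices from the root to the leaves -/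

section Construction

variable {V : Type*} {G : SimpleGraph V} {r : V} {h : V → Option V}

/-- The state of a vertex in a drawing: its position, the direction and length of the edge from the
parent, the position of the top node of its heavy path, the axis of the wedge in which the heavy
path is drawn, and the radius of a disk about the top node that covers the heavy path so far. -/
structure VertexState where
  pos : ℂ
  dir : ℂ
  len : ℝ
  top : ℂ
  axis : ℂ
  reach : ℝ

/-- `st` is a drawing that follows the plan `P`. -/
structure IsPlanDrawing (P : Plan G r h) (st : V → VertexState) : Prop where
  norm_dir : ∀ v, ‖(st v).dir‖ = 1
  norm_axis : ∀ v, ‖(st v).axis‖ = 1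
  reach_eq : ∀ v, ‖(st v).pos - (st v).top‖ + P.y v = (st v).reach
  root : (st r).top = (st r).pos ∧ (st r).axis = (st r).dir ∧ (st r).reach = P.y r
  step : ∀ z v, IsChild G r z v →
    (st v).pos = (st z).pos + (st v).len * (st v).dir ∧ 0 < (st v).len
  light : ∀ z v, IsLightChild G r h z v → (st v).len = P.cd z v ∧ (st v).top = (st v).pos ∧
    (st v).axis = (st v).dir ∧ (st v).reach = P.y v
  heavy : ∀ z v, h z = some v → (st v).top = (st z).top ∧ (st v).axis = (st z).axis ∧
    ‖(st v).pos - (st v).top‖ = (st z).reach + P.y z + P.y v ∧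
    1 / 2 ≤ proj (st v).axis (st v).dir
  spokes : ∀ z, ∃ θ ε : ℝ, (ε = 1 ∨ ε = -1) ∧
    (∀ w, IsChild G r w z → spokeDir (deg G z) θ ε (P.sp z w) = -(st z).dir) ∧
    ∀ v, IsChild G r z v → spokeDir (deg G z) θ ε (P.sp z v) = (st v).dir

/-- The spoke to the parent fixes the rotation and leaves the reflection for `exists_turn`. At the
root the heavy spoke is simply turned into the axis. -/
theorem exists_rotation (P : Plan G r h) (hG : G.IsTree) (z : V) {dir axis : ℂ} (hd : ‖dir‖ = 1)
    (ha : ‖axis‖ = 1) (hp : 1 / 2 ≤ proj axis dir) : ∃ θ ε : ℝ, (ε = 1 ∨ ε = -1) ∧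
      (∀ w, IsChild G r w z → spokeDir (deg G z) θ ε (P.sp z w) = -dir) ∧
      ∀ v, h z = some v → 1 / 2 ≤ proj axis (spokeDir (deg G z) θ ε (P.sp z v)) := by
  by_cases hw : ∃ w, IsChild G r w z
  · obtain ⟨w, hw⟩ := hw
    have hu : ∀ w', IsChild G r w' z → w' = w := fun w' h' => h'.unique hG hw
    cases hz : h z with
    | none =>
      obtain ⟨θ, hθ⟩ := exists_spokeDir_eq (deg G z) 1 (P.sp z w)
        (show ‖-dir‖ = 1 by rw [norm_neg, hd])
      refine ⟨θ, 1, Or.inl rfl, fun w' h' => by rw [hu w' h', hθ], by simp⟩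
    | some v =>
      obtain ⟨θ, ε, hε, h1, h2⟩ := exists_turn ((P.star z).angle w v (P.eqF w z v hw hz)) hd ha hp
      refine ⟨θ, ε, hε, fun w' h' => by rw [hu w' h', h1], ?_⟩
      rintro v' hv'
      rw [← Option.some.inj hv']
      exact h2
  · push Not at hw
    cases hz : h z with
    | none => exact ⟨0, 1, Or.inl rfl, fun w h' => (hw w h').elim, by simp⟩
    | some v =>
      obtain ⟨θ, hθ⟩ := exists_spokeDir_eq (deg G z) 1 (P.sp z v) ha
      refine ⟨θ, 1, Or.inl rfl, fun w h' => (hw w h').elim, ?_⟩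
      rintro v' hv'
      rw [← Option.some.inj hv', hθ, proj_self axis ha]
      norm_num

theorem exists_isPlanDrawing [Finite V] (P : Plan G r h) (hG : G.IsTree)
    (hh : IsHeavyChoice G r h) : ∃ st, IsPlanDrawing P st := by
  classical
  let Valid : V → VertexState → Prop := fun v s => ‖s.dir‖ = 1 ∧ ‖s.axis‖ = 1 ∧
    ‖s.pos - s.top‖ + P.y v = s.reach ∧ 1 / 2 ≤ proj s.axis s.dir
  let Rel : V → VertexState → (V → VertexState) → Prop := fun z s n =>
    ∃ θ ε : ℝ, (ε = 1 ∨ ε = -1) ∧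
      (∀ w, IsChild G r w z → spokeDir (deg G z) θ ε (P.sp z w) = -s.dir) ∧
      ∀ v, IsChild G r z v → spokeDir (deg G z) θ ε (P.sp z v) = (n v).dir ∧
        ((n v).pos = s.pos + (n v).len * (n v).dir ∧ 0 < (n v).len) ∧
        (h z ≠ some v → (n v).len = P.cd z v ∧ (n v).top = (n v).pos ∧
          (n v).axis = (n v).dir ∧ (n v).reach = P.y v) ∧
        (h z = some v → (n v).top = s.top ∧ (n v).axis = s.axis ∧
          ‖(n v).pos - (n v).top‖ = s.reach + P.y z + P.y v ∧
          1 / 2 ≤ proj (n v).axis (n v).dir)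
  have hRel : ∀ z s n n', (∀ v, IsChild G r z v → n v = n' v) → Rel z s n → Rel z s n' := by
    rintro z s n n' hn ⟨θ, ε, h1, h2, h3⟩
    refine ⟨θ, ε, h1, h2, fun v hv => ?_⟩
    rw [← hn v hv]
    exact h3 v hv
  -- The root has no parent edge: its direction only serves as the axis, and its length is
  -- arbitrary.
  let s₀ : VertexState := ⟨0, 1, 1, 0, 1, P.y r⟩
  have h₀ : Valid r s₀ := by
    refine ⟨by simp [s₀], by simp [s₀], by simp [s₀], ?_⟩
    change 1 / 2 ≤ proj 1 1
    rw [proj_self 1 (by simp)]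
    norm_num
  have hstep : ∀ z s, Valid z s → ∃ n, Rel z s n ∧ ∀ v, IsChild G r z v → Valid v (n v) := by
    rintro z s ⟨hd, ha, hr, hp⟩
    obtain ⟨θ, ε, hε, hpar, hheavy⟩ := exists_rotation P hG z hd ha hp
    have ht : ∀ v, ∃ t : ℝ, h z = some v → 0 < t ∧
        ‖s.pos + t * spokeDir (deg G z) θ ε (P.sp z v) - s.top‖ = s.reach + P.y z + P.y v := by
      intro v
      by_cases hv : h z = some v
      -- The disk of radius `P.y v` about the next path node has to clear the disk reached so far,
      -- with a spare gap of width `P.y z`.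
      · obtain ⟨t, ht0, ht⟩ := exists_norm_add_mul_eq (q := s.pos - s.top)
          (ρ := s.reach + P.y z + P.y v) (by linarith [P.half_le_y hv, P.y_nonneg hh v])
          (norm_spokeDir (deg G z) θ ε (P.sp z v))
        refine ⟨t, fun _ => ⟨ht0, ?_⟩⟩
        rw [← ht]
        congr 1
        ring
      · exact ⟨0, fun h' => (hv h').elim⟩
    choose t ht using ht
    let n : V → VertexState := fun v =>
      if h z = some v then
        ⟨s.pos + t v * spokeDir (deg G z) θ ε (P.sp z v), spokeDir (deg G z) θ ε (P.sp z v), t v,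
          s.top, s.axis, s.reach + P.y z + P.y v + P.y v⟩
      else
        ⟨s.pos + P.cd z v * spokeDir (deg G z) θ ε (P.sp z v), spokeDir (deg G z) θ ε (P.sp z v),
          P.cd z v, s.pos + P.cd z v * spokeDir (deg G z) θ ε (P.sp z v),
          spokeDir (deg G z) θ ε (P.sp z v), P.y v⟩
    refine ⟨n, ⟨θ, ε, hε, hpar, ?_⟩, ?_⟩
    · intro v hv
      by_cases hzv : h z = some v
      · simp only [n, hzv, if_true, true_and, ne_eq, not_true_eq_false, false_imp_iff, true_imp_iff]
        exact ⟨(ht v hzv).1, (ht v hzv).2, hheavy v hzv⟩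
      · simp only [n, hzv, if_false, true_and, ne_eq, not_false_eq_true, true_imp_iff,
          false_imp_iff, and_true]
        have := (P.star z).le_cd v ((P.memL z v).2 ⟨hv, hzv⟩)
        linarith [P.one_le_X hh v]
    · intro v hv
      by_cases hzv : h z = some v
      · simp only [Valid, n, hzv, if_true]
        refine ⟨norm_spokeDir _ _ _ _, ha, ?_, hheavy v hzv⟩
        rw [(ht v hzv).2]
      · simp only [Valid, n, hzv, if_false]
        refine ⟨norm_spokeDir _ _ _ _, norm_spokeDir _ _ _ _, by simp, ?_⟩
        rw [proj_self _ (norm_spokeDir _ _ _ _)]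
        norm_num
  obtain ⟨st, hst0, hst⟩ := exists_state hG Valid Rel hRel s₀ h₀ hstep
  refine ⟨st, fun v => (hst v).1.1, fun v => (hst v).1.2.1, fun v => (hst v).1.2.2.1, ?_, ?_, ?_,
    ?_, ?_⟩
  · rw [hst0]
    exact ⟨rfl, rfl, rfl⟩
  · intro z v hv
    obtain ⟨θ, ε, -, -, h3⟩ := (hst z).2
    exact (h3 v hv).2.1
  · intro z v hv
    obtain ⟨θ, ε, -, -, h3⟩ := (hst z).2
    exact (h3 v hv.1).2.2.1 hv.2
  · intro z v hv
    obtain ⟨θ, ε, -, -, h3⟩ := (hst z).2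
    exact (h3 v (hh.isChild z v hv)).2.2.2 hv
  · intro z
    obtain ⟨θ, ε, h1, h2, h3⟩ := (hst z).2
    exact ⟨θ, ε, h1, h2, fun v hv => (h3 v hv).1⟩

end Construction


/-! ### Planarity -/

theorem norm_sub_sq_of_norm_eq_one {u v : ℂ} (hu : ‖u‖ = 1) (hv : ‖v‖ = 1) (a b : ℝ) :
    ‖(a : ℂ) * u - b * v‖ ^ 2 = a ^ 2 + b ^ 2 - 2 * a * b * proj u v := by
  have e1 : u.re * u.re + u.im * u.im = 1 := by
    rw [← Complex.normSq_apply, Complex.normSq_eq_norm_sq, hu]; norm_num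
  have e2 : v.re * v.re + v.im * v.im = 1 := by
    rw [← Complex.normSq_apply, Complex.normSq_eq_norm_sq, hv]; norm_num
  rw [← Complex.normSq_eq_norm_sq, Complex.normSq_apply, proj]
  simp only [Complex.sub_re, Complex.mul_re, Complex.ofReal_re, Complex.ofReal_im, Complex.sub_im,
    Complex.mul_im, Complex.conj_re, Complex.conj_im]
  linear_combination a ^ 2 * e1 + b ^ 2 * e2

theorem proj_spokeDir (d : ℕ) (θ : ℝ) {ε : ℝ} (hε : ε = 1 ∨ ε = -1) (s t : ℕ) :
    proj (spokeDir d θ ε s) (spokeDir d θ ε t) = cosAng d s t := by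
  have h1 : spokeDir d θ ε s * (starRingEnd ℂ) (spokeDir d θ ε s) = 1 := by
    rw [Complex.mul_conj, Complex.normSq_eq_norm_sq, norm_spokeDir]; norm_num
  rw [proj, spokeDir_eq_mul d θ ε s t, mul_right_comm, h1, one_mul, Complex.exp_ofReal_mul_I_re,
    cosAng]
  rcases hε with rfl | rfl
  · rw [one_mul, ← Real.cos_neg]; congr 1; ring
  · congr 1; ring

theorem cosAng_le_cos {d s t : ℕ} (hs : s < d) (ht : t < d) (hst : s ≠ t) :
    cosAng d s t ≤ Real.cos (2 * Real.pi / d) := by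
  wlog hlt : s < t generalizing s t
  · rw [cosAng_comm]; exact this ht hs hst.symm (by omega)
  have hd : (0 : ℝ) < d := by exact_mod_cast (by omega : 0 < d)
  have hpi := Real.pi_pos
  have h1 : (s : ℝ) + 1 ≤ t := by exact_mod_cast hlt
  have h2 : (t : ℝ) + 1 ≤ d := by exact_mod_cast ht
  have h3 : (0 : ℝ) ≤ s := by positivity
  rw [cosAng_comm, cosAng]
  apply cos_le_cos_of_mem (by positivity)
  · apply div_le_div_of_nonneg_right _ hd.le
    nlinarith
  · rw [le_sub_iff_add_le, ← add_div, div_le_iff₀ hd]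
    nlinarith

theorem cosAng_lt_one {d s t : ℕ} (hs : s < d) (ht : t < d) (hst : s ≠ t) : cosAng d s t < 1 := by
  have hd : (2 : ℝ) ≤ d := by exact_mod_cast (by omega : 2 ≤ d)
  have hpi := Real.pi_pos
  refine (cosAng_le_cos hs ht hst).trans_lt ?_
  rw [← Real.cos_zero]
  apply Real.cos_lt_cos_of_nonneg_of_le_pi le_rfl
  · rw [div_le_iff₀ (by linarith)]; nlinarith
  · positivity

section Planarity

variable {V : Type*} {G : SimpleGraph V} {r : V} {h : V → Option V} {P : Plan G r h}
  {st : V → VertexState}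

theorem isChild_cases {z v : V} (hv : IsChild G r z v) : h z = some v ∨ IsLightChild G r h z v := by
  by_cases e : h z = some v
  · exact Or.inl e
  · exact Or.inr ⟨hv, e⟩

/-- The part of the drawing added with `v`: its position, and the edge from the parent without
the position of the parent. -/
def arm (r : V) (st : V → VertexState) (v : V) : Set ℂ :=
  {q | ∃ s : ℝ, 0 ≤ s ∧ (s = 0 ∨ v ≠ r ∧ s < (st v).len) ∧ q = (st v).pos - s * (st v).dir}

/-- The scalar product with the axis, measured from the top node of the heavy path. -/
noncomputable def VertexState.height (s : VertexState) (q : ℂ) : ℝ := proj s.axis (q - s.top)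

theorem pos_mem_arm (r : V) (st : V → VertexState) (v : V) : (st v).pos ∈ arm r st v :=
  ⟨0, le_rfl, Or.inl rfl, by simp⟩

namespace IsPlanDrawing

theorem exists_of_mem_arm (D : IsPlanDrawing P st) {z v : V} (hv : IsChild G r z v) {q : ℂ}
    (hq : q ∈ arm r st v) :
    ∃ a : ℝ, 0 < a ∧ a ≤ (st v).len ∧ q = (st z).pos + a * (st v).dir := by
  obtain ⟨s, h0, h1, rfl⟩ := hq
  obtain ⟨e, hl⟩ := D.step z v hv
  have h2 : s < (st v).len := by
    rcases h1 with rfl | h1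
    · exact hl
    · exact h1.2
  exact ⟨(st v).len - s, by linarith, by linarith, by rw [e]; push_cast; ring⟩

theorem exists_dirs (D : IsPlanDrawing P st) (z : V) : ∃ U : V → ℂ, (∀ w, ‖U w‖ = 1) ∧
    (∀ v w, proj (U v) (U w) = cosAng (deg G z) (P.sp z v) (P.sp z w)) ∧
    (∀ w, IsChild G r w z → U w = -(st z).dir) ∧ ∀ v, IsChild G r z v → U v = (st v).dir := by
  obtain ⟨θ, ε, hε, h1, h2⟩ := D.spokes z
  exact ⟨fun w => spokeDir (deg G z) θ ε (P.sp z w), fun w => norm_spokeDir _ _ _ _,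
    fun v w => proj_spokeDir _ _ hε _ _, h1, h2⟩

theorem mem_or_mem_of_adj {z v : V} (P : Plan G r h) (hv : G.Adj z v) : v ∈ P.L z ∨ v ∈ P.F z := by
  rw [P.memL, P.memF]
  tauto

theorem dirs_ne {z v w : V} (hv : G.Adj z v) (hw : G.Adj z w) (hvw : v ≠ w) {U : V → ℂ}
    (hU : ∀ w, ‖U w‖ = 1)
    (hp : ∀ v w, proj (U v) (U w) = cosAng (deg G z) (P.sp z v) (P.sp z w)) {a b : ℝ}
    (ha : 0 < a) (hb : 0 ≤ b) (he : (a : ℂ) * U v = b * U w) : False := by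
  have hab : a = b := by
    have := congrArg norm he
    simpa [hU, abs_of_pos ha, abs_of_nonneg hb] using this
  have e := norm_sub_sq_of_norm_eq_one (hU v) (hU w) a b
  rw [he, sub_self, norm_zero, hp, ← hab] at e
  have mv := mem_or_mem_of_adj P hv
  have mw := mem_or_mem_of_adj P hw
  have := cosAng_lt_one ((P.star z).lt v mv) ((P.star z).lt w mw)
    (fun e => hvw ((P.star z).inj v w mv mw e))
  nlinarith [mul_pos ha ha]

theorem light_pos (D : IsPlanDrawing P st) {z c : V} (hc : IsLightChild G r h z c) :
    (st c).pos = (st z).pos + P.cd z c * (st c).dir := by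
  rw [(D.step z c hc.1).1, (D.light z c hc).1]

/-- A light child with its exclusive disk and the edge to it does not meet a ray from the parent
along a spoke without a balloon. -/
theorem light_disjoint_ray [Finite V] (D : IsPlanDrawing P st) (hh : IsHeavyChoice G r h)
    {z c w : V} (hc : IsLightChild G r h z c) (hw : G.Adj z w) (hw' : ¬ IsLightChild G r h z w)
    {U : V → ℂ} (hU : ∀ w, ‖U w‖ = 1)
    (hp : ∀ v w, proj (U v) (U w) = cosAng (deg G z) (P.sp z v) (P.sp z w))
    (hd : U c = (st c).dir) {a : ℝ} (ha : 0 ≤ a) {q : ℂ} (hq : q = (st z).pos + a * U w) :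
    q ∉ arm r st c ∪ Metric.ball (st c).pos (P.X c) := by
  rintro (hm | hm)
  · obtain ⟨b, h0, -, e⟩ := D.exists_of_mem_arm hc.1 hm
    rw [hq, ← hd, add_right_inj] at e
    exact dirs_ne hc.1.1 hw (by rintro rfl; exact hw' hc) hU hp h0 ha e.symm
  · have hr := (P.star z).ray c ((P.memL z c).2 hc) w ((P.memF z w).2 ⟨hw, hw'⟩) a ha
    simp only at hr
    have e := norm_sub_sq_of_norm_eq_one (hU c) (hU w) (P.cd z c) a
    rw [hp] at e
    rw [Metric.mem_ball, dist_comm, dist_eq_norm, D.light_pos hc, hq, add_sub_add_left_eq_sub,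
      ← hd] at hm
    have hX := P.one_le_X hh c
    nlinarith [norm_nonneg ((P.cd z c : ℂ) * U c - a * U w)]

theorem light_disjoint_light [Finite V] (D : IsPlanDrawing P st) (hh : IsHeavyChoice G r h)
    {z c c' : V} (hc : IsLightChild G r h z c) (hc' : IsLightChild G r h z c') (hne : c ≠ c')
    {q : ℂ} (hq : q ∈ arm r st c ∪ Metric.ball (st c).pos (P.X c)) :
    q ∉ arm r st c' ∪ Metric.ball (st c').pos (P.X c') := by
  obtain ⟨U, hU, hp, -, hd⟩ := D.exists_dirs z
  have aux : ∀ c c', IsLightChild G r h z c → IsLightChild G r h z c' → c ≠ c' →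
      q ∈ arm r st c → q ∈ Metric.ball (st c').pos (P.X c') → False := by
    intro c c' hc hc' hne hq hm
    obtain ⟨a, h0, h1, rfl⟩ := D.exists_of_mem_arm hc.1 hq
    rw [(D.light z c hc).1] at h1
    have hr := ((P.star z).compat c ((P.memL z c).2 hc) c' ((P.memL z c').2 hc') hne).right a h0.le h1
    simp only at hr
    have e := norm_sub_sq_of_norm_eq_one (hU c) (hU c') a (P.cd z c')
    rw [hp] at e
    rw [Metric.mem_ball, dist_eq_norm, D.light_pos hc', add_sub_add_left_eq_sub, ← hd _ hc.1,
      ← hd _ hc'.1] at hm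
    have hX := P.one_le_X hh c'
    nlinarith [norm_nonneg ((a : ℂ) * U c - P.cd z c' * U c')]
  rintro (hm | hm) <;> rcases hq with hq | hq
  · obtain ⟨a, h0, h1, rfl⟩ := D.exists_of_mem_arm hc.1 hq
    obtain ⟨b, h2, h3, e⟩ := D.exists_of_mem_arm hc'.1 hm
    rw [← hd _ hc.1, ← hd _ hc'.1, add_right_inj] at e
    exact dirs_ne hc.1.1 hc'.1.1 hne hU hp h0 h2.le e
  · exact aux c' c hc' hc hne.symm hm hq
  · exact aux c c' hc hc' hne hq hm
  · have hr := ((P.star z).compat c ((P.memL z c).2 hc) c' ((P.memL z c').2 hc') hne).disks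
    simp only at hr
    have e := norm_sub_sq_of_norm_eq_one (hU c) (hU c') (P.cd z c) (P.cd z c')
    rw [hp] at e
    have h1 : dist (st c).pos (st c').pos < P.X c + P.X c' := by
      have := dist_triangle_left (st c).pos (st c').pos q
      rw [Metric.mem_ball] at hq hm
      linarith
    rw [dist_eq_norm, D.light_pos hc, D.light_pos hc', add_sub_add_left_eq_sub, ← hd _ hc.1,
      ← hd _ hc'.1] at h1
    nlinarith [norm_nonneg ((P.cd z c : ℂ) * U c - P.cd z c' * U c'), P.one_le_X hh c,
      P.one_le_X hh c']

theorem cd_add_X_le {z c : V} (hc : IsLightChild G r h z c) :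
    P.cd z c + P.X c ≤ P.x z := by
  rw [P.x_eq]
  exact (P.star z).cover c ((P.memL z c).2 hc)

/-- A light child with its exclusive disk and the edge to it lies in the covering disk. -/
theorem norm_lt_of_mem_light [Finite V] (D : IsPlanDrawing P st) (hh : IsHeavyChoice G r h)
    {z c : V} (hc : IsLightChild G r h z c) {q : ℂ}
    (hq : q ∈ arm r st c ∪ Metric.ball (st c).pos (P.X c)) :
    q ≠ (st z).pos ∧ ‖q - (st z).pos‖ < P.y z := by
  have h1 := cd_add_X_le (P := P) hc
  have h2 := P.x_le_y hh z
  have h3 := P.one_le_X hh c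
  have h4 := (P.star z).le_cd c ((P.memL z c).2 hc)
  have h5 : ‖(P.cd z c : ℂ) * (st c).dir‖ = P.cd z c := by
    rw [norm_mul, D.norm_dir, mul_one, Complex.norm_real, Real.norm_of_nonneg (by linarith)]
  rcases hq with hq | hq
  · obtain ⟨a, h6, h7, rfl⟩ := D.exists_of_mem_arm hc.1 hq
    rw [(D.light z c hc).1] at h7
    have h8 : ‖(a : ℂ) * (st c).dir‖ = a := by
      rw [norm_mul, D.norm_dir, mul_one, Complex.norm_real, Real.norm_of_nonneg h6.le]
    refine ⟨?_, ?_⟩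
    · intro e
      rw [add_eq_left] at e
      rw [e, norm_zero] at h8
      linarith
    · rw [add_sub_cancel_left, h8]; linarith
  · rw [D.light_pos hc, Metric.mem_ball, dist_eq_norm] at hq
    refine ⟨?_, ?_⟩
    · rintro rfl
      rw [sub_add_cancel_left, norm_neg, h5] at hq
      linarith
    · have := norm_add_le (q - ((st z).pos + P.cd z c * (st c).dir)) (P.cd z c * (st c).dir)
      rw [h5] at this
      have e : q - ((st z).pos + P.cd z c * (st c).dir) + P.cd z c * (st c).dir =
        q - (st z).pos := by ring
      rw [e] at this
      linarith

theorem height_heavy (D : IsPlanDrawing P st) {z v : V} (hv : h z = some v) :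
    (st v).height = (st z).height := by
  funext q
  simp only [VertexState.height, (D.heavy z v hv).1, (D.heavy z v hv).2.1]

/-- Along the edge, the distance from the top node grows from `reach - y z` to `reach + y z + y v`.
-/
theorem le_len_heavy (D : IsPlanDrawing P st) (hh : IsHeavyChoice G r h) {z v : V}
    (hv : h z = some v) : 2 * P.y z + P.y v ≤ (st v).len := by
  obtain ⟨e, hl⟩ := D.step z v (hh.isChild z v hv)
  obtain ⟨e1, -, e2, -⟩ := D.heavy z v hv
  have e3 := D.reach_eq z
  have := norm_add_le ((st z).pos - (st z).top) ((st v).len * (st v).dir)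
  rw [norm_mul, D.norm_dir, mul_one, Complex.norm_real, Real.norm_of_nonneg hl.le] at this
  have e4 : (st z).pos - (st z).top + (st v).len * (st v).dir = (st v).pos - (st v).top := by
    rw [e1, e]; ring
  rw [e4] at this
  linarith

/-- The edge makes an angle of at most π/3 with the axis, so at least half of the length is gained
in height. -/
theorem height_add (D : IsPlanDrawing P st) {z v : V} (hv : h z = some v) (a : ℝ) (ha : 0 ≤ a) :
    (st z).height (st z).pos + a / 2 ≤ (st z).height ((st z).pos + a * (st v).dir) := by
  obtain ⟨-, e1, -, e2⟩ := D.heavy z v hv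
  rw [e1] at e2
  have e : (st z).pos + a * (st v).dir - (st z).top =
    (st z).pos - (st z).top + a * (st v).dir := by ring
  simp only [VertexState.height, e, proj_add, proj_mul]
  nlinarith

/-- The spare gap is made for this: half of `2 * y z + y v` is at least `y z`, so the whole disk
about `z` is no higher than `v`. -/
theorem height_add_y_le (D : IsPlanDrawing P st) (hh : IsHeavyChoice G r h) {z v : V}
    (hv : h z = some v) : (st z).height (st z).pos + P.y z ≤ (st z).height (st v).pos := by
  obtain ⟨e, hl⟩ := D.step z v (hh.isChild z v hv)
  have := D.height_add hv _ hl.le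
  rw [← e] at this
  linarith [D.le_len_heavy hh hv, P.y_nonneg hh v]

theorem top_eq_of_isTop (D : IsPlanDrawing P st) (hG : G.IsTree) {u : V} (hu : IsTop h u) :
    (st u).top = (st u).pos ∧ (st u).axis = (st u).dir ∧ (st u).reach = P.y u := by
  by_cases e : u = r
  · rw [e]; exact D.root
  · obtain ⟨z, hz⟩ := exists_isChild hG e
    exact (D.light z u ⟨hz, hu z⟩).2

theorem height_pos_nonneg (D : IsPlanDrawing P st) (hG : G.IsTree) (hh : IsHeavyChoice G r h)
    (v : V) : 0 ≤ (st v).height (st v).pos := by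
  have key : ∀ v, Desc G r r v → 0 ≤ (st v).height (st v).pos := by
    intro v hv
    induction hv with
    | refl => simp [VertexState.height, D.root.1, proj]
    | @tail z v _ hv ih =>
      rcases isChild_cases (h := h) hv with hl | hl
      · rw [D.height_heavy hl]
        linarith [D.height_add_y_le hh hl, P.y_nonneg hh z]
      · simp [VertexState.height, (D.light z v hl).2.1, proj]
  exact key v (desc_root hG v)

/-- A bound for the distance between the top node of the heavy path of `z` and the drawing of the
part of the heavy path below `z`. -/
noncomputable def bound (P : Plan G r h) (st : V → VertexState) (z : V) : ℝ :=
  (st z).reach - 2 * P.y z + P.Z z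

/-- Going to the heavy child, `reach` gains `y z + 2 * y v` and `Z` loses `3 * y z`; the correction
by `-2 * y` balances this. -/
theorem bound_heavy (D : IsPlanDrawing P st) {z v : V} (hv : h z = some v) :
    bound P st v = bound P st z := by
  have e1 := D.reach_eq v
  obtain ⟨-, -, e2, -⟩ := D.heavy z v hv
  rw [bound, bound, P.Z_some z v hv, ← e1, e2]
  ring

theorem reach_le_bound [Finite V] (hh : IsHeavyChoice G r h) (z : V) :
    (st z).reach ≤ bound P st z := by
  rw [bound]
  cases hz : h z with
  | none => rw [P.Z_leaf z hz, P.y_leaf z hz]; linarith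
  | some v => rw [P.Z_some z v hz]; linarith [P.y_nonneg hh z, P.Z_nonneg hh v]

theorem reach_heavy (D : IsPlanDrawing P st) {z v : V} (hv : h z = some v) :
    (st v).reach = (st z).reach + P.y z + 2 * P.y v := by
  rw [← D.reach_eq v, (D.heavy z v hv).2.2.1]; ring

/-- The arm of a heavy child lies in the disk about the top node that reaches its end. -/
theorem norm_le_of_mem_arm_heavy (D : IsPlanDrawing P st) (hh : IsHeavyChoice G r h) {z v : V}
    (hv : h z = some v) {q : ℂ} (hq : q ∈ arm r st v) :
    ‖q - (st v).top‖ ≤ ‖(st v).pos - (st v).top‖ := by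
  obtain ⟨a, h0, h1, rfl⟩ := D.exists_of_mem_arm (hh.isChild z v hv) hq
  obtain ⟨e, hl⟩ := D.step z v (hh.isChild z v hv)
  obtain ⟨e1, -, e2, -⟩ := D.heavy z v hv
  have e3 := D.reach_eq z
  have hz : ‖(st z).pos - (st v).top‖ ≤ ‖(st v).pos - (st v).top‖ := by
    rw [e2, e1]; linarith [P.y_nonneg hh z, P.y_nonneg hh v]
  have hconv := convex_closedBall (st v).top ‖(st v).pos - (st v).top‖
  have := hconv (x := (st z).pos) (by rwa [mem_closedBall_iff_norm]) (y := (st v).pos)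
    (by rw [mem_closedBall_iff_norm]) (a := 1 - a / (st v).len) (b := a / (st v).len)
    (by rw [sub_nonneg, div_le_one hl]; exact h1) (by positivity) (by ring)
  rw [mem_closedBall_iff_norm] at this
  have hl' : ((st v).len : ℂ) ≠ 0 := by exact_mod_cast hl.ne'
  have e4 : (1 - a / (st v).len) • (st z).pos + (a / (st v).len) • (st v).pos =
      (st z).pos + a * (st v).dir := by
    rw [e]
    simp only [Complex.real_smul]
    push_cast
    field_simp
    ring
  rwa [e4] at this

/-- At the top node the bound is `X u - y u`. Strictness puts the arms of proper descendants into
the open exclusive disk. -/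
theorem bound_lt_X {u v : V} (hu : (st u).reach = P.y u) (hv : h u = some v) : bound P st u < P.X u := by
  rw [bound, hu, P.X_some u v hv]
  linarith [P.half_le_y hv]

/-- The arms of all proper descendants are close to the top node of the heavy path. -/
theorem norm_le_bound [Finite V] (D : IsPlanDrawing P st) (hh : IsHeavyChoice G r h) (z : V) :
    ∀ w, Desc G r z w → w ≠ z → ∀ q ∈ arm r st w, ‖q - (st z).top‖ ≤ bound P st z := by
  induction z using (wellFounded_child G r).induction with
  | _ z ih =>
    intro w hw hwz q hq
    rcases hw.cases_head with rfl | ⟨c, hc, hcw⟩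
    · exact absurd rfl hwz
    rcases isChild_cases (h := h) hc with hl | hl
    · rw [← D.bound_heavy hl, ← (D.heavy z c hl).1]
      by_cases e : w = c
      · subst e
        have := D.norm_le_of_mem_arm_heavy hh hl hq
        linarith [D.reach_eq w, P.y_nonneg hh w, reach_le_bound (P := P) (st := st) hh w]
      · exact ih c hc w hcw e q hq
    · have hm : q ∈ arm r st c ∪ Metric.ball (st c).pos (P.X c) := by
        by_cases e : w = c
        · subst e
          exact Or.inl hq
        · right
          have h1 := ih c hc w hcw e q hq
          obtain ⟨-, e1, -, e2⟩ := D.light z c hl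
          rcases hcw.cases_head with rfl | ⟨c', hc', -⟩
          · exact absurd rfl e
          · obtain ⟨v, hv⟩ := Option.ne_none_iff_exists'.1 (hh.exists_of_child c c' hc')
            rw [mem_ball_iff_norm, ← e1]
            exact h1.trans_lt (bound_lt_X e2 hv)
      have h1 := (D.norm_lt_of_mem_light hh hl hm).2
      have h2 := norm_sub_le_norm_sub_add_norm_sub q (st z).pos (st z).top
      linarith [D.reach_eq z, reach_le_bound (P := P) (st := st) hh z]

/-- The arms of all descendants of a light child lie in its exclusive disk and the edge to it. -/
theorem mem_light_of_desc [Finite V] (D : IsPlanDrawing P st) (hh : IsHeavyChoice G r h) {z c w : V}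
    (hc : IsLightChild G r h z c) (hw : Desc G r c w) {q : ℂ} (hq : q ∈ arm r st w) :
    q ∈ arm r st c ∪ Metric.ball (st c).pos (P.X c) := by
  by_cases e : w = c
  · subst e
    exact Or.inl hq
  · right
    have h1 := D.norm_le_bound hh c w hw e q hq
    obtain ⟨-, e1, -, e2⟩ := D.light z c hc
    rcases hw.cases_head with rfl | ⟨c', hc', -⟩
    · exact absurd rfl e
    · obtain ⟨v, hv⟩ := Option.ne_none_iff_exists'.1 (hh.exists_of_child c c' hc')
      rw [mem_ball_iff_norm, ← e1]
      exact h1.trans_lt (bound_lt_X e2 hv)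

/-- The points `q` that are at least `ξ` high, or in a disk that lies outside the disk of radius `R`
about the top node and has a centre of nonnegative height. -/
def Far (s : VertexState) (R ξ : ℝ) (q : ℂ) : Prop :=
  ξ ≤ s.height q ∨ ∃ m ρ, ‖q - m‖ < ρ ∧ R + ρ ≤ ‖m - s.top‖ ∧ 0 ≤ s.height m

/-- The edges of the heavy path only go up from `v`. A light subtree hanging at a path node stays in
the disk about this node, which clears radius `R` and whose centre is not below the top. -/
theorem far_of_desc [Finite V] (D : IsPlanDrawing P st) (hG : G.IsTree) (hh : IsHeavyChoice G r h)
    (v : V) : ∀ w, Desc G r v w → w ≠ v → ∀ q ∈ arm r st w, ∀ R ξ : ℝ,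
      R + P.y v ≤ ‖(st v).pos - (st v).top‖ → ξ ≤ (st v).height (st v).pos →
      Far (st v) R ξ q := by
  induction v using (wellFounded_child G r).induction with
  | _ v ih =>
    intro w hw hwv q hq R ξ hR hξ
    rcases hw.cases_head with rfl | ⟨c, hc, hcw⟩
    · exact absurd rfl hwv
    rcases isChild_cases (h := h) hc with hl | hl
    · by_cases e : w = c
      · subst e
        left
        obtain ⟨a, h0, -, rfl⟩ := D.exists_of_mem_arm hc hq
        linarith [D.height_add hl a h0.le]
      · obtain ⟨e1, e2, e3, -⟩ := D.heavy v c hl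
        have := ih c hc w hcw e q hq R ξ
          (by rw [e3]; linarith [D.reach_eq v, P.y_nonneg hh v])
          (by rw [D.height_heavy hl]; linarith [D.height_add_y_le hh hl, P.y_nonneg hh v])
        rwa [Far, D.height_heavy hl, e1] at this
    · right
      exact ⟨(st v).pos, P.y v, (D.norm_lt_of_mem_light hh hl (D.mem_light_of_desc hh hl hcw hq)).2,
        hR, D.height_pos_nonneg hG hh v⟩

theorem far_of_desc_heavy [Finite V] (D : IsPlanDrawing P st) (hG : G.IsTree)
    (hh : IsHeavyChoice G r h) {z v w : V} (hv : h z = some v) (hw : Desc G r v w) (hwv : w ≠ v)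
    {q : ℂ} (hq : q ∈ arm r st w) :
    Far (st z) (st z).reach ((st z).height (st v).pos) q := by
  obtain ⟨e1, e2, e3, -⟩ := D.heavy z v hv
  have := D.far_of_desc hG hh v w hw hwv q hq (st z).reach ((st z).height (st v).pos)
    (by rw [e3]; linarith [P.y_nonneg hh z]) (by rw [D.height_heavy hv])
  rwa [Far, D.height_heavy hv, e1] at this

theorem Far.lt_norm {s : VertexState} {R ξ : ℝ} {q : ℂ} (hq : Far s R ξ q) (h : s.height q < ξ) :
    R < ‖q - s.top‖ := by
  rcases hq with hq | ⟨m, ρ, h1, h2, -⟩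
  · linarith
  · have := norm_sub_le_norm_sub_add_norm_sub m q s.top
    rw [norm_sub_rev m q] at this
    linarith

/-- The drawings of the subtrees of a light and the heavy child are disjoint. -/
theorem light_disjoint_heavy [Finite V] (D : IsPlanDrawing P st) (hG : G.IsTree)
    (hh : IsHeavyChoice G r h) {z c v w : V} (hc : IsLightChild G r h z c) (hv : h z = some v)
    (hw : Desc G r v w) {q : ℂ} (hq : q ∈ arm r st w) :
    q ∉ arm r st c ∪ Metric.ball (st c).pos (P.X c) := by
  by_cases e : w = v
  · subst e
    obtain ⟨U, hU, hp, -, hd⟩ := D.exists_dirs z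
    have hw' := hh.isChild z w hv
    obtain ⟨a, h0, -, e⟩ := D.exists_of_mem_arm hw' hq
    rw [← hd _ hw'] at e
    exact D.light_disjoint_ray hh hc hw'.1 (fun hl => hl.2 hv) hU hp (hd _ hc.1) h0.le e
  · intro hm
    -- The light part lies in the disk of radius `y z` about `z`, hence within the reach of `z` and
    -- below the next path node; this excludes being far.
    have h1 := (D.norm_lt_of_mem_light hh hc hm).2
    have h2 := D.far_of_desc_heavy hG hh hv hw e hq
    have h3 := proj_le (st z).axis (q - (st z).pos) (D.norm_axis z)
    have h4 : proj (st z).axis (q - (st z).pos) = (st z).height q - (st z).height (st z).pos := by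
      rw [VertexState.height, VertexState.height, ← proj_sub]; congr 1; ring
    rw [h4] at h3
    have h5 := h2.lt_norm
      (by linarith [le_abs_self ((st z).height q - (st z).height (st z).pos),
        D.height_add_y_le hh hv])
    have h6 := norm_sub_le_norm_sub_add_norm_sub q (st z).pos (st z).top
    linarith [D.reach_eq z]

/-- The arm of a vertex lies on the spoke to the parent. -/
theorem exists_of_mem_arm_self (hG : G.IsTree) {z : V} {q : ℂ}
    (hq : q ∈ arm r st z) : q = (st z).pos ∨ ∃ w, IsChild G r w z ∧ ∃ a : ℝ, 0 ≤ a ∧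
      q = (st z).pos + a * (-(st z).dir) := by
  obtain ⟨s, h0, h1, rfl⟩ := hq
  by_cases e : z = r
  · left
    rcases h1 with rfl | h1
    · simp
    · exact absurd e h1.1
  · right
    obtain ⟨w, hw⟩ := exists_isChild hG e
    exact ⟨w, hw, s, h0, by ring⟩

theorem arm_disjoint_light [Finite V] (D : IsPlanDrawing P st) (hG : G.IsTree)
    (hh : IsHeavyChoice G r h) {z c : V} (hc : IsLightChild G r h z c) {q : ℂ}
    (hq : q ∈ arm r st z) : q ∉ arm r st c ∪ Metric.ball (st c).pos (P.X c) := by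
  rcases exists_of_mem_arm_self hG hq with rfl | ⟨w, hw, a, ha, e⟩
  · exact fun hm => (D.norm_lt_of_mem_light hh hc hm).1 rfl
  · obtain ⟨U, hU, hp, hd', hd⟩ := D.exists_dirs z
    rw [← hd' w hw] at e
    exact D.light_disjoint_ray hh hc hw.1.symm (fun hl => hw.not_isChild hl.1) hU hp (hd _ hc.1) ha e

/-- At a top node the arm runs against the axis, so it has nonpositive height; moving back along it
does not bring it closer to a centre of nonnegative height, and the disks in question do not contain
the top. At any other path node the arm stays within the distance of `z` from the top and no higher
than `z`. -/
theorem arm_disjoint_heavy [Finite V] (D : IsPlanDrawing P st) (hG : G.IsTree)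
    (hh : IsHeavyChoice G r h) {z v w : V} (hv : h z = some v) (hw : Desc G r v w) {q : ℂ}
    (hq : q ∈ arm r st w) : q ∉ arm r st z := by
  intro hm
  have hv' := hh.isChild z v hv
  by_cases e : w = v
  · subst e
    obtain ⟨b, h0, -, e⟩ := D.exists_of_mem_arm hv' hq
    obtain ⟨U, hU, hp, hd', hd⟩ := D.exists_dirs z
    rw [← hd w hv'] at e
    rcases exists_of_mem_arm_self hG hm with rfl | ⟨w', hw', a, ha, e'⟩
    · rw [left_eq_add] at e
      have := congrArg norm e
      rw [norm_mul, hU, mul_one, Complex.norm_real, Real.norm_of_nonneg h0.le, norm_zero] at this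
      linarith
    · rw [e', ← hd' w' hw', add_right_inj] at e
      exact dirs_ne hv'.1 hw'.1.symm (by rintro rfl; exact hv'.not_isChild hw') hU hp h0 ha e.symm
  · have hf := D.far_of_desc_heavy hG hh hv hw e hq
    have hy := P.half_le_y hv
    have hz := D.height_add_y_le hh hv
    by_cases ht : IsTop h z
    · obtain ⟨e1, e2, e3⟩ := D.top_eq_of_isTop hG ht
      obtain ⟨s, h0, -, rfl⟩ := hm
      have e4 : (st z).height ((st z).pos - s * (st z).dir) = -s := by
        rw [VertexState.height, e1, e2, sub_right_comm, sub_self, zero_sub, ← neg_mul,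
          ← Complex.ofReal_neg, proj_mul, proj_self _ (D.norm_dir z), mul_one]
      have e5 : (st z).height (st z).pos = 0 := by simp [VertexState.height, e1, proj]
      rcases hf with hf | ⟨m, ρ, h1, h2, h3⟩
      · linarith
      · have h4 : 0 < ρ := (norm_nonneg _).trans_lt h1
        have e6 : ‖(st z).pos - s * (st z).dir - m‖ ^ 2 =
            ‖m - (st z).top‖ ^ 2 + s ^ 2 + 2 * s * (st z).height m := by
          have hn := D.norm_dir z
          rw [VertexState.height, e1, e2, proj]
          generalize (st z).pos = t
          generalize (st z).dir = u at *
          have hu : u.re * u.re + u.im * u.im = 1 := by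
            rw [← Complex.normSq_apply, Complex.normSq_eq_norm_sq, hn]; norm_num
          rw [← Complex.normSq_eq_norm_sq, ← Complex.normSq_eq_norm_sq, Complex.normSq_apply,
            Complex.normSq_apply]
          simp only [Complex.sub_re, Complex.mul_re, Complex.ofReal_re, Complex.ofReal_im,
            Complex.sub_im, Complex.mul_im, Complex.conj_re, Complex.conj_im]
          linear_combination s ^ 2 * hu
        have h5 : ρ ^ 2 ≤ ‖m - (st z).top‖ ^ 2 :=
          pow_le_pow_left₀ h4.le (by linarith) 2
        have h6 : ‖(st z).pos - s * (st z).dir - m‖ ^ 2 < ρ ^ 2 :=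
          pow_lt_pow_left₀ h1 (norm_nonneg _) two_ne_zero
        nlinarith [mul_nonneg h0 h3]
    · unfold IsTop at ht
      push Not at ht
      obtain ⟨z', hz'⟩ := ht
      have h1 := D.norm_le_of_mem_arm_heavy hh hz' hm
      have h2 : (st z).height q ≤ (st z).height (st z).pos := by
        obtain ⟨s, h0, -, rfl⟩ := hm
        have h3 : 1 / 2 ≤ proj (st z).axis (st z).dir := (D.heavy z' z hz').2.2.2
        have e : (st z).pos - s * (st z).dir - (st z).top =
          (st z).pos - (st z).top - s * (st z).dir := by ring
        rw [VertexState.height, VertexState.height, e, proj_sub, proj_mul]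
        nlinarith
      have h3 := hf.lt_norm (by linarith)
      linarith [D.reach_eq z]

theorem arm_disjoint_desc [Finite V] (D : IsPlanDrawing P st) (hG : G.IsTree)
    (hh : IsHeavyChoice G r h) {z c w : V} (hc : IsChild G r z c) (hw : Desc G r c w) {q : ℂ}
    (hq : q ∈ arm r st w) : q ∉ arm r st z := by
  rcases isChild_cases (h := h) hc with hl | hl
  · exact D.arm_disjoint_heavy hG hh hl hw hq
  · exact fun hm => D.arm_disjoint_light hG hh hl hm (D.mem_light_of_desc hh hl hw hq)

/-- Arms of different vertices are disjoint. -/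
theorem eq_of_mem_arm [Finite V] (D : IsPlanDrawing P st) (hG : G.IsTree)
    (hh : IsHeavyChoice G r h) {v w : V} {q : ℂ} (hv : q ∈ arm r st v) (hw : q ∈ arm r st w) :
    v = w := by
  by_contra hne
  rcases desc_trichotomy (r := r) hG v w hne with ⟨c, hc, hd⟩ | ⟨c, hc, hd⟩ |
    ⟨z, c, c', hc, hc', hcc, hd, hd'⟩
  · exact D.arm_disjoint_desc hG hh hc hd hw hv
  · exact D.arm_disjoint_desc hG hh hc hd hv hw
  · rcases isChild_cases (h := h) hc with hl | hl <;> rcases isChild_cases (h := h) hc' with hl' | hl'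
    · exact hcc (Option.some.inj (hl.symm.trans hl'))
    · exact D.light_disjoint_heavy hG hh hl' hl hd hv (D.mem_light_of_desc hh hl' hd' hw)
    · exact D.light_disjoint_heavy hG hh hl hl' hd' hw (D.mem_light_of_desc hh hl hd hv)
    · have hm := D.mem_light_of_desc hh hl' hd' hw
      exact D.light_disjoint_light hh hl hl' hcc (D.mem_light_of_desc hh hl hd hv) hm

/-- The edge to a child consists of its arm and the position of the parent. -/
theorem mem_arm_of_mem_segment (D : IsPlanDrawing P st) {z v : V} (hv : IsChild G r z v) {q : ℂ}
    (hq : q ∈ segment ℝ (st z).pos (st v).pos) : q = (st z).pos ∨ q ∈ arm r st v := by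
  obtain ⟨e, hl⟩ := D.step z v hv
  rw [segment_eq_image'] at hq
  obtain ⟨t, ⟨h0, h1⟩, rfl⟩ := hq
  rcases h0.eq_or_lt with rfl | h0
  · left; simp
  · right
    refine ⟨(1 - t) * (st v).len, by nlinarith, Or.inr ⟨hv.ne_root, by nlinarith⟩, ?_⟩
    simp only [Complex.real_smul]
    rw [e]
    push_cast
    ring

theorem injective_pos [Finite V] (D : IsPlanDrawing P st) (hG : G.IsTree)
    (hh : IsHeavyChoice G r h) : Function.Injective fun v => (st v).pos := by
  intro v w he
  have := pos_mem_arm r st v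
  rw [show (st v).pos = (st w).pos from he] at this
  exact D.eq_of_mem_arm hG hh this (pos_mem_arm r st w)

/-- An edge is the arm of its child together with the position of the parent, which belongs to the
arm of the parent; so disjointness of arms decides all incidences. -/
theorem isPlanarStraightLine [Finite V] (D : IsPlanDrawing P st) (hG : G.IsTree)
    (hh : IsHeavyChoice G r h) : IsPlanarStraightLine G fun v => (st v).pos := by
  have hve : ∀ z v w, IsChild G r z v → (st w).pos ∈ segment ℝ (st z).pos (st v).pos →
      w = z ∨ w = v := by
    intro z v w hv hw
    rcases D.mem_arm_of_mem_segment hv hw with e | hm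
    · exact Or.inl (D.injective_pos hG hh e)
    · exact Or.inr (D.eq_of_mem_arm hG hh (pos_mem_arm r st w) hm)
  have hee : ∀ z v z' v', IsChild G r z v → IsChild G r z' v' → s(z, v) ≠ s(z', v') →
      segment ℝ (st z).pos (st v).pos ∩ segment ℝ (st z').pos (st v').pos ⊆
        (fun v => (st v).pos) '' (({z, v} : Set V) ∩ {z', v'}) := by
    rintro z v z' v' hv hv' hne q ⟨hq, hq'⟩
    rcases D.mem_arm_of_mem_segment hv hq with rfl | hm
    · exact ⟨z, ⟨Or.inl rfl, hve z' v' z hv' hq'⟩, rfl⟩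
    rcases D.mem_arm_of_mem_segment hv' hq' with rfl | hm'
    · exact ⟨z', ⟨hve z v z' hv hq, Or.inl rfl⟩, rfl⟩
    · have := D.eq_of_mem_arm hG hh hm hm'
      subst this
      rw [hv.unique hG hv'] at hne
      exact absurd rfl hne
  refine ⟨D.injective_pos hG hh, ?_, ?_⟩
  · intro u v w huv hw
    rcases isChild_or_isChild hG r huv with hc | hc
    · exact hve u v w hc hw
    · rw [segment_symm] at hw
      exact (hve v u w hc hw).symm
  · intro u v u' v' huv huv' hne
    rcases isChild_or_isChild hG r huv with hc | hc <;>
      rcases isChild_or_isChild hG r huv' with hc' | hc'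
    · exact hee u v u' v' hc hc' hne
    · rw [segment_symm ℝ (st u').pos, Set.pair_comm u' v']
      exact hee u v v' u' hc hc' (by rwa [Sym2.eq_swap (a := v')])
    · rw [segment_symm ℝ (st u).pos, Set.pair_comm u v]
      exact hee v u u' v' hc hc' (by rwa [Sym2.eq_swap (a := v)])
    · rw [segment_symm ℝ (st u).pos, Set.pair_comm u v, segment_symm ℝ (st u').pos,
        Set.pair_comm u' v']
      exact hee v u v' u' hc hc' (by rwa [Sym2.eq_swap (a := v), Sym2.eq_swap (a := v')])

end IsPlanDrawing

end Planarity


/-! ### Properties of the drawing -/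

section Properties

variable {V : Type*} {G : SimpleGraph V} {r : V} {h : V → Option V} {P : Plan G r h}
  {st : V → VertexState}

theorem isTop_root (hh : IsHeavyChoice G r h) : IsTop h r :=
  fun w hw => (hh.isChild w r hw).ne_root rfl

theorem OnHeavyPath.total {u z z' : V} (hz : OnHeavyPath h u z) (hz' : OnHeavyPath h u z') :
    OnHeavyPath h z z' ∨ OnHeavyPath h z' z :=
  Relation.ReflTransGen.total_of_right_unique
    (fun _ _ _ h1 h2 => Option.some.inj (h1.symm.trans h2)) hz hz'

namespace IsPlanDrawing

theorem dist_child (D : IsPlanDrawing P st) {z v : V} (hv : IsChild G r z v) :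
    dist (st z).pos (st v).pos = (st v).len := by
  obtain ⟨e, hl⟩ := D.step z v hv
  rw [e, dist_self_add_right, norm_mul, D.norm_dir, mul_one, Complex.norm_real,
    Real.norm_of_nonneg hl.le]

theorem one_le_len [Finite V] (D : IsPlanDrawing P st) (hh : IsHeavyChoice G r h) {z v : V}
    (hv : IsChild G r z v) : 1 ≤ (st v).len := by
  rcases isChild_cases (h := h) hv with hl | hl
  · linarith [D.le_len_heavy hh hl, P.half_le_y hl, P.y_nonneg hh v]
  · rw [(D.light z v hl).1]
    linarith [P.one_le_X hh v, (P.star z).le_cd v ((P.memL z v).2 hl)]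

theorem one_le_dist [Finite V] (D : IsPlanDrawing P st) (hG : G.IsTree) (hh : IsHeavyChoice G r h)
    {u v : V} (huv : G.Adj u v) : 1 ≤ dist (st u).pos (st v).pos := by
  rcases isChild_or_isChild hG r huv with hc | hc
  · rw [D.dist_child hc]; exact D.one_le_len hh hc
  · rw [dist_comm, D.dist_child hc]; exact D.one_le_len hh hc

/-- The edges at a vertex leave along its spokes. -/
theorem exists_pos_eq_of_adj (D : IsPlanDrawing P st) (hG : G.IsTree) {z : V} {U : V → ℂ}
    (hd' : ∀ w, IsChild G r w z → U w = -(st z).dir) (hd : ∀ v, IsChild G r z v → U v = (st v).dir)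
    {w : V} (hw : G.Adj z w) : ∃ t : ℝ, 0 < t ∧ (st w).pos = (st z).pos + t * U w := by
  rcases isChild_or_isChild hG r hw with hc | hc
  · obtain ⟨e, hl⟩ := D.step z w hc
    exact ⟨(st w).len, hl, by rw [hd w hc, e]⟩
  · obtain ⟨e, hl⟩ := D.step w z hc
    exact ⟨(st z).len, hl, by rw [hd' w hc, e]; ring⟩

theorem isGreedyStar (D : IsPlanDrawing P st) (hG : G.IsTree) (u : V) :
    IsGreedyStar G r h (fun v => (st v).pos) P.X u (P.x u) := by
  obtain ⟨θ, ε, hε, hd', hd⟩ := D.spokes u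
  refine ⟨P.L u, P.F u, θ, ε, hε, P.nodupL u, P.memL u, P.sortedL u, P.nodupF u, P.memF u, ?_, ?_,
    P.x_eq u⟩
  · rw [(P.star u).placed, List.forall₂_map_right_iff, List.forall₂_same]
    intro v hv
    rw [P.memL] at hv
    simp only
    rw [hd v hv.1, D.light_pos hv]
  · rw [(P.star u).free, List.forall₂_map_right_iff, List.forall₂_same]
    intro v hv
    rw [P.memF] at hv
    exact D.exists_pos_eq_of_adj hG (U := fun w => spokeDir (deg G u) θ ε (P.sp u w)) hd' hd hv.1

theorem reach_le_of_onHeavyPath [Finite V] (D : IsPlanDrawing P st) (hh : IsHeavyChoice G r h) {z w : V}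
    (hw : OnHeavyPath h z w) : (st w).top = (st z).top ∧ bound P st w = bound P st z ∧
      (st z).reach ≤ (st w).reach ∧
      (w ≠ z → (st z).reach + P.y w ≤ ‖(st w).pos - (st w).top‖) := by
  induction hw with
  | refl => exact ⟨rfl, rfl, le_rfl, fun e => absurd rfl e⟩
  | @tail b c _ hc ih =>
    obtain ⟨i1, i2, i3, -⟩ := ih
    obtain ⟨e1, -, e2, -⟩ := D.heavy b c hc
    refine ⟨e1.trans i1, (D.bound_heavy hc).trans i2, ?_, fun _ => ?_⟩
    · rw [D.reach_heavy hc]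
      linarith [P.y_nonneg hh b, P.y_nonneg hh c]
    · rw [e2]
      linarith [P.y_nonneg hh b]

/-- The disk about the later node lies outside the disk about the top node that covers everything up
to the earlier one. -/
theorem x_add_x_le_dist [Finite V] (D : IsPlanDrawing P st) (hh : IsHeavyChoice G r h) {z w : V}
    (hw : OnHeavyPath h z w) (hne : w ≠ z) :
    P.x z + P.x w ≤ dist (st z).pos (st w).pos := by
  obtain ⟨e1, -, -, h1⟩ := D.reach_le_of_onHeavyPath hh hw
  have h2 := h1 hne
  rw [e1] at h2
  have h3 := norm_sub_le_norm_sub_add_norm_sub (st w).pos (st z).pos (st z).top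
  rw [dist_comm, dist_eq_norm]
  linarith [P.x_le_y hh z, P.x_le_y hh w, D.reach_eq z]

theorem bound_le_X (D : IsPlanDrawing P st) (hG : G.IsTree) {u : V}
    (hu : IsTop h u) : bound P st u ≤ P.X u := by
  have e := (D.top_eq_of_isTop hG hu).2.2
  cases hv : h u with
  | none => rw [bound, e, P.y_leaf u hv, P.Z_leaf u hv, P.X_leaf u hv]; norm_num
  | some v => exact (bound_lt_X e hv).le

theorem isGreedyHeavyPathDrawing [Finite V] (D : IsPlanDrawing P st) (hG : G.IsTree)
    (hh : IsHeavyChoice G r h) :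
    IsGreedyHeavyPathDrawing G r h (fun v => (st v).pos) P.X P.x where
  leaf u _ hu := P.X_leaf u hu
  star u := D.isGreedyStar hG u
  cover_disjoint u z z' _ hz hz' hne := by
    rcases hz.total hz' with hp | hp
    · exact D.x_add_x_le_dist hh hp hne.symm
    · rw [add_comm, dist_comm]
      exact D.x_add_x_le_dist hh hp hne
  cover_subset u z hu hz := by
    obtain ⟨e1, e2, -, -⟩ := D.reach_le_of_onHeavyPath hh hz
    obtain ⟨e3, -, -⟩ := D.top_eq_of_isTop hG hu
    have h1 := D.reach_eq z
    rw [e1, e3] at h1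
    rw [dist_comm, dist_eq_norm]
    linarith [P.x_le_y hh z, reach_le_bound (P := P) (st := st) hh z, D.bound_le_X hG hu]
  subtree_subset u hu w hw := by
    rw [mem_closedBall_iff_norm]
    by_cases e : w = u
    · rw [e, sub_self, norm_zero]
      linarith [P.one_le_X hh u]
    · rw [mem_subtree_iff hG] at hw
      have := D.norm_le_bound hh u w hw e _ (pos_mem_arm r st w)
      rw [(D.top_eq_of_isTop hG hu).1] at this
      exact this.trans (D.bound_le_X hG hu)
  parent_outside u v hv := by
    rw [D.dist_child hv.1, (D.light u v hv).1]
    exact (P.star u).le_cd v ((P.memL u v).2 hv)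

theorem hasPerfectAngularResolution (D : IsPlanDrawing P st) (hG : G.IsTree) :
    HasPerfectAngularResolution G fun v => (st v).pos := by
  intro v u w hu hw hne
  obtain ⟨U, hU, hp, hd', hd⟩ := D.exists_dirs v
  obtain ⟨a, ha, ea⟩ := D.exists_pos_eq_of_adj hG hd' hd hu
  obtain ⟨b, hb, eb⟩ := D.exists_pos_eq_of_adj hG hd' hd hw
  have mu := mem_or_mem_of_adj P hu
  have mw := mem_or_mem_of_adj P hw
  have hs := (P.star v).lt u mu
  have ht := (P.star v).lt w mw
  have hst : P.sp v u ≠ P.sp v w := fun e => hne ((P.star v).inj u w mu mw e)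
  have hd2 : (2 : ℝ) ≤ deg G v := by exact_mod_cast (by omega : 2 ≤ deg G v)
  have hpi := Real.pi_pos
  have hin : inner ℝ (U u) (U w) = proj (U u) (U w) := by
    simp [proj, Complex.inner]
  simp only [EuclideanGeometry.angle, vsub_eq_sub, ea, eb, add_sub_cancel_left]
  rw [← Complex.real_smul, ← Complex.real_smul, InnerProductGeometry.angle_smul_left_of_pos _ _ ha,
    InnerProductGeometry.angle_smul_right_of_pos _ _ hb, InnerProductGeometry.angle, hU, hU, hin, hp,
    mul_one, div_one, ← Real.arccos_cos (x := 2 * Real.pi / deg G v) (by positivity)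
      (by rw [div_le_iff₀ (by linarith)]; nlinarith)]
  exact Real.arccos_le_arccos (cosAng_le_cos hs ht hst)

theorem drawing_subset [Finite V] (D : IsPlanDrawing P st) (hG : G.IsTree)
    (hh : IsHeavyChoice G r h) :
    drawing G (fun v => (st v).pos) ⊆ Metric.closedBall (st r).pos (P.X r) := by
  have hpos : ∀ w, (st w).pos ∈ Metric.closedBall (st r).pos (P.X r) := fun w =>
    (D.isGreedyHeavyPathDrawing hG hh).subtree_subset r (isTop_root hh) w
      ((mem_subtree_iff hG).2 (desc_root hG w))
  rintro q (⟨v, rfl⟩ | ⟨u, v, -, hq⟩)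
  · exact hpos v
  · exact (convex_closedBall _ _).segment_subset (hpos u) (hpos v) hq

end IsPlanDrawing

end Properties

end BalloonTree

/-! ### The theorem -/

theorem mainTheorem4 {V : Type*} [Fintype V] (G : SimpleGraph V) (hG : G.IsTree) (r : V)
    (h : V → Option V) (hh : BalloonTree.IsHeavyChoice G r h) :
    (∃ (p : V → ℂ) (X x : V → ℝ),
      BalloonTree.IsGreedyHeavyPathDrawing G r h p X x ∧
      BalloonTree.IsPlanarStraightLine G p ∧
      BalloonTree.HasPerfectAngularResolution G p ∧
      (∀ u v, G.Adj u v → 1 ≤ dist (p u) (p v)) ∧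
      ∃ c : ℂ, BalloonTree.drawing G p ⊆ Metric.closedBall c
        ((Fintype.card V : ℝ) ^ 2 * (Fintype.card V : ℝ) ^ Real.logb 2 BalloonTree.kappa)) ∧
    (2 ≤ Fintype.card V →
      (Fintype.card V : ℝ) ^ 2 * (Fintype.card V : ℝ) ^ Real.logb 2 BalloonTree.kappa <
        (Fintype.card V : ℝ) ^ (3.0367 : ℝ)) := by
  refine ⟨?_, fun hn => BalloonTree.sq_mul_rpow_lt hn⟩
  obtain ⟨P⟩ := BalloonTree.exists_plan hG hh
  obtain ⟨st, D⟩ := BalloonTree.exists_isPlanDrawing P hG hh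
  refine ⟨fun v => (st v).pos, P.X, P.x, D.isGreedyHeavyPathDrawing hG hh,
    D.isPlanarStraightLine hG hh, D.hasPerfectAngularResolution hG,
    fun u v huv => D.one_le_dist hG hh huv, (st r).pos, ?_⟩
  refine (D.drawing_subset hG hh).trans (Metric.closedBall_subset_closedBall ?_)
  have hcard : (0 : ℝ) < Fintype.card V := by
    have : Nonempty V := ⟨r⟩
    exact_mod_cast Fintype.card_pos
  have hsub : BalloonTree.subtree G r r = Set.univ :=
    Set.eq_univ_of_forall fun w =>
      (BalloonTree.mem_subtree_iff hG).2 (BalloonTree.desc_root hG w)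
  have := P.X_le hG hh r
  rwa [hsub, Set.ncard_univ, Nat.card_eq_fintype_card, Real.rpow_add hcard, Real.rpow_two] at this
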